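/- An instance $I$ of the Reward-Penalty-Selection Problem (RPSP) consists of players $N=\{1,\dots,n\}$ with $n\ge 1$, reward sets $A_1,\dots,A_h\subseteq N$ with rewards $a_1,\dots,a_h\ge 0$, and penalty sets $B_1,\dots,B_l\subseteq N$ with penalties $b_1,\dots,b_l\ge 0$. Solving it means computing a selection $X\subseteq N$ that maximizes $$\sum_{i:\,A_i\cap X\neq\emptyset} a_i-\sum_{j:\,B_j\subseteq X} b_j$$ together with the maximal value. If all reward sets are singletons, the reduced connection graph of $I$ is the bipartite graph whose nodes are the $h$ reward sets and the $l$ penalty sets, in which $A_i=\{u\}$ is adjacent to $B_j$ if and only if $u\in B_j$. For constants $c,C$ put $$T(m,k)=C\cdot m\left(2^{ck^3}+2^{k+1}\left(m^{k+1}\right)^2\right).$$ Theorem. There are constants $c,C\in\mathbb N$ and a single algorithm, on a random access machine with unit cost for addition, subtraction and comparison of natural and of real numbers and for (indirect) memory access, such that for every instance $I$ of the RPSP in which all reward sets are singletons, and every $k\in\mathbb N$ such that the reduced connection graph of $I$ has treewidth at most $k$, the algorithm solves $I$ in at most $T(m,k)$ steps, where $m=\max\{n,h\}+l$; this is the number $h+l$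 of nodes of the reduced connection graph whenever every player belongs to a reward set. If moreover the reward sets are pairwise distinct, the penalty sets are pairwise distinct, and every player belongs to a reward set (so that reward sets and players are identified), then the number of steps is at most $T(n,k)$, where $n$ is the number of players. Thus the RPSP is solved in time $O\bigl(n(2^{O(k^3)}+2^{k+1}(n^{k+1})^2)\bigr)$, with constants independent of the instance and of $k$. -/

import Mathlib

/-! ### Tree decompositions and treewidth -/

/-- A tree decomposition of `G`: a finite tree `T` with a bag of vertices at every node, such that
every vertex lies in a bag, both ends of every edge lie in a common bag, and the nodes whose bags
contain a given vertex induce a connected subgraph of `T`. -/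
structure TreeDecomposition {V : Type} (G : SimpleGraph V) where
  size : ℕ
  T : SimpleGraph (Fin size)
  isTree : T.IsTree
  bag : Fin size → Finset V
  vertex_mem : ∀ v, ∃ t, v ∈ bag t
  edge_mem : ∀ v w, G.Adj v w → ∃ t, v ∈ bag t ∧ w ∈ bag t
  connected : ∀ v, (T.induce {t | v ∈ bag t}).Connected

/-- The width: the maximal size of a bag, minus one. -/
def TreeDecomposition.width {V : Type} {G : SimpleGraph V} (D : TreeDecomposition G) : ℕ :=
  (Finset.univ.sup fun t => (D.bag t).card) - 1

/-- The treewidth of a finite graph: the least width of a tree decomposition. -/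
noncomputable def treewidth {V : Type} [Finite V] (G : SimpleGraph V) : ℕ :=
  sInf {w | ∃ D : TreeDecomposition G, D.width = w}

/-! ### The Reward-Penalty-Selection Problem -/

/-- An instance: players `0, …, n - 1`, reward sets `A 0, …, A (h - 1)` with rewards `a`, and
penalty sets `B 0, …, B (l - 1)` with penalties `b`. -/
structure RPSP where
  n : ℕ
  h : ℕ
  l : ℕ
  A : Fin h → Finset (Fin n)
  a : Fin h → ℝ
  B : Fin l → Finset (Fin n)
  b : Fin l → ℝ
  a_nonneg : ∀ i, 0 ≤ a i
  b_nonneg : ∀ j, 0 ≤ b j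

namespace RPSP

/-- The profit of a selection `X`: a reward is gained if its set is hit, a penalty is paid if its
set is completely contained in `X`. -/
noncomputable def profit (I : RPSP) (X : Finset (Fin I.n)) : ℝ :=
  (∑ i with (I.A i ∩ X).Nonempty, I.a i) - ∑ j with I.B j ⊆ X, I.b j

/-- `X` is an optimal selection. -/
def IsOptimal (I : RPSP) (X : Finset (Fin I.n)) : Prop :=
  ∀ Y, I.profit Y ≤ I.profit X

/-- All reward sets are singletons. -/
def RewardSingletons (I : RPSP) : Prop :=
  ∀ i, (I.A i).card = 1

/-- The reduced connection graph (for singleton reward sets): its nodes are the reward sets and the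
penalty sets; a reward set takes the place of its player, so that it is adjacent to the penalty
sets which contain that player. -/
def reducedConnectionGraph (I : RPSP) : SimpleGraph (Fin I.h ⊕ Fin I.l) :=
  SimpleGraph.fromRel fun x y =>
    ∃ i j u, x = Sum.inl i ∧ y = Sum.inr j ∧ u ∈ I.A i ∧ u ∈ I.B j

end RPSP

/-! ### A random access machine with real weights

The machine has finitely many (as many as the program mentions) unbounded arrays of natural numbers
and of real numbers. A scalar variable is a cell of an array at a constant index. On natural numbers
there are addition, truncated subtraction and comparison (no multiplication, so that unit costs are
reasonable); on real numbers there are addition, subtraction and comparison. Each evaluation of an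
operation, array access, assignment or test has unit cost. -/

namespace RAM

/-- `nat r i` is cell `i` of the `r`-th array of natural numbers, `real r i` is cell `i` of the
`r`-th array of real numbers. -/
structure State where
  nat : ℕ → ℕ → ℕ
  real : ℕ → ℕ → ℝ

/-- Expressions for natural numbers; `load r e` reads cell `e` of array `r`. -/
inductive NExpr where
  | const (m : ℕ)
  | load (r : ℕ) (e : NExpr)
  | add (e f : NExpr)
  | sub (e f : NExpr)

def NExpr.eval (s : State) : NExpr → ℕ
  | const m => m
  | load r e => s.nat r (e.eval s)
  | add e f => e.eval s + f.eval s
  | sub e f => e.eval s - f.eval s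

def NExpr.cost : NExpr → ℕ
  | const _ => 1
  | load _ e => e.cost + 1
  | add e f => e.cost + f.cost + 1
  | sub e f => e.cost + f.cost + 1

/-- Expressions for real numbers. The only real constant is zero. -/
inductive RExpr where
  | zero
  | load (r : ℕ) (e : NExpr)
  | add (e f : RExpr)
  | sub (e f : RExpr)

noncomputable def RExpr.eval (s : State) : RExpr → ℝ
  | zero => 0
  | load r e => s.real r (e.eval s)
  | add e f => e.eval s + f.eval s
  | sub e f => e.eval s - f.eval s

def RExpr.cost : RExpr → ℕ
  | zero => 1
  | load _ e => e.cost + 1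
  | add e f => e.cost + f.cost + 1
  | sub e f => e.cost + f.cost + 1

/-- Tests. -/
inductive BExpr where
  | nle (e f : NExpr)
  | rle (e f : RExpr)
  | not (p : BExpr)
  | and (p q : BExpr)

def BExpr.Holds (s : State) : BExpr → Prop
  | nle e f => e.eval s ≤ f.eval s
  | rle e f => e.eval s ≤ f.eval s
  | not p => ¬ p.Holds s
  | and p q => p.Holds s ∧ q.Holds s

def BExpr.cost : BExpr → ℕ
  | nle e f => e.cost + f.cost + 1
  | rle e f => e.cost + f.cost + 1
  | not p => p.cost + 1
  | and p q => p.cost + q.cost + 1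

/-- Programs. `nstore r e f` writes the value of `f` to cell `e` of the `r`-th array of natural
numbers, `rstore r e f` does so for real numbers. -/
inductive Program where
  | skip
  | nstore (r : ℕ) (e : NExpr) (f : NExpr)
  | rstore (r : ℕ) (e : NExpr) (f : RExpr)
  | seq (P Q : Program)
  | ite (p : BExpr) (P Q : Program)
  | while (p : BExpr) (P : Program)

def State.nwrite (s : State) (r i m : ℕ) : State :=
  { s with nat := Function.update s.nat r (Function.update (s.nat r) i m) }

noncomputable def State.rwrite (s : State) (r i : ℕ) (x : ℝ) : State :=
  { s with real := Function.update s.real r (Function.update (s.real r) i x) }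

/-- `Exec P s t s'`: started in state `s`, the program `P` terminates after `t` steps in
state `s'`. -/
inductive Exec : Program → State → ℕ → State → Prop where
  | skip (s : State) : Exec .skip s 1 s
  | nstore (r : ℕ) (e f : NExpr) (s : State) :
      Exec (.nstore r e f) s (e.cost + f.cost + 1) (s.nwrite r (e.eval s) (f.eval s))
  | rstore (r : ℕ) (e : NExpr) (f : RExpr) (s : State) :
      Exec (.rstore r e f) s (e.cost + f.cost + 1) (s.rwrite r (e.eval s) (f.eval s))
  | seq {P Q : Program} {s s' s'' : State} {t t' : ℕ} :
      Exec P s t s' → Exec Q s' t' s'' → Exec (.seq P Q) s (t + t') s''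
  | ite_true {p : BExpr} {P Q : Program} {s s' : State} {t : ℕ} :
      p.Holds s → Exec P s t s' → Exec (.ite p P Q) s (p.cost + t) s'
  | ite_false {p : BExpr} {P Q : Program} {s s' : State} {t : ℕ} :
      ¬ p.Holds s → Exec Q s t s' → Exec (.ite p P Q) s (p.cost + t) s'
  | while_true {p : BExpr} {P : Program} {s s' s'' : State} {t t' : ℕ} :
      p.Holds s → Exec P s t s' → Exec (.while p P) s' t' s'' →
        Exec (.while p P) s (p.cost + t + t') s''
  | while_false {p : BExpr} {P : Program} {s : State} :
      ¬ p.Holds s → Exec (.while p P) s p.cost s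

end RAM

namespace RPSP

/-- A family of sets is written down as a list of numbers: for every set its cardinality, followed
by its elements in increasing order. -/
def encodeSets {n m : ℕ} (F : Fin m → Finset (Fin n)) : List ℕ :=
  (List.ofFn fun i => (F i).card :: ((F i).sort (· ≤ ·)).map Fin.val).flatten

/-- The initial state for an instance. Array `0` of natural numbers holds `n, h, l`, arrays `1` and
`2` hold the reward sets and the penalty sets; arrays `0` and `1` of real numbers hold the rewards
and the penalties. All other cells are zero. -/
noncomputable def input (I : RPSP) : RAM.State where
  nat r i :=
    match r with
    | 0 => [I.n, I.h, I.l].getD i 0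
    | 1 => (encodeSets I.A).getD i 0
    | 2 => (encodeSets I.B).getD i 0
    | _ => 0
  real r i :=
    match r with
    | 0 => (List.ofFn I.a).getD i 0
    | 1 => (List.ofFn I.b).getD i 0
    | _ => 0

/-- The final state `s` holds a solution: the first `n` cells of array `3` of natural numbers are
the characteristic vector of an optimal selection, and cell `0` of array `2` of real numbers is the
optimal profit. -/
def IsSolution (I : RPSP) (s : RAM.State) : Prop :=
  ∃ X : Finset (Fin I.n), I.IsOptimal X ∧
    (∀ u : Fin I.n, s.nat 3 u = if u ∈ X then 1 else 0) ∧ s.real 2 0 = I.profit X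

/-- The function `n (2 ^ (c k ^ 3) + 2 ^ (k + 1) (n ^ (k + 1)) ^ 2)`. -/
def timeBound (c n k : ℕ) : ℕ :=
  n * (2 ^ (c * k ^ 3) + 2 ^ (k + 1) * (n ^ (k + 1)) ^ 2)

end RPSP

/-! ### Components of induced subgraphs -/

/-! No tree decomposition is ever computed, and the program does not know `k`. Let `M = n + l`. The
vertices are the players that have a reward, weighted by the sum of their rewards, and the penalty
nodes. A penalty set containing a player without reward gets weight zero, since leaving that player
out avoids the penalty for free.

Separators. If the reduced connection graph has treewidth at most `k`, every connected piece has a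
nonempty set of at most `k + 1` vertices whose removal leaves components of at most half the size:
intersect the piece with the bag of a deepest node that still has more than half of the piece below
it (`RootedDecomposition.exists_balanced`, `RootedDecomposition.separable`). The program finds such
a set by trying all short sequences of vertices and testing each with breadth first search
(`runs_check`, `runs_search`). Shorter sequences come first, so `k` enters only the analysis.

Dynamic program. The separators are put on a stack, depth first: separate a component, then its
parts, and pop a vertex as soon as no remaining vertex can need it. Sizes halve at each level, so
the stack has at most `(k + 1) * (j + 1)` vertices for some `j` with `2 ^ j ≤ M`, and a table
indexed by the subsets of the stack has at most `(2 * M) ^ (k + 1)` entries (`height_le`). The table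
accumulates the gain of all processed vertices, as for a path decomposition, so tables never have to
be joined. For an index `Z`, a player on the stack lies in `Z` if it is dropped; a penalty node on
the stack lies in `Z` if its penalty is demanded, that is, charged unless a processed player avoids
it. The lemmas `IsBest.selectPlayer`, `IsBest.dropPlayer`, `IsBest.ignorePenalty`,
`IsBest.demandPenalty`, `IsBest.forgetPlayer` and `IsBest.forgetPenalty` justify the updates. Each
entry also stores an optimal selection as one binary number, so copying it takes one array access
and one assignment.

Running time. Twice the number of remaining vertices plus the stack height drops in every round that
separates or pops (`runs_separate`, `runs_mainLoop`), so there are O(`M`) rounds. In total this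
costs about `(k + 1) ^ 2 * M ^ (k + 4)` for the search, or `M ^ 3` if `k = 0`, and `(k + 1) * (2 *
M) ^ (k + 1) * M ^ 2` for the table. Factors `2 ^ O(k ^ 2)` are absorbed by a power of the size if
the size is large, and by `2 ^ (c * k ^ 3)` otherwise (`two_pow_mul_le`). For distinct sets with all
players covered, `l` is at most about `2 ^ (k + 1) * n`, because a graph of small treewidth has few
different neighbourhoods (`card_le_of_injective`); hence `M` may be replaced by `n`. -/

open Classical in
/-- The vertices of `A` that are reachable from `v` inside `A`. -/
noncomputable def comp {α : Type} (adj : α → α → Prop) (A : Finset α) (v : α) : Finset α :=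
  A.filter fun w => Relation.ReflTransGen (fun x y => adj x y ∧ x ∈ A ∧ y ∈ A) v w

section Comp

variable {α : Type} {adj : α → α → Prop} {A A' : Finset α} {v w x y : α}

theorem mem_comp : w ∈ comp adj A v ↔
    w ∈ A ∧ Relation.ReflTransGen (fun x y => adj x y ∧ x ∈ A ∧ y ∈ A) v w := by
  simp [comp]

theorem comp_subset : comp adj A v ⊆ A := fun _ h => (mem_comp.1 h).1

theorem self_mem_comp (h : v ∈ A) : v ∈ comp adj A v := mem_comp.2 ⟨h, .refl⟩

theorem mem_comp_of_adj (hx : x ∈ comp adj A v) (h : adj x y) (hy : y ∈ A) :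
    y ∈ comp adj A v := by
  rw [mem_comp] at *
  exact ⟨hy, hx.2.tail ⟨h, hx.1, hy⟩⟩

theorem comp_trans (h : w ∈ comp adj A v) (hx : x ∈ comp adj A w) : x ∈ comp adj A v := by
  rw [mem_comp] at *
  exact ⟨hx.1, h.2.trans hx.2⟩

theorem comp_mem_symm (hs : ∀ x y, adj x y → adj y x) (hv : v ∈ A) (h : w ∈ comp adj A v) :
    v ∈ comp adj A w := by
  rw [mem_comp] at *
  refine ⟨hv, ?_⟩
  have := h.2
  clear h
  induction this with
  | refl => exact .refl
  | tail _ h ih => exact .head ⟨hs _ _ h.1, h.2.2, h.2.1⟩ ih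

theorem comp_eq_of_mem (hs : ∀ x y, adj x y → adj y x) (hv : v ∈ A) (h : w ∈ comp adj A v) :
    comp adj A w = comp adj A v := by
  ext x
  exact ⟨comp_trans h, comp_trans (comp_mem_symm hs hv h)⟩

/-- A set that contains `v` and is closed under adjacency inside `A` contains the component. -/
theorem comp_induct {p : α → Prop} (hv : p v)
    (h : ∀ x y, adj x y → x ∈ A → y ∈ A → p x → p y) (hw : w ∈ comp adj A v) : p w := by
  rw [mem_comp] at hw
  have := hw.2
  clear hw
  induction this with
  | refl => exact hv
  | tail _ h' ih => exact h _ _ h'.1 h'.2.1 h'.2.2 ih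

theorem comp_mono (h : A' ⊆ A) : comp adj A' v ⊆ comp adj A v := by
  intro w hw
  rw [mem_comp] at *
  exact ⟨h hw.1, Relation.ReflTransGen.mono (fun a b hab => ⟨hab.1, h hab.2.1, h hab.2.2⟩) _ _ hw.2⟩

/-- Removing whole components does not change the remaining ones. -/
theorem comp_eq_of_closed (hA : A' ⊆ A) (h : ∀ x y, adj x y → x ∈ A' → y ∈ A → y ∈ A')
    (hv : v ∈ A') : comp adj A' v = comp adj A v := by
  refine (comp_mono hA).antisymm fun w hw => ?_
  exact comp_induct (p := fun w => w ∈ comp adj A' v) (self_mem_comp hv)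
    (fun x y hxy _ hy hx => mem_comp_of_adj hx hxy (h x y hxy (comp_subset hx) hy)) hw

/-- A walk in `A \ S` that starts in a component of `A` stays in it. This passes from separators of
a component, as the tree decomposition supplies them, to components of `A \ S`, as the program sees
them. -/
theorem comp_sdiff_subset [DecidableEq α] {S : Finset α} {v₀ : α} (hv : v ∈ comp adj A v₀)
    (hvS : v ∉ S) : comp adj (A \ S) v ⊆ comp adj (comp adj A v₀ \ S) v := by
  intro w hw
  refine comp_induct (p := fun w => w ∈ comp adj (comp adj A v₀ \ S) v)
    (self_mem_comp (by simp [hv, hvS])) (fun x y hxy _ hy hx => ?_) hw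
  have hx' := comp_subset hx
  simp only [Finset.mem_sdiff] at hx' hy
  exact mem_comp_of_adj hx hxy (by simp [hy.2, mem_comp_of_adj hx'.1 hxy hy.1])

end Comp

/-! ### Rooted tree decompositions -/

/-- A tree decomposition in rooted form: every vertex has a topmost bag, and it stays in the bags on
the way up to that bag. -/
structure RootedDecomposition (V : Type) where
  Node : Type
  fintypeNode : Fintype Node
  root : Node
  par : Node → Node
  depth : Node → ℕ
  depth_par : ∀ t, t ≠ root → depth (par t) < depth t
  bag : Node → Finset V
  top : V → Node
  top_mem : ∀ v, v ∈ bag (top v)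
  climb : ∀ v t, v ∈ bag t → t ≠ top v → t ≠ root ∧ v ∈ bag (par t)

namespace TreeDecomposition

variable {V : Type} {G : SimpleGraph V} (D : TreeDecomposition G)

/-- Prefixing a shortest walk by either edge gives a shortest walk from `x` to `r`, hence a path; a
tree has only one, and `y` and `y'` are both its second vertex. -/
theorem parent_unique {n : ℕ} {T : SimpleGraph (Fin n)} (hT : T.IsTree) (r : Fin n) {x y y' : Fin n}
    (h : T.Adj x y) (h' : T.Adj x y') (hd : T.dist x r = T.dist y r + 1)
    (hd' : T.dist x r = T.dist y' r + 1) : y = y' := by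
  obtain ⟨p, hp⟩ := hT.1.exists_walk_length_eq_dist y r
  obtain ⟨p', hp'⟩ := hT.1.exists_walk_length_eq_dist y' r
  have hq : (SimpleGraph.Walk.cons h p).IsPath :=
    SimpleGraph.Walk.isPath_of_length_eq_dist _ (by simp [hp, hd])
  have hq' : (SimpleGraph.Walk.cons h' p').IsPath :=
    SimpleGraph.Walk.isPath_of_length_eq_dist _ (by simp [hp', hd'])
  have := congrArg Subtype.val ((hT.2.subsingleton_path x r).elim ⟨_, hq⟩ ⟨_, hq'⟩)
  simpa using congrArg SimpleGraph.Walk.snd this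

theorem dist_step {n : ℕ} {T : SimpleGraph (Fin n)} (hT : T.IsTree) (r : Fin n) {x y : Fin n}
    (h : T.Adj x y) : T.dist x r = T.dist y r + 1 ∨ T.dist y r = T.dist x r + 1 := by
  have := hT.dist_eq_dist_add_one_of_adj r h
  rwa [T.dist_comm, T.dist_comm (u := r) (v := y)] at this

/-- A path in a tree that has stepped away from the root never turns back: the only neighbour nearer
to the root is the vertex it came from. -/
theorem dist_le_of_down {n : ℕ} {T : SimpleGraph (Fin n)} (hT : T.IsTree) (r : Fin n) {y z : Fin n}
    (p : T.Walk y z) (hp : p.IsPath) (x : Fin n) (hxy : T.Adj x y) (hx : x ∉ p.support)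
    (hd : T.dist y r = T.dist x r + 1) : T.dist y r ≤ T.dist z r := by
  induction p generalizing x with
  | nil => exact le_rfl
  | @cons y y' z h p ih =>
    rw [SimpleGraph.Walk.cons_isPath_iff] at hp
    rcases dist_step hT r h with hd' | hd'
    · have := parent_unique hT r hxy.symm h hd hd'
      subst this
      simp at hx
    · have := ih hp.1 y h hp.2 hd'
      omega

/-- The implication stands inside the existential so that `choose` yields a total parent function,
with an irrelevant value at the root. -/
theorem exists_parent (r x : Fin D.size) :
    ∃ y, x ≠ r → D.T.Adj x y ∧ D.T.dist x r = D.T.dist y r + 1 := by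
  by_cases hx : x = r
  · exact ⟨x, fun h => absurd hx h⟩
  · obtain ⟨p, hp⟩ := D.isTree.1.exists_walk_length_eq_dist x r
    cases p with
    | nil => exact absurd rfl hx
    | @cons _ y _ h p =>
      refine ⟨y, fun _ => ⟨h, ?_⟩⟩
      have h1 := D.T.dist_le p
      have h2 := dist_step D.isTree r h
      simp at hp
      omega

/-- The top is a node nearest to the root among those whose bag contains `v`. From any other such
node, a path to the top inside these nodes must start upwards; a downward first step would make the
top farther from the root than its start, by `dist_le_of_down`. -/
theorem exists_top (r : Fin D.size) (par : Fin D.size → Fin D.size)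
    (hpar : ∀ x, x ≠ r → D.T.Adj x (par x) ∧ D.T.dist x r = D.T.dist (par x) r + 1) (v : V) :
    ∃ t₀, v ∈ D.bag t₀ ∧ ∀ t, v ∈ D.bag t → t ≠ t₀ → t ≠ r ∧ v ∈ D.bag (par t) := by
  classical
  obtain ⟨t₀, ht₀, hmin⟩ := Finset.exists_min_image (Finset.univ.filter fun t => v ∈ D.bag t)
    (fun t => D.T.dist t r) (by
      obtain ⟨t, ht⟩ := D.vertex_mem v
      exact ⟨t, by simpa using ht⟩)
  simp only [Finset.mem_filter, Finset.mem_univ, true_and] at ht₀ hmin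
  refine ⟨t₀, ht₀, fun t ht hne => ?_⟩
  have htr : t ≠ r := by
    rintro rfl
    have := hmin t ht
    rw [SimpleGraph.dist_self, Nat.le_zero, D.isTree.1.dist_eq_zero_iff] at this
    exact hne this.symm
  refine ⟨htr, ?_⟩
  obtain ⟨p⟩ := (D.connected v).preconnected ⟨t, ht⟩ ⟨t₀, ht₀⟩
  let q := p.toPath.1
  have hq : q.IsPath := p.toPath.2
  clear_value q
  cases q with
  | nil => exact absurd rfl hne
  | @cons _ y _ h q =>
    have hadj : D.T.Adj t y := h
    rw [SimpleGraph.Walk.cons_isPath_iff] at hq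
    let f := (SimpleGraph.Embedding.induce {t | v ∈ D.bag t} (G := D.T)).toHom
    have hq' : (q.map f).IsPath := hq.1.map Subtype.val_injective
    rcases dist_step D.isTree r hadj with hd | hd
    · rw [← parent_unique D.isTree r hadj (hpar t htr).1 hd (hpar t htr).2]
      exact y.2
    · have h1 := dist_le_of_down D.isTree r (q.map f) hq' t hadj (by
        rw [SimpleGraph.Walk.support_map]
        intro hmem
        obtain ⟨z, hz, hzt⟩ := List.mem_map.1 hmem
        have : z = ⟨t, ht⟩ := Subtype.ext hzt
        exact hq.2 (this ▸ hz)) hd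
      have h2 := hmin t ht
      have h3 : D.T.dist (f y) r = D.T.dist y.1 r := rfl
      have h4 : D.T.dist (f ⟨t₀, ht₀⟩) r = D.T.dist t₀ r := rfl
      omega

theorem exists_rooted : ∃ R : RootedDecomposition V,
    (∀ t, (R.bag t).card ≤ D.width + 1) ∧
    ∀ v w, G.Adj v w → ∃ t, v ∈ R.bag t ∧ w ∈ R.bag t := by
  have := D.isTree.1.nonempty
  obtain ⟨r⟩ := this
  choose par hpar using D.exists_parent r
  choose top htop using D.exists_top r par hpar
  refine ⟨⟨Fin D.size, inferInstance, r, par, fun t => D.T.dist t r, fun t ht => ?_, D.bag, top,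
    fun v => (htop v).1, fun v => (htop v).2⟩, fun t => ?_, D.edge_mem⟩
  · have := (hpar t ht).2
    omega
  · have : (D.bag t).card ≤ Finset.univ.sup fun t => (D.bag t).card :=
      Finset.le_sup (f := fun t => (D.bag t).card) (Finset.mem_univ t)
    simp only [width]
    omega

end TreeDecomposition

/-! ### Balanced separators and neighbourhood counts from a rooted decomposition -/

namespace RootedDecomposition

variable {V : Type} (R : RootedDecomposition V)

/-- `R.Below t x`: the node `x` lies in the subtree of `t`. -/
def Below (t x : R.Node) : Prop :=
  Relation.ReflTransGen (fun a b => a ≠ R.root ∧ b = R.par a) x t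

variable {R} {s t x : R.Node} {u v w : V}

theorem depth_induct {p : R.Node → Prop} (h : ∀ t, (t ≠ R.root → p (R.par t)) → p t) (t : R.Node) : p t := by
  induction hn : R.depth t using Nat.strong_induction_on generalizing t with
  | _ n ih => exact h t fun ht => ih _ (hn ▸ R.depth_par t ht) _ rfl

theorem below_root (t : R.Node) : R.Below R.root t := by
  refine depth_induct (fun t ih => ?_) t
  by_cases ht : t = R.root
  · exact ht ▸ .refl
  · exact .head ⟨ht, rfl⟩ (ih ht)

theorem depth_top_le (t : R.Node) : v ∈ R.bag t → R.depth (R.top v) ≤ R.depth t := by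
  induction t using depth_induct
  rename_i t ih
  intro hv
  by_cases ht : t = R.top v
  · rw [ht]
  · obtain ⟨h1, h2⟩ := R.climb v t hv ht
    exact (ih h1 h2).trans (R.depth_par t h1).le

/-- On the way from `t` up to the top of `v`, the vertex `w` cannot drop out, as its own top is not
deeper. So of two adjacent vertices, the one with the higher top lies in the top bag of the other.
-/
theorem mem_bag_top (t : R.Node) : v ∈ R.bag t → w ∈ R.bag t →
    R.depth (R.top w) ≤ R.depth (R.top v) → w ∈ R.bag (R.top v) := by
  induction t using depth_induct
  rename_i t ih
  intro hv hw hd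
  by_cases ht : t = R.top v
  · rwa [← ht]
  · obtain ⟨h1, h2⟩ := R.climb v t hv ht
    by_cases ht' : t = R.top w
    · have := depth_top_le _ h2
      have := R.depth_par t h1
      subst ht'
      omega
    · exact ih h1 h2 (R.climb w t hw ht').2 hd

/-- Climbing to its top, `w` could leave the subtree of `s` only by passing from `s` to the parent,
and would then be in both bags. -/
theorem below_top (hs : w ∉ R.bag s ∨ w ∉ R.bag (R.par s)) (t : R.Node) :
    w ∈ R.bag t → R.Below s t → R.Below s (R.top w) := by
  induction t using depth_induct
  rename_i t ih
  intro hw hb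
  by_cases ht : t = R.top w
  · rwa [← ht]
  · obtain ⟨h1, h2⟩ := R.climb w t hw ht
    rcases Relation.ReflTransGen.cases_head hb with rfl | ⟨y, ⟨_, rfl⟩, hy⟩
    · tauto
    · exact ih h1 h2 hy

theorem below_of_mem (t : R.Node) : w ∈ R.bag t → R.Below (R.top w) t := by
  induction t using depth_induct
  rename_i t ih
  intro hw
  by_cases ht : t = R.top w
  · exact ht ▸ .refl
  · obtain ⟨h1, h2⟩ := R.climb w t hw ht
    exact .head ⟨h1, rfl⟩ (ih h1 h2)

theorem below_trans (h : R.Below s t) (h' : R.Below t x) : R.Below s x :=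
  Relation.ReflTransGen.trans h' h

/-- Adjacent vertices outside the bag of `t` have their top nodes on the same side of the node `s`,
if `s` is `t` or a child of `t`. -/
theorem below_iff (hst : s = t ∨ R.par s = t) (hv : v ∉ R.bag t) (hw : w ∉ R.bag t)
    (h : ∃ t, v ∈ R.bag t ∧ w ∈ R.bag t) : R.Below s (R.top v) ↔ R.Below s (R.top w) := by
  have key : ∀ v w, v ∉ R.bag t → w ∈ R.bag (R.top v) → w ∉ R.bag t →
      (R.Below s (R.top v) ↔ R.Below s (R.top w)) := by
    intro v w _ hwv hw
    refine ⟨below_top ?_ _ hwv, fun h => below_trans h (below_of_mem _ hwv)⟩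
    rcases hst with rfl | rfl
    · exact .inl hw
    · exact .inr hw
  obtain ⟨t', h1, h2⟩ := h
  rcases le_total (R.depth (R.top v)) (R.depth (R.top w)) with hd | hd
  · exact (key w v hw (mem_bag_top t' h2 h1 hd) hv).symm
  · exact key v w hv (mem_bag_top t' h1 h2 hd) hw

/-- Every vertex set has a balanced separator that lies in one bag. -/
theorem exists_balanced {α : Type} [DecidableEq α] (adj : α → α → Prop) (C : Finset α) (φ : α → V)
    (hφ : Set.InjOn φ C) (k : ℕ) (hk : ∀ t, (R.bag t).card ≤ k + 1)
    (he : ∀ v ∈ C, ∀ w ∈ C, adj v w → ∃ t, φ v ∈ R.bag t ∧ φ w ∈ R.bag t) :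
    ∃ S ⊆ C, S.card ≤ k + 1 ∧ ∀ v ∈ C \ S, 2 * (comp adj (C \ S) v).card ≤ C.card := by
  classical
  rcases C.eq_empty_or_nonempty with rfl | hC
  · exact ⟨∅, by simp⟩
  have := R.fintypeNode
  -- `W t` is the part of `C` whose tops lie in the subtree of `t`. The separator is cut out by the
  -- bag of a deepest `t` for which `W t` is more than half of `C`; the root qualifies.
  let W : R.Node → Finset α := fun t => C.filter fun v => R.Below t (R.top (φ v))
  obtain ⟨t, ht, hmax⟩ := Finset.exists_max_image
    (Finset.univ.filter fun t => C.card < 2 * (W t).card) R.depth ⟨R.root, by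
      have : W R.root = C := Finset.filter_true_of_mem fun v _ => below_root _
      have := hC.card_pos
      simp [*]⟩
  simp only [Finset.mem_filter, Finset.mem_univ, true_and] at ht hmax
  let S := C.filter fun v => φ v ∈ R.bag t
  refine ⟨S, Finset.filter_subset _ _, ?_, fun v hv => ?_⟩
  · rw [← Finset.card_image_of_injOn (f := φ) (hφ.mono fun x hx => (Finset.mem_filter.1 hx).1)]
    refine (Finset.card_le_card ?_).trans (hk t)
    intro x hx
    obtain ⟨v, hv, rfl⟩ := Finset.mem_image.1 hx
    exact (Finset.mem_filter.1 hv).2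
  have hmem : ∀ v, v ∈ C \ S ↔ v ∈ C ∧ φ v ∉ R.bag t := by
    intro v
    simp only [S, Finset.mem_sdiff, Finset.mem_filter]
    tauto
  have hstep : ∀ s, (s = t ∨ R.par s = t) → ∀ w ∈ comp adj (C \ S) v,
      (R.Below s (R.top (φ v)) ↔ R.Below s (R.top (φ w))) := by
    intro s hs w hw
    refine comp_induct (p := fun w => R.Below s (R.top (φ v)) ↔ R.Below s (R.top (φ w))) Iff.rfl
      (fun x y hxy hx hy h => h.trans ?_) hw
    rw [hmem] at hx hy
    exact below_iff hs hx.2 hy.2 (he x hx.1 y hy.1 hxy)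
  have hsub : comp adj (C \ S) v ⊆ C := comp_subset.trans Finset.sdiff_subset
  rw [hmem] at hv
  -- A component of `C \ S` lies on one side. Inside the subtree of `t` it sits below a single
  -- child, which is deeper than `t` and so carries at most half; outside it avoids `W t`, which is
  -- more than half.
  by_cases hb : R.Below t (R.top (φ v))
  · rcases Relation.ReflTransGen.cases_tail hb with h | ⟨s, hs, h1, rfl⟩
    · exact absurd (h ▸ R.top_mem (φ v)) hv.2
    · have hle : (comp adj (C \ S) v).card ≤ (W s).card := Finset.card_le_card fun w hw =>
        Finset.mem_filter.2 ⟨hsub hw, (hstep s (.inr rfl) w hw).1 hs⟩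
      by_contra hlt
      have := hmax s (by omega)
      have := R.depth_par s h1
      omega
  · have hle : (comp adj (C \ S) v).card ≤ (C \ W t).card := Finset.card_le_card fun w hw => by
      rw [Finset.mem_sdiff]
      exact ⟨hsub hw, fun h => hb ((hstep t (.inl rfl) w hw).2 (Finset.mem_filter.1 h).2)⟩
    rw [Finset.card_sdiff_of_subset (Finset.filter_subset _ _)] at hle
    change _ ≤ C.card - (W t).card at hle
    omega

/-- The number of different neighbourhoods in one side of a bipartite graph is linear in the size of
the other side. -/
theorem card_le_of_injective {n l k : ℕ} (hk : ∀ t, (R.bag t).card ≤ k + 1)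
    (N : Fin l → Finset (Fin n)) (hN : Function.Injective N) (φ : Fin n → V) (ψ : Fin l → V)
    (hφ : Function.Injective φ) (hψ : Function.Injective ψ)
    (he : ∀ j, ∀ u ∈ N j, ∃ t, φ u ∈ R.bag t ∧ ψ j ∈ R.bag t) :
    l ≤ n * (k + 1) + n * 2 ^ (k + 1) + 1 := by
  classical
  have hcard : ∀ (m : ℕ) (f : Fin m → V), Function.Injective f → ∀ t,
      (Finset.univ.filter fun x => f x ∈ R.bag t).card ≤ k + 1 := by
    intro m f hf t
    rw [← Finset.card_image_of_injective _ hf]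
    refine (Finset.card_le_card fun x hx => ?_).trans (hk t)
    obtain ⟨y, hy, rfl⟩ := Finset.mem_image.1 hx
    simpa using hy
  let S₁ : Fin n → Finset (Fin l) := fun u => Finset.univ.filter fun j => ψ j ∈ R.bag (R.top (φ u))
  let P : Fin n → Finset (Fin n) := fun u => Finset.univ.filter fun x => φ x ∈ R.bag (R.top (φ u))
  let S₂ : Fin n → Finset (Fin l) := fun u => Finset.univ.filter fun j => N j ⊆ P u
  let S₀ : Finset (Fin l) := Finset.univ.filter fun j => N j = ∅
  -- Either `j` lies in the top bag of one of its players, at most `k + 1` indices per player, or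
  -- all its players lie in its own top bag. In the latter case all of them lie in the top bag of
  -- the one with the deepest top, and `N j` is one of at most `2 ^ (k + 1)` subsets there. The
  -- empty neighbourhood is counted separately.
  have hcov : Finset.univ ⊆ Finset.univ.biUnion S₁ ∪ Finset.univ.biUnion S₂ ∪ S₀ := by
    intro j _
    rw [Finset.mem_union, Finset.mem_union, Finset.mem_biUnion, Finset.mem_biUnion]
    rcases (N j).eq_empty_or_nonempty with h0 | hne
    · exact .inr (by simpa [S₀] using h0)
    refine .inl ?_
    by_cases h : ∃ u ∈ N j, ψ j ∈ R.bag (R.top (φ u))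
    · obtain ⟨u, _, hu⟩ := h
      exact .inl ⟨u, Finset.mem_univ _, by simpa [S₁] using hu⟩
    · push Not at h
      have htop : ∀ u ∈ N j, φ u ∈ R.bag (R.top (ψ j)) := by
        intro u hu
        obtain ⟨t, h1, h2⟩ := he j u hu
        rcases le_total (R.depth (R.top (φ u))) (R.depth (R.top (ψ j))) with hd | hd
        · exact mem_bag_top t h2 h1 hd
        · exact absurd (mem_bag_top t h1 h2 hd) (h u hu)
      obtain ⟨u, hu, hmax⟩ := Finset.exists_max_image (N j) (fun u => R.depth (R.top (φ u))) hne
      refine .inr ⟨u, Finset.mem_univ _, Finset.mem_filter.2 ⟨Finset.mem_univ _, fun x hx => ?_⟩⟩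
      exact Finset.mem_filter.2 ⟨Finset.mem_univ _,
        mem_bag_top _ (htop u hu) (htop x hx) (hmax x hx)⟩
  have h1 : (Finset.univ.biUnion S₁).card ≤ n * (k + 1) := by
    refine Finset.card_biUnion_le.trans ((Finset.sum_le_card_nsmul _ _ (k + 1) fun u _ =>
      hcard l ψ hψ _).trans (by simp))
  have h2 : (Finset.univ.biUnion S₂).card ≤ n * 2 ^ (k + 1) := by
    refine Finset.card_biUnion_le.trans ((Finset.sum_le_card_nsmul _ _ (2 ^ (k + 1)) fun u _ =>
      ?_).trans (by simp))
    rw [← Finset.card_image_of_injective _ hN]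
    refine (Finset.card_le_card (t := (P u).powerset) fun x hx => ?_).trans ?_
    · obtain ⟨y, hy, rfl⟩ := Finset.mem_image.1 hx
      exact Finset.mem_powerset.2 (Finset.mem_filter.1 hy).2
    · rw [Finset.card_powerset]
      exact Nat.pow_le_pow_right two_pos (hcard n φ hφ _)
  have h3 : S₀.card ≤ 1 := by
    refine Finset.card_le_one.2 fun x hx y hy => hN ?_
    rw [(Finset.mem_filter.1 hx).2, (Finset.mem_filter.1 hy).2]
  have h4 := (Finset.card_le_card hcov).trans (Finset.card_union_le _ _)
  have h5 := Finset.card_union_le (Finset.univ.biUnion S₁) (Finset.univ.biUnion S₂)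
  simp only [Finset.card_univ, Fintype.card_fin] at h4
  omega

end RootedDecomposition

/-- The treewidth is the width of a tree decomposition. -/
theorem exists_width_eq_treewidth {V : Type} [Finite V] (G : SimpleGraph V) :
    ∃ D : TreeDecomposition G, D.width = treewidth G := by
  classical
  have := Fintype.ofFinite V
  refine Nat.sInf_mem (s := {w | ∃ D : TreeDecomposition G, D.width = w}) ⟨_, ?_, rfl⟩
  -- One bag with all vertices shows that the infimum is taken over a nonempty set.
  refine ⟨1, ⊥, .of_subsingleton, fun _ => Finset.univ, fun v => ⟨0, Finset.mem_univ _⟩,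
    fun v w _ => ⟨0, Finset.mem_univ _, Finset.mem_univ _⟩, fun v => ?_⟩
  have : Nonempty {t : Fin 1 | v ∈ (Finset.univ : Finset V)} := ⟨⟨0, Finset.mem_univ _⟩⟩
  exact ⟨.of_subsingleton⟩

/-! ### The table of the dynamic program -/

section Table

open Classical

variable (n : ℕ) (w : ℕ → ℝ) (adj : ℕ → ℕ → Prop)

/-- The penalty nodes of `P` that are paid for: their processed players are all selected, and if
they are still on the stack `K` then they are demanded by `Z`. -/
noncomputable def paid (P K Z X : Finset ℕ) : Finset ℕ :=
  P.filter fun j => n ≤ j ∧ (j ∈ K → j ∈ Z) ∧ ∀ u ∈ P, u < n → adj j u → u ∈ X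

/-- The value of the partial selection `X` of processed players. -/
noncomputable def gain (P K Z X : Finset ℕ) : ℝ :=
  ∑ u ∈ X, w u - ∑ j ∈ paid n adj P K Z X, w j

/-- `X` is a partial selection that contains exactly those players of the stack that are not
in `Z`. -/
def Feasible (P K Z X : Finset ℕ) : Prop :=
  (∀ u ∈ X, u ∈ P ∧ u < n) ∧ ∀ u ∈ K, u < n → (u ∈ Z ↔ u ∉ X)

/-- A correct table entry for `Z`: the value together with a selection that attains it, so that no
traceback is needed at the end. -/
def IsBest (P K Z X : Finset ℕ) (t : ℝ) : Prop :=
  Feasible n P K Z X ∧ gain n w adj P K Z X = t ∧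
    ∀ Y, Feasible n P K Z Y → gain n w adj P K Z Y ≤ t

/-- Edges join players and penalty nodes. -/
def Bip : Prop :=
  ∀ x y, adj x y → adj y x ∧ (x < n ↔ n ≤ y)

variable {n w adj} {P K Z X Y : Finset ℕ} {t : ℝ} {x : ℕ}

theorem mem_paid {j : ℕ} : j ∈ paid n adj P K Z X ↔
    j ∈ P ∧ n ≤ j ∧ (j ∈ K → j ∈ Z) ∧ ∀ u ∈ P, u < n → adj j u → u ∈ X := by
  simp [paid]

/-- A map from the old feasible selections onto the new ones that shifts every gain by the same
amount preserves optimality. The four rules for pushing a vertex are instances of this. -/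
theorem IsBest.transfer {P' K' Z' : Finset ℕ} {f : Finset ℕ → Finset ℕ} {r : ℝ}
    (h : IsBest n w adj P K Z X t)
    (hf : ∀ Y, Feasible n P K Z Y → Feasible n P' K' Z' (f Y) ∧
      gain n w adj P' K' Z' (f Y) = gain n w adj P K Z Y + r)
    (hs : ∀ Y', Feasible n P' K' Z' Y' → ∃ Y, Feasible n P K Z Y ∧ f Y = Y') :
    IsBest n w adj P' K' Z' (f X) (t + r) := by
  refine ⟨(hf X h.1).1, by rw [(hf X h.1).2, h.2.1], fun Y' hY' => ?_⟩
  obtain ⟨Y, hY, rfl⟩ := hs Y' hY'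
  rw [(hf Y hY).2]
  exact add_le_add_left (h.2.2 Y hY) r

/-- A selected player avoids no penalty: `paid` stays the same and only the reward is added. -/
theorem IsBest.selectPlayer (h : IsBest n w adj P K Z X t) (hx : x ∉ P) (hxn : x < n)
    (hK : K ⊆ P) (hZ : Z ⊆ K) :
    IsBest n w adj (insert x P) (insert x K) Z (insert x X) (t + w x) := by
  have hxZ : x ∉ Z := fun h => hx (hK (hZ h))
  have hxK : x ∉ K := fun h => hx (hK h)
  refine h.transfer (fun Y hY => ?_) fun Y' hY' => ?_
  · have hxY : x ∉ Y := fun h => hx (hY.1 x h).1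
    refine ⟨⟨?_, ?_⟩, ?_⟩
    · simp only [Finset.mem_insert]
      rintro u (rfl | hu)
      · exact ⟨.inl rfl, hxn⟩
      · exact ⟨.inr (hY.1 u hu).1, (hY.1 u hu).2⟩
    · simp only [Finset.mem_insert]
      rintro u (rfl | hu) hun
      · simp [hxZ]
      · rw [hY.2 u hu hun]
        have : u ≠ x := fun h => hxK (h ▸ hu)
        simp [this]
    · have : paid n adj (insert x P) (insert x K) Z (insert x Y) = paid n adj P K Z Y := by
        ext j
        simp only [mem_paid, Finset.mem_insert]
        constructor
        · rintro ⟨h1, h2, h3, h4⟩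
          refine ⟨h1.resolve_left (by omega), h2, fun h => h3 (.inr h), fun u hu hun hju => ?_⟩
          exact (h4 u (.inr hu) hun hju).resolve_left fun h => hx (h ▸ hu)
        · rintro ⟨h1, h2, h3, h4⟩
          refine ⟨.inr h1, h2, fun h => h3 (h.resolve_left (by omega)), fun u hu hun hju => ?_⟩
          exact hu.imp id fun hu => h4 u hu hun hju
      rw [gain, this, gain, Finset.sum_insert hxY]
      ring
  · refine ⟨Y'.erase x, ⟨fun u hu => ?_, fun u hu hun => ?_⟩, ?_⟩
    · rw [Finset.mem_erase] at hu
      have := hY'.1 u hu.2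
      rw [Finset.mem_insert] at this
      exact ⟨this.1.resolve_left hu.1, this.2⟩
    · rw [hY'.2 u (Finset.mem_insert_of_mem hu) hun]
      have : u ≠ x := fun h => hxK (h ▸ hu)
      simp [this]
    · refine Finset.insert_erase ?_
      have := hY'.2 x (Finset.mem_insert_self _ _) hxn
      tauto

/-- A dropped player avoids all penalties at `x`. By `hN` the processed ones are still on the stack,
so it suffices to withdraw the demand for them and look up the old entry. -/
theorem IsBest.dropPlayer (hb : Bip n adj)
    (h : IsBest n w adj P K (Z.filter fun y => ¬ adj x y) X t) (hx : x ∉ P) (hxn : x < n)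
    (hK : K ⊆ P) (hN : ∀ y ∈ P, adj x y → y ∈ K) :
    IsBest n w adj (insert x P) (insert x K) (insert x Z) X t := by
  have hxK : x ∉ K := fun h => hx (hK h)
  have key : ∀ u ∈ K, u < n →
      ((u ∈ Z.filter fun y => ¬ adj x y) ↔ (u ∈ insert x Z)) := by
    intro u hu hun
    have : ¬ adj x u := fun h => by have := (hb x u h).2; omega
    have : u ≠ x := fun h => hxK (h ▸ hu)
    simp [*]
  have := h.transfer (P' := insert x P) (K' := insert x K) (Z' := insert x Z) (f := id) (r := 0)
    (fun Y hY => ?_) fun Y' hY' => ?_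
  · simpa using this
  · have hxY : x ∉ Y := fun h => hx (hY.1 x h).1
    refine ⟨⟨fun u hu => ⟨Finset.mem_insert_of_mem (hY.1 u hu).1, (hY.1 u hu).2⟩,
      fun u hu hun => ?_⟩, ?_⟩
    · rcases Finset.mem_insert.1 hu with rfl | hu
      · simp [hxY]
      · rw [← key u hu hun]
        exact hY.2 u hu hun
    · have : paid n adj (insert x P) (insert x K) (insert x Z) Y =
          paid n adj P K (Z.filter fun y => ¬ adj x y) Y := by
        ext j
        simp only [mem_paid, Finset.mem_insert, Finset.mem_filter]
        constructor
        · rintro ⟨h1, h2, h3, h4⟩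
          refine ⟨h1.resolve_left (by omega), h2, fun h => ?_,
            fun u hu hun hju => h4 u (.inr hu) hun hju⟩
          exact ⟨(h3 (.inr h)).resolve_left (by omega),
            fun hj => hxY (h4 x (.inl rfl) hxn (hb _ _ hj).1)⟩
        · rintro ⟨h1, h2, h3, h4⟩
          refine ⟨.inr h1, h2, fun h => .inr (h3 (h.resolve_left (by omega))).1,
            fun u hu hun hju => ?_⟩
          rcases hu with rfl | hu
          · exact absurd (hb _ _ hju).1 (h3 (hN j h1 (hb _ _ hju).1)).2
          · exact h4 u hu hun hju
      simp only [id, gain, this, add_zero]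
  · have hxY : x ∉ Y' := (hY'.2 x (Finset.mem_insert_self _ _) hxn).1 (Finset.mem_insert_self _ _)
    refine ⟨Y', ⟨fun u hu => ⟨?_, (hY'.1 u hu).2⟩, fun u hu hun => ?_⟩, rfl⟩
    · exact (Finset.mem_insert.1 (hY'.1 u hu).1).resolve_left fun h => hxY (h ▸ hu)
    · rw [key u hu hun]
      exact hY'.2 u (Finset.mem_insert_of_mem hu) hun

theorem feasible_insert_iff (hxn : n ≤ x) (Z : Finset ℕ) (hZ : ∀ u < n, u ∈ Z ↔ u ∈ Y) :
    Feasible n (insert x P) (insert x K) Z X ↔ Feasible n P K Y X := by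
  constructor
  · rintro ⟨h1, h2⟩
    refine ⟨fun u hu => ⟨?_, (h1 u hu).2⟩, fun u hu hun => ?_⟩
    · refine (Finset.mem_insert.1 (h1 u hu).1).resolve_left ?_
      have := (h1 u hu).2
      omega
    · rw [← hZ u hun]
      exact h2 u (Finset.mem_insert_of_mem hu) hun
  · rintro ⟨h1, h2⟩
    refine ⟨fun u hu => ⟨Finset.mem_insert_of_mem (h1 u hu).1, (h1 u hu).2⟩, fun u hu hun => ?_⟩
    rw [hZ u hun]
    exact h2 u ((Finset.mem_insert.1 hu).resolve_left (by omega)) hun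

/-- A penalty node on the stack that is not demanded is never charged; this is the entry to be used
once some later player has been dropped. -/
theorem IsBest.ignorePenalty (h : IsBest n w adj P K Z X t) (hx : x ∉ P) (hxn : n ≤ x)
    (hK : K ⊆ P) (hZ : Z ⊆ K) : IsBest n w adj (insert x P) (insert x K) Z X t := by
  have hxZ : x ∉ Z := fun h => hx (hK (hZ h))
  have := h.transfer (P' := insert x P) (K' := insert x K) (Z' := Z) (f := id) (r := 0)
    (fun Y hY => ⟨(feasible_insert_iff hxn Z fun _ _ => Iff.rfl).2 hY, ?_⟩)
    fun Y' hY' => ⟨Y', (feasible_insert_iff hxn Z fun _ _ => Iff.rfl).1 hY', rfl⟩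
  · simpa using this
  · have : paid n adj (insert x P) (insert x K) Z Y = paid n adj P K Z Y := by
      ext j
      simp only [mem_paid, Finset.mem_insert]
      constructor
      · rintro ⟨h1, h2, h3, h4⟩
        refine ⟨h1.resolve_left fun h => hxZ (h ▸ h3 (.inl h)), h2, fun h => h3 (.inr h),
          fun u hu hun hju => h4 u (.inr hu) hun hju⟩
      · rintro ⟨h1, h2, h3, h4⟩
        refine ⟨.inr h1, h2, fun h => h3 (h.resolve_left fun h => hx (h ▸ h1)),
          fun u hu hun hju => h4 u (hu.resolve_left (by omega)) hun hju⟩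
    simp only [id, gain, this, add_zero]

/-- By `hN` all processed players of the penalty set are on the stack, so `Z` itself shows whether
one of them is dropped; if not, the penalty is charged. -/
theorem IsBest.demandPenalty (hb : Bip n adj) (h : IsBest n w adj P K Z X t) (hx : x ∉ P)
    (hxn : n ≤ x) (hK : K ⊆ P) (hZ : Z ⊆ K) (hN : ∀ y ∈ P, adj x y → y ∈ K) :
    IsBest n w adj (insert x P) (insert x K) (insert x Z) X
      (if ∃ y ∈ Z, adj x y then t else t - w x) := by
  have hZ' : ∀ u < n, u ∈ insert x Z ↔ u ∈ Z := fun u hu => by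
    have : u ≠ x := by omega
    simp [this]
  have := h.transfer (P' := insert x P) (K' := insert x K) (Z' := insert x Z) (f := id)
    (r := if ∃ y ∈ Z, adj x y then 0 else - w x)
    (fun Y hY => ⟨(feasible_insert_iff hxn _ hZ').2 hY, ?_⟩)
    fun Y' hY' => ⟨Y', (feasible_insert_iff hxn _ hZ').1 hY', rfl⟩
  · have e : (if ∃ y ∈ Z, adj x y then t else t - w x) =
        t + if ∃ y ∈ Z, adj x y then 0 else - w x := by
      split_ifs <;> simp [sub_eq_add_neg]
    rw [e]
    exact this
  · have hp : (∃ y ∈ Z, adj x y) ↔ ¬ ∀ u ∈ P, u < n → adj x u → u ∈ Y := by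
      push Not
      constructor
      · rintro ⟨y, hy, hxy⟩
        have hyn : y < n := by have := (hb x y hxy).2; omega
        exact ⟨y, hK (hZ hy), hyn, hxy, (hY.2 y (hZ hy) hyn).1 hy⟩
      · rintro ⟨y, hy, hyn, hxy, hyY⟩
        exact ⟨y, (hY.2 y (hN y hy hxy) hyn).2 hyY, hxy⟩
    have hmem : ∀ j, j ∈ paid n adj (insert x P) (insert x K) (insert x Z) Y ↔
        j ∈ paid n adj P K Z Y ∨ (j = x ∧ ∀ u ∈ P, u < n → adj x u → u ∈ Y) := by
      intro j
      simp only [mem_paid, Finset.mem_insert]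
      constructor
      · rintro ⟨h1, h2, h3, h4⟩
        rcases h1 with rfl | h1
        · exact .inr ⟨rfl, fun u hu hun hju => h4 u (.inr hu) hun hju⟩
        · exact .inl ⟨h1, h2, fun h => (h3 (.inr h)).resolve_left fun h => hx (h ▸ h1),
            fun u hu hun hju => h4 u (.inr hu) hun hju⟩
      · rintro (⟨h1, h2, h3, h4⟩ | ⟨rfl, h4⟩)
        · exact ⟨.inr h1, h2, fun h => .inr (h3 (h.resolve_left fun h => hx (h ▸ h1))),
            fun u hu hun hju => h4 u (hu.resolve_left (by omega)) hun hju⟩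
        · exact ⟨.inl rfl, hxn, fun _ => .inl rfl,
            fun u hu hun hju => h4 u (hu.resolve_left (by omega)) hun hju⟩
    have hxp : x ∉ paid n adj P K Z Y := fun h => hx (mem_paid.1 h).1
    split_ifs with hc
    · have : paid n adj (insert x P) (insert x K) (insert x Z) Y = paid n adj P K Z Y := by
        ext j
        rw [hmem]
        simp [hp.1 hc]
      simp only [id, gain, this, add_zero]
    · rw [hp, not_not] at hc
      have : paid n adj (insert x P) (insert x K) (insert x Z) Y =
          insert x (paid n adj P K Z Y) := by
        ext j
        rw [hmem, Finset.mem_insert, or_comm]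
        exact or_congr (and_iff_left hc) Iff.rfl
      simp only [id, gain, this, Finset.sum_insert hxp]
      ring

theorem paid_erase_player (hxn : x < n) (hZ : ∀ j, n ≤ j → (j ∈ Y ↔ j ∈ Z)) :
    paid n adj P (K.erase x) Z X = paid n adj P K Y X := by
  ext j
  simp only [mem_paid, Finset.mem_erase]
  refine and_congr_right fun _ => and_congr_right fun hj => and_congr_left fun _ => ?_
  rw [hZ j hj]
  have : j ≠ x := by omega
  simp [this]

/-- When a player is removed from the stack, the better one of both decisions is taken. -/
theorem IsBest.forgetPlayer {X₀ X₁ : Finset ℕ} {t₀ t₁ : ℝ} (hxn : x < n) (hxZ : x ∉ Z)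
    (h₀ : IsBest n w adj P K Z X₀ t₀) (h₁ : IsBest n w adj P K (insert x Z) X₁ t₁) :
    (t₀ ≤ t₁ → IsBest n w adj P (K.erase x) Z X₁ t₁) ∧
      (t₁ ≤ t₀ → IsBest n w adj P (K.erase x) Z X₀ t₀) := by
  have hZ' : ∀ u, u ≠ x → (u ∈ insert x Z ↔ u ∈ Z) := fun u hu => by simp [hu]
  have g₀ : ∀ Y, gain n w adj P (K.erase x) Z Y = gain n w adj P K Z Y := fun Y => by
    rw [gain, gain, paid_erase_player hxn fun j _ => Iff.rfl]
  have g₁ : ∀ Y, gain n w adj P (K.erase x) Z Y = gain n w adj P K (insert x Z) Y := fun Y => by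
    rw [gain, gain, paid_erase_player hxn fun j hj => hZ' j (by omega)]
  have f₀ : ∀ Y, Feasible n P K Z Y → Feasible n P (K.erase x) Z Y := fun Y hY =>
    ⟨hY.1, fun u hu => hY.2 u (Finset.mem_of_mem_erase hu)⟩
  have f₁ : ∀ Y, Feasible n P K (insert x Z) Y → Feasible n P (K.erase x) Z Y := fun Y hY =>
    ⟨hY.1, fun u hu => by
      rw [← hZ' u (Finset.ne_of_mem_erase hu)]
      exact hY.2 u (Finset.mem_of_mem_erase hu)⟩
  have split : ∀ Y, Feasible n P (K.erase x) Z Y →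
      Feasible n P K Z Y ∨ Feasible n P K (insert x Z) Y := by
    intro Y hY
    by_cases hxY : x ∈ Y
    · refine .inl ⟨hY.1, fun u hu hun => ?_⟩
      by_cases hux : u = x
      · subst hux
        simp [hxY, hxZ]
      · exact hY.2 u (Finset.mem_erase.2 ⟨hux, hu⟩) hun
    · refine .inr ⟨hY.1, fun u hu hun => ?_⟩
      by_cases hux : u = x
      · subst hux
        simp [hxY]
      · rw [hZ' u hux]
        exact hY.2 u (Finset.mem_erase.2 ⟨hux, hu⟩) hun
  constructor
  · refine fun hle => ⟨f₁ _ h₁.1, by rw [g₁, h₁.2.1], fun Y hY => ?_⟩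
    rcases split Y hY with h | h
    · rw [g₀]
      exact (h₀.2.2 Y h).trans hle
    · rw [g₁]
      exact h₁.2.2 Y h
  · refine fun hle => ⟨f₀ _ h₀.1, by rw [g₀, h₀.2.1], fun Y hY => ?_⟩
    rcases split Y hY with h | h
    · rw [g₀]
      exact h₀.2.2 Y h
    · rw [g₁]
      exact (h₁.2.2 Y h).trans hle

/-- Off the stack, a penalty is charged unless a processed player avoids it. That is the demanded
case, and the other entry is discarded. -/
theorem IsBest.forgetPenalty (hxn : n ≤ x) (h : IsBest n w adj P K (insert x Z) X t) :
    IsBest n w adj P (K.erase x) Z X t := by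
  have hf : ∀ Y, Feasible n P K (insert x Z) Y ↔ Feasible n P (K.erase x) Z Y := by
    intro Y
    refine and_congr_right fun _ => forall_congr' fun u => ?_
    by_cases hu : u = x
    · subst hu
      simp [hxn]
    · simp [hu]
  have hg : ∀ Y, gain n w adj P (K.erase x) Z Y = gain n w adj P K (insert x Z) Y := by
    intro Y
    have : paid n adj P (K.erase x) Z Y = paid n adj P K (insert x Z) Y := by
      ext j
      by_cases hj : j = x
      · subst hj
        simp [mem_paid]
      · simp [mem_paid, hj]
    rw [gain, gain, this]
  refine ⟨(hf X).1 h.1, by rw [hg, h.2.1], fun Y hY => ?_⟩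
  rw [hg]
  exact h.2.2 Y ((hf Y).2 hY)

end Table

/-! ### Sets as binary numbers -/

/-- The number whose binary digits are the characteristic function of `Y`. -/
def code (Y : Finset ℕ) : ℕ := ∑ i ∈ Y, 2 ^ i

theorem code_lt {Y : Finset ℕ} {d : ℕ} (h : Y ⊆ Finset.range d) : code Y < 2 ^ d :=
  Nat.geomSum_lt le_rfl fun _ hi => Finset.mem_range.1 (h hi)

theorem code_injective : Function.Injective code := Finset.geomSum_injective le_rfl

theorem exists_code_eq (y : ℕ) : ∃ Y, code Y = y :=
  ⟨y.bitIndices.toFinset, Finset.sum_toFinset_bitIndices_two_pow y⟩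

theorem two_pow_le_code {Y : Finset ℕ} {i : ℕ} (h : i ∈ Y) : 2 ^ i ≤ code Y :=
  Finset.single_le_sum (f := fun i => 2 ^ i) (fun _ _ => Nat.zero_le _) h

theorem exists_code_eq_of_lt {y d : ℕ} (h : y < 2 ^ d) : ∃ Y ⊆ Finset.range d, code Y = y := by
  obtain ⟨Y, rfl⟩ := exists_code_eq y
  refine ⟨Y, fun i hi => Finset.mem_range.2 ?_, rfl⟩
  exact (Nat.pow_lt_pow_iff_right one_lt_two).1 ((two_pow_le_code hi).trans_lt h)

theorem code_insert {Y : Finset ℕ} {i : ℕ} (h : i ∉ Y) : code (insert i Y) = code Y + 2 ^ i := by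
  rw [code, Finset.sum_insert h, add_comm, code]

open Classical in
-- With `code_filter_lt`: what remains of the number after treating the bits above `i` is at least
-- `2 ^ i` exactly if `i ∈ Y`. So a machine without division can read the bits from the top by
-- comparisons and subtractions.
theorem code_filter_range_succ (Y : Finset ℕ) (i : ℕ) :
    code (Y.filter (· < i + 1)) = code (Y.filter (· < i)) + if i ∈ Y then 2 ^ i else 0 := by
  split_ifs with h
  · rw [← code_insert (by simp)]
    congr 1
    ext j
    simp only [Finset.mem_filter, Finset.mem_insert]
    constructor
    · rintro ⟨h1, h2⟩
      have : j = i ∨ j < i := by omega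
      tauto
    · rintro (rfl | ⟨h1, h2⟩)
      · exact ⟨h, by omega⟩
      · exact ⟨h1, by omega⟩
  · congr 1
    ext j
    simp only [Finset.mem_filter]
    refine and_congr_right fun hj => ?_
    have : j ≠ i := fun e => h (e ▸ hj)
    omega

theorem code_filter_lt (Y : Finset ℕ) (i : ℕ) : code (Y.filter (· < i)) < 2 ^ i :=
  code_lt fun j hj => by simpa using (Finset.mem_filter.1 hj).2

/-! ### A program logic with running times -/

namespace RAM

/-- The program `P`, started in `s`, terminates within `T` steps in a state that satisfies `Q`. -/
def Runs (P : Program) (s : State) (T : ℕ) (Q : State → Prop) : Prop :=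
  ∃ t s', Exec P s t s' ∧ t ≤ T ∧ Q s'

/-- The arrays of natural numbers that a program may write to. -/
def Program.nats : Program → List ℕ
  | .skip => []
  | .nstore r _ _ => [r]
  | .rstore _ _ _ => []
  | .seq P Q => P.nats ++ Q.nats
  | .ite _ P Q => P.nats ++ Q.nats
  | .while _ P => P.nats

/-- The arrays of real numbers that a program may write to. -/
def Program.reals : Program → List ℕ
  | .skip => []
  | .nstore _ _ _ => []
  | .rstore r _ _ => [r]
  | .seq P Q => P.reals ++ Q.reals
  | .ite _ P Q => P.reals ++ Q.reals
  | .while _ P => P.reals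

/-- The states agree outside of the arrays that `P` writes to. -/
def Frame (P : Program) (s s' : State) : Prop :=
  (∀ r ∉ P.nats, s'.nat r = s.nat r) ∧ ∀ r ∉ P.reals, s'.real r = s.real r

theorem Frame.refl (P : Program) (s : State) : Frame P s s := ⟨fun _ _ => rfl, fun _ _ => rfl⟩

theorem Frame.trans {P : Program} {s s' s'' : State} (h : Frame P s s') (h' : Frame P s' s'') :
    Frame P s s'' :=
  ⟨fun r hr => (h'.1 r hr).trans (h.1 r hr), fun r hr => (h'.2 r hr).trans (h.2 r hr)⟩

theorem Frame.mono {P Q : Program} {s s' : State} (h : Frame P s s') (hn : P.nats ⊆ Q.nats)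
    (hr : P.reals ⊆ Q.reals) : Frame Q s s' :=
  ⟨fun r h' => h.1 r fun h => h' (hn h), fun r h' => h.2 r fun h => h' (hr h)⟩

@[simp] theorem nwrite_nat (s : State) (r i m r' : ℕ) :
    (s.nwrite r i m).nat r' = if r' = r then Function.update (s.nat r) i m else s.nat r' := by
  simp [State.nwrite, Function.update_apply]

@[simp] theorem nwrite_real (s : State) (r i m : ℕ) : (s.nwrite r i m).real = s.real := rfl

@[simp] theorem rwrite_real (s : State) (r i : ℕ) (x : ℝ) (r' : ℕ) :
    (s.rwrite r i x).real r' = if r' = r then Function.update (s.real r) i x else s.real r' := by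
  simp [State.rwrite, Function.update_apply]

@[simp] theorem rwrite_nat (s : State) (r i : ℕ) (x : ℝ) : (s.rwrite r i x).nat = s.nat := rfl

theorem Exec.frame {P : Program} {s s' : State} {t : ℕ} (h : Exec P s t s') : Frame P s s' := by
  induction h with
  | skip s => exact .refl _ _
  | nstore r e f s =>
    refine ⟨fun r' hr => ?_, fun r' _ => rfl⟩
    rw [nwrite_nat, if_neg (by simpa [Program.nats] using hr)]
  | rstore r e f s =>
    refine ⟨fun r' _ => rfl, fun r' hr => ?_⟩
    rw [rwrite_real, if_neg (by simpa [Program.reals] using hr)]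
  | seq _ _ h1 h2 =>
    exact (h1.mono (List.subset_append_left _ _) (List.subset_append_left _ _)).trans
      (h2.mono (List.subset_append_right _ _) (List.subset_append_right _ _))
  | ite_true _ _ h => exact h.mono (List.subset_append_left _ _) (List.subset_append_left _ _)
  | ite_false _ _ h => exact h.mono (List.subset_append_right _ _) (List.subset_append_right _ _)
  | while_true _ _ _ h1 h2 => exact Frame.trans h1 h2
  | while_false _ => exact .refl _ _

section Rules

variable {P Q P' : Program} {s : State} {T T' : ℕ} {R R' : State → Prop}

theorem Runs.frame (h : Runs P s T R) : Runs P s T fun s' => R s' ∧ Frame P s s' := by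
  obtain ⟨t, s', h, ht, hR⟩ := h
  exact ⟨t, s', h, ht, hR, h.frame⟩

theorem Runs.mono (h : Runs P s T R) (hT : T ≤ T') (hR : ∀ s', R s' → R' s') : Runs P s T' R' := by
  obtain ⟨t, s', h, ht, hr⟩ := h
  exact ⟨t, s', h, ht.trans hT, hR _ hr⟩

theorem Runs.seq {T₁ T₂ : ℕ} (h : Runs P s T₁ R) (h' : ∀ s', R s' → Frame P s s' → Runs Q s' T₂ R')
    (hT : T₁ + T₂ ≤ T) : Runs (.seq P Q) s T R' := by
  obtain ⟨t, s', h, ht, hr⟩ := h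
  obtain ⟨t', s'', h', ht', hr'⟩ := h' s' hr h.frame
  exact ⟨_, s'', .seq h h', by omega, hr'⟩

/-- The rules for straight-line code and branches are equivalences, so that as `simp` lemmas they
execute a program symbolically. -/
theorem runs_skip : Runs .skip s T R ↔ 1 ≤ T ∧ R s := by
  constructor
  · rintro ⟨t, s', h, ht, hr⟩
    cases h
    exact ⟨ht, hr⟩
  · exact fun h => ⟨_, _, .skip s, h.1, h.2⟩

theorem runs_nstore {r : ℕ} {e f : NExpr} : Runs (.nstore r e f) s T R ↔
    e.cost + f.cost + 1 ≤ T ∧ R (s.nwrite r (e.eval s) (f.eval s)) := by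
  constructor
  · rintro ⟨t, s', h, ht, hr⟩
    cases h
    exact ⟨ht, hr⟩
  · exact fun h => ⟨_, _, .nstore r e f s, h.1, h.2⟩

theorem runs_rstore {r : ℕ} {e : NExpr} {f : RExpr} : Runs (.rstore r e f) s T R ↔
    e.cost + f.cost + 1 ≤ T ∧ R (s.rwrite r (e.eval s) (f.eval s)) := by
  constructor
  · rintro ⟨t, s', h, ht, hr⟩
    cases h
    exact ⟨ht, hr⟩
  · exact fun h => ⟨_, _, .rstore r e f s, h.1, h.2⟩

theorem runs_ite {p : BExpr} : Runs (.ite p P Q) s T R ↔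
    p.cost ≤ T ∧ (p.Holds s → Runs P s (T - p.cost) R) ∧
      (¬ p.Holds s → Runs Q s (T - p.cost) R) := by
  constructor
  · rintro ⟨t, s', h, ht, hr⟩
    cases h with
    | ite_true hp h => exact ⟨by omega, fun _ => ⟨_, _, h, by omega, hr⟩, fun h => absurd hp h⟩
    | ite_false hp h => exact ⟨by omega, fun h => absurd h hp, fun _ => ⟨_, _, h, by omega, hr⟩⟩
  · rintro ⟨hT, h1, h2⟩
    by_cases hp : p.Holds s
    · obtain ⟨t, s', h, ht, hr⟩ := h1 hp
      exact ⟨_, s', .ite_true hp h, by omega, hr⟩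
    · obtain ⟨t, s', h, ht, hr⟩ := h2 hp
      exact ⟨_, s', .ite_false hp h, by omega, hr⟩

theorem runs_seq_nstore {r : ℕ} {e f : NExpr} : Runs (.seq (.nstore r e f) Q) s T R ↔
    e.cost + f.cost + 1 ≤ T ∧
      Runs Q (s.nwrite r (e.eval s) (f.eval s)) (T - (e.cost + f.cost + 1)) R := by
  constructor
  · rintro ⟨t, s', h, ht, hr⟩
    cases h with
    | seq h h' =>
      cases h
      exact ⟨by omega, _, _, h', by omega, hr⟩
  · rintro ⟨h1, t, s', h, ht, hr⟩
    exact ⟨_, _, .seq (.nstore r e f s) h, by omega, hr⟩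

theorem runs_seq_rstore {r : ℕ} {e : NExpr} {f : RExpr} : Runs (.seq (.rstore r e f) Q) s T R ↔
    e.cost + f.cost + 1 ≤ T ∧
      Runs Q (s.rwrite r (e.eval s) (f.eval s)) (T - (e.cost + f.cost + 1)) R := by
  constructor
  · rintro ⟨t, s', h, ht, hr⟩
    cases h with
    | seq h h' =>
      cases h
      exact ⟨by omega, _, _, h', by omega, hr⟩
  · rintro ⟨h1, t, s', h, ht, hr⟩
    exact ⟨_, _, .seq (.rstore r e f s) h, by omega, hr⟩

theorem runs_seq_assoc {P₁ P₂ P₃ : Program} :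
    Runs (.seq (.seq P₁ P₂) P₃) s T R ↔ Runs (.seq P₁ (.seq P₂ P₃)) s T R := by
  constructor
  · rintro ⟨t, s', h, ht, hr⟩
    cases h with
    | seq h h' =>
      cases h with
      | seq h1 h2 => exact ⟨_, _, .seq h1 (.seq h2 h'), by omega, hr⟩
  · rintro ⟨t, s', h, ht, hr⟩
    cases h with
    | seq h h' =>
      cases h' with
      | seq h1 h2 => exact ⟨_, _, .seq (.seq h h1) h2, by omega, hr⟩

theorem runs_seq_ite {p : BExpr} : Runs (.seq (.ite p P P') Q) s T R ↔
    p.cost ≤ T ∧ (p.Holds s → Runs (.seq P Q) s (T - p.cost) R) ∧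
      (¬ p.Holds s → Runs (.seq P' Q) s (T - p.cost) R) := by
  constructor
  · rintro ⟨t, s', h, ht, hr⟩
    cases h with
    | seq h h' =>
      cases h with
      | ite_true hp h =>
        exact ⟨by omega, fun _ => ⟨_, _, .seq h h', by omega, hr⟩, fun h => absurd hp h⟩
      | ite_false hp h =>
        exact ⟨by omega, fun h => absurd h hp, fun _ => ⟨_, _, .seq h h', by omega, hr⟩⟩
  · rintro ⟨hT, h1, h2⟩
    by_cases hp : p.Holds s
    · obtain ⟨t, s', h, ht, hr⟩ := h1 hp
      cases h with
      | seq h h' => exact ⟨_, s', .seq (.ite_true hp h) h', by omega, hr⟩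
    · obtain ⟨t, s', h, ht, hr⟩ := h2 hp
      cases h with
      | seq h h' => exact ⟨_, s', .seq (.ite_false hp h) h', by omega, hr⟩

/-- The rule for loops: the invariant `I` depends on a budget from which every iteration is paid. -/
theorem Runs.loop {p : BExpr} (I : ℕ → State → Prop) (N : ℕ) (h : I N s)
    (hstep : ∀ N s', I N s' → Frame P s s' → p.Holds s' →
      ∃ T, Runs P s' T fun s'' => ∃ N', N' + T + p.cost ≤ N ∧ I N' s'')
    (hT : N + p.cost ≤ T) (hR : ∀ N s', I N s' → ¬ p.Holds s' → R s') :
    Runs (.while p P) s T R := by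
  suffices ∀ N s', I N s' → Frame P s s' →
      Runs (.while p P) s' (N + p.cost) fun s'' => ∃ N, I N s'' ∧ ¬ p.Holds s'' from
    (this N s h (.refl _ _)).mono hT fun s' ⟨N, h1, h2⟩ => hR N s' h1 h2
  -- Every test has positive cost, so the budget strictly decreases; this proves termination.
  have hp : 1 ≤ p.cost := by cases p <;> simp [BExpr.cost]
  intro N
  induction N using Nat.strong_induction_on with
  | _ N ih =>
    intro s' hs' hf
    by_cases hps : p.Holds s'
    · obtain ⟨T', t, s₁, h1, h2, N', h3, h4⟩ := hstep N s' hs' hf hps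
      obtain ⟨t', s₂, h5, h6, h7⟩ := ih N' (by omega) s₁ h4 (hf.trans h1.frame)
      exact ⟨_, s₂, .while_true hps h1 h5, by omega, h7⟩
    · exact ⟨_, s', .while_false hps, by omega, N, hs', hps⟩

end Rules

/-! ### Counting loops -/

/-- The value of a scalar variable. -/
abbrev NExpr.var (r : ℕ) : NExpr := .load r (.const 0)

/-- Assignment to a scalar variable. -/
abbrev Program.set (r : ℕ) (e : NExpr) : Program := .nstore r (.const 0) e

abbrev BExpr.lt (e f : NExpr) : BExpr := .not (.nle f e)

/-- Execute `P` for all values of the variable `i` below the value of the variable `b`. -/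
def Program.for (i b : ℕ) (P : Program) : Program :=
  .seq (.set i (.const 0))
    (.while (.lt (.var i) (.var b)) (.seq P (.set i (.add (.var i) (.const 1)))))

/-- The rule for counting loops with a budget. -/
theorem Runs.forBudget {i b : ℕ} {P : Program} {s : State} {T : ℕ} {R : State → Prop}
    (N : ℕ) (I : ℕ → ℕ → State → Prop) (B : ℕ) (hib : i ≠ b) (hi : i ∉ P.nats) (hb : b ∉ P.nats)
    (hN : s.nat b 0 = N)
    (h : I B 0 (s.nwrite i 0 0))
    (hstep : ∀ B, ∀ j < N, ∀ s', I B j s' → Frame (P.for i b) s s' → s'.nat i 0 = j →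
      s'.nat b 0 = N → ∃ T, Runs P s' T fun s'' => Frame P s' s'' →
        ∃ B', B' + T ≤ B ∧ I B' (j + 1) (s''.nwrite i 0 (j + 1)))
    (hT : B + N * 12 + 9 ≤ T)
    (hR : ∀ B s', I B N s' → Frame (P.for i b) s s' → s'.nat i 0 = N → R s') :
    Runs (P.for i b) s T R := by
  have h0 : Frame (P.for i b) s (s.nwrite i 0 0) := by
    refine ⟨fun r hr => ?_, fun r hr => rfl⟩
    rw [nwrite_nat, if_neg (by simp [Program.for, Program.nats] at hr; tauto)]
  have hb' : b ∉ (P.for i b).nats := by simp [Program.for, Program.nats, hb, Ne.symm hib]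
  rw [Program.for, runs_seq_nstore]
  simp only [NExpr.cost, NExpr.eval]
  refine ⟨by omega, ?_⟩
  -- Each round costs 12 besides the body, 6 for the test and 6 for the increment. The 9 in the
  -- total is the initialisation and the final failing test.
  refine Runs.loop (fun M s' => ∃ j ≤ N, ∃ B, M = B + (N - j) * 12 ∧ s'.nat i 0 = j ∧
      Frame (P.for i b) s s' ∧ I B j s')
    (B + N * 12) ⟨0, Nat.zero_le _, B, by simp, by simp, h0, h⟩ ?_ ?_ ?_
  · rintro M s' ⟨j, hj, B, rfl, hij, hf, hI⟩ - hp
    have hbs : s'.nat b 0 = N := by rw [hf.1 b hb', hN]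
    have hjN : j < N := by simpa [BExpr.Holds, NExpr.eval, hij, hbs] using hp
    obtain ⟨T', hT'⟩ := hstep B j hjN s' hI hf hij hbs
    refine ⟨T' + 6, hT'.seq (T₂ := 6) ?_ le_rfl⟩
    rintro s'' hI' hf'
    obtain ⟨B', hB', hI'⟩ := hI' hf'
    have hi' : s''.nat i 0 = j := by rw [hf'.1 i hi, hij]
    rw [runs_nstore]
    simp only [NExpr.cost, NExpr.eval, BExpr.cost, hi']
    refine ⟨by omega, B' + (N - (j + 1)) * 12, by omega, j + 1, by omega, B', rfl, by simp,
      (hf.trans (hf'.mono ?_ ?_)).trans ⟨fun r hr => ?_, fun r hr => rfl⟩, hI'⟩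
    · simp [Program.for, Program.nats]
    · simp [Program.for, Program.reals]
    · rw [nwrite_nat, if_neg (by simp [Program.for, Program.nats] at hr; tauto)]
  · simp only [BExpr.cost, NExpr.cost]
    omega
  · rintro M s' ⟨j, hj, B, rfl, hij, hf, hI⟩ hp
    have hbs : s'.nat b 0 = N := by rw [hf.1 b hb', hN]
    have hjN : j = N := by
      have : N ≤ j := by simpa [BExpr.Holds, NExpr.eval, hij, hbs] using hp
      omega
    subst hjN
    exact hR B s' hI hf hij

/-- The rule for counting loops. -/
theorem Runs.for {i b : ℕ} {P : Program} {s : State} {T : ℕ} {R : State → Prop}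
    (N : ℕ) (I : ℕ → State → Prop) (K : ℕ) (hib : i ≠ b) (hi : i ∉ P.nats) (hb : b ∉ P.nats)
    (hN : s.nat b 0 = N)
    (h : I 0 (s.nwrite i 0 0))
    (hstep : ∀ j < N, ∀ s', I j s' → Frame (P.for i b) s s' → s'.nat i 0 = j → s'.nat b 0 = N →
      Runs P s' K fun s'' => Frame P s' s'' → I (j + 1) (s''.nwrite i 0 (j + 1)))
    (hT : N * (K + 12) + 9 ≤ T)
    (hR : ∀ s', I N s' → Frame (P.for i b) s s' → s'.nat i 0 = N → R s') :
    Runs (P.for i b) s T R := by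
  refine Runs.forBudget N (fun B j s' => B = (N - j) * K ∧ I j s') (N * K) hib hi hb hN
    ⟨by simp, h⟩ ?_ (by rw [Nat.mul_add] at hT; exact hT) fun B s' h => hR s' h.2
  rintro B j hj s' ⟨rfl, hI⟩ hf hij hbs
  refine ⟨K, (hstep j hj s' hI hf hij hbs).mono le_rfl fun s'' h hf' =>
    ⟨(N - (j + 1)) * K, ?_, rfl, h hf'⟩⟩
  have : N - j = N - (j + 1) + 1 := by omega
  rw [this, Nat.add_mul]
  omega

end RAM

namespace RAM

attribute [simp] NExpr.eval NExpr.cost RExpr.eval RExpr.cost BExpr.Holds BExpr.cost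
  runs_skip runs_nstore runs_rstore runs_ite runs_seq_nstore runs_seq_rstore
  runs_seq_ite runs_seq_assoc

/-! ### The program

The names of the arrays; scalar variables are the cells `0` of their arrays. -/

notation "aOut" => 3
notation "vM" => 4
notation "aOff" => 6
notation "aAdj" => 7
notation "aPow" => 8
notation "aRem" => 9
notation "aLab" => 10
notation "aMark" => 11
notation "aQue" => 12
notation "vCnt" => 13
notation "vHd" => 14
notation "vSrc" => 15
notation "vCur" => 16
notation "vBw" => 17
notation "aCl" => 18
notation "vCsz" => 19
notation "aDig" => 20
notation "vLen" => 21
notation "vOk" => 22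
notation "vCi" => 23
notation "vTi" => 24
notation "aStk" => 25
notation "vHt" => 26
notation "vTsz" => 27
notation "aSel" => 28
notation "vTy" => 29
notation "vTz" => 30
notation "vTr" => 31
notation "vTj" => 32
notation "vPick" => 33
notation "vDone" => 34
notation "vX" => 35
notation "vI" => 36
notation "vH" => 37
notation "vL" => 38
notation "vPtr" => 39
notation "vQ" => 40
notation "vCard" => 41
notation "vU" => 42
notation "vNode" => 43
notation "aWgt" => 3
notation "aTab" => 4

open Program NExpr BExpr

scoped infixr:60 " ;; " => Program.seq
scoped notation "#" c => NExpr.const c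
scoped infixl:85 " ⊹ " => NExpr.add
scoped infixl:85 " ⊖ " => NExpr.sub

/-- Add the neighbours of the current vertex to the queue. -/
def scan : Program :=
  .for vBw vM
    (.ite (.and (nle (load aMark (var vBw)) (#0)) (nle (#1) (load aAdj (var vCur ⊹ var vBw))))
      (nstore aMark (var vBw) (#1) ;; nstore aQue (var vCnt) (var vBw) ;;
        set vCnt (var vCnt ⊹ #1))
      .skip)

/-- Breadth first search from the vertex `vSrc` through the vertices with mark `0`. -/
def bfs : Program :=
  nstore aQue (#0) (var vSrc) ;; nstore aMark (var vSrc) (#1) ;; set vCnt (#1) ;; set vHd (#0) ;;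
  .while (lt (var vHd) (var vCnt))
    (set vCur (load aOff (load aQue (var vHd))) ;;
    (set vHd (var vHd ⊹ #1) ;;
    scan))

/-- The marks of the removed vertices. -/
def resetMarks : Program := .for vI vM (nstore aMark (var vI) (load aRem (var vI)))

/-- The component of the vertex `vPick`. -/
def component : Program :=
  resetMarks ;; set vSrc (var vPick) ;; bfs ;; set vCsz (var vCnt) ;;
  .for vI vCsz (nstore aCl (var vI) (load aQue (var vI)))

/-- Is the set that is given by the digits a balanced separator of the component? -/
def check : Program :=
  resetMarks ;; .for vI vLen (nstore aMark (load aCl (load aDig (var vI))) (#1)) ;; set vOk (#1) ;;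
  .for vCi vCsz
    (.ite (nle (load aMark (load aCl (var vCi))) (#0))
      (set vSrc (load aCl (var vCi)) ;; bfs ;;
        .ite (lt (var vCsz) (var vCnt ⊹ var vCnt)) (set vOk (#0)) .skip)
      .skip)

/-- The next sequence of digits. -/
def increment : Program :=
  set vTi (#0) ;;
  .while (.and (lt (var vTi) (var vLen)) (nle (var vCsz) (load aDig (var vTi) ⊹ #1)))
    (nstore aDig (var vTi) (#0) ;; set vTi (var vTi ⊹ #1)) ;;
  .ite (lt (var vTi) (var vLen))
    (nstore aDig (var vTi) (load aDig (var vTi) ⊹ #1))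
    (nstore aDig (var vTi) (#0) ;; set vLen (var vLen ⊹ #1))

/-- Incrementing before the first check skips the empty sequence, so the separator found is never
empty. -/
def search : Program :=
  set vLen (#0) ;; set vOk (#0) ;; .while (nle (var vOk) (#0)) (increment ;; check)

/-- Delete the neighbours of `vX` from the set with the number `vTy` of positions of the stack. -/
def decode : Program :=
  set vTz (#0) ;; set vTr (var vTy) ;; set vTj (var vHt) ;;
  .while (lt (#0) (var vTj))
    (set vTj (var vTj ⊖ #1) ;;
      .ite (nle (load aPow (var vTj)) (var vTr))
        (set vTr (var vTr ⊖ load aPow (var vTj)) ;;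
          .ite (nle (load aAdj (load aOff (var vX) ⊹ load aStk (var vTj))) (#0))
            (set vTz (var vTz ⊹ load aPow (var vTj))) .skip)
        .skip)

/-- The upper half of the doubled table belongs to the indices containing the new vertex. It is
computed from the old lower half, hence before `selectPlayer` overwrites that half. -/
def dropPlayer : Program :=
  .for vTy vTsz
    (decode ;; rstore aTab (var vTsz ⊹ var vTy) (.load aTab (var vTz)) ;;
      nstore aSel (var vTsz ⊹ var vTy) (load aSel (var vTz)))

def selectPlayer : Program :=
  .for vTy vTsz
    (rstore aTab (var vTy) (.add (.load aTab (var vTy)) (.load aWgt (var vX))) ;;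
      nstore aSel (var vTy) (load aSel (var vTy) ⊹ load aPow (var vX)))

/-- `decode` removes the dropped players of the penalty set from the index; the index did not shrink
exactly if there is none, and then the penalty is due. -/
def demandPenalty : Program :=
  .for vTy vTsz
    (decode ;; .ite (nle (var vTy) (var vTz))
        (rstore aTab (var vTsz ⊹ var vTy) (.sub (.load aTab (var vTy)) (.load aWgt (var vX))))
        (rstore aTab (var vTsz ⊹ var vTy) (.load aTab (var vTy))) ;;
      nstore aSel (var vTsz ⊹ var vTy) (load aSel (var vTy)))

/-- Push the vertex `vX` on the stack. -/
def introduce : Program :=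
  .ite (lt (var vX) (load 0 (#0))) (dropPlayer ;; selectPlayer) demandPenalty ;;
  nstore aStk (var vHt) (var vX) ;; set vHt (var vHt ⊹ #1) ;; set vTsz (var vTsz ⊹ var vTsz) ;;
  nstore aRem (var vX) (#1)

/-- Pop a vertex from the stack. -/
def forget : Program :=
  set vHt (var vHt ⊖ #1) ;; set vTsz (load aPow (var vHt)) ;; set vX (load aStk (var vHt)) ;;
  .for vTy vTsz
    (.ite (.and (lt (var vX) (load 0 (#0)))
        (.rle (.load aTab (var vTsz ⊹ var vTy)) (.load aTab (var vTy)))) .skip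
      (rstore aTab (var vTy) (.load aTab (var vTsz ⊹ var vTy)) ;;
        nstore aSel (var vTy) (load aSel (var vTsz ⊹ var vTy))))

/-- Push the vertices that are given by the digits. -/
def pushDigits : Program :=
  .for vI vLen (set vX (load aCl (load aDig (var vI))) ;;
    .ite (nle (load aRem (var vX)) (#0)) introduce .skip)

/-- Label the vertices of the component with the height of the stack. -/
def label : Program := .for vI vCsz (nstore aLab (load aCl (var vI)) (var vHt))

/-- Push a balanced separator of the component of `vPick`. -/
def separate : Program := component ;; search ;; pushDigits ;; label

/-- A remaining vertex whose label is the full stack height has a component that may still need the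
top of the stack. The value of `vM` means that there is none. -/
def pick : Program :=
  set vPick (var vM) ;;
  .for vI vM (.ite (.and (nle (load aRem (var vI)) (#0)) (nle (var vHt) (load aLab (var vI))))
    (set vPick (var vI)) .skip)

/-- A depth first traversal of the hierarchy of separators: separate while some component may use
the whole stack, otherwise pop. -/
def mainLoop : Program :=
  set vDone (#0) ;; .while (nle (var vDone) (#0))
    (pick ;; .ite (lt (var vPick) (var vM)) separate
      (.ite (nle (var vHt) (#0)) (set vDone (#1)) forget))

/-! ### Breadth first search -/

/-- The adjacency matrix in the memory. -/
structure GraphMem (M : ℕ) (adj : ℕ → ℕ → Prop) (s : State) : Prop where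
  size : s.nat vM 0 = M
  off : ∀ v < M, s.nat aOff v = v * M
  adj : ∀ v < M, ∀ w < M, 1 ≤ s.nat aAdj (v * M + w) ↔ adj v w

theorem GraphMem.congr {M : ℕ} {adj : ℕ → ℕ → Prop} {s s' : State} (h : GraphMem M adj s)
    (h4 : s'.nat vM = s.nat vM) (h6 : s'.nat aOff = s.nat aOff) (h7 : s'.nat aAdj = s.nat aAdj) :
    GraphMem M adj s' :=
  ⟨h4 ▸ h.size, h6 ▸ h.off, h7 ▸ h.adj⟩

theorem GraphMem.frame {M : ℕ} {adj : ℕ → ℕ → Prop} {P : Program} {s s' : State}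
    (h : GraphMem M adj s) (hf : Frame P s s')
    (hP : vM ∉ P.nats ∧ aOff ∉ P.nats ∧ aAdj ∉ P.nats) : GraphMem M adj s' :=
  h.congr (hf.1 _ hP.1) (hf.1 _ hP.2.1) (hf.1 _ hP.2.2)

/-- The content of the first `c` cells of an array. -/
def cells (q : ℕ → ℕ) (c : ℕ) : Finset ℕ := (Finset.range c).image q

theorem mem_cells {q : ℕ → ℕ} {c x : ℕ} : x ∈ cells q c ↔ ∃ i < c, q i = x := by
  simp [cells]

@[simp] theorem cells_zero (q : ℕ → ℕ) : cells q 0 = ∅ := by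
  simp [cells]

theorem cells_update (q : ℕ → ℕ) (c x : ℕ) :
    cells (Function.update q c x) (c + 1) = insert x (cells q c) := by
  rw [cells, Finset.range_add_one, Finset.image_insert, Function.update_self, cells]
  congr 1
  refine Finset.image_congr fun i hi => ?_
  simp at hi
  rw [Function.update_of_ne (by omega)]

theorem injOn_update {q : ℕ → ℕ} {c x : ℕ} (h : Set.InjOn q (Set.Iio c)) (hx : x ∉ cells q c) :
    Set.InjOn (Function.update q c x) (Set.Iio (c + 1)) := by
  intro i hi j hj hij
  simp only [mem_cells, not_exists, not_and, Set.mem_Iio] at *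
  simp only [Function.update_apply] at hij
  split_ifs at hij with h1 h2 h2
  · omega
  · exact absurd hij.symm (hx j (by omega))
  · exact absurd hij (hx i (by omega))
  · exact h (Set.mem_Iio.2 (by omega)) (Set.mem_Iio.2 (by omega)) hij

theorem card_cells {q : ℕ → ℕ} {c : ℕ} (h : Set.InjOn q (Set.Iio c)) : (cells q c).card = c := by
  rw [cells, Finset.card_image_of_injOn (by simpa using h), Finset.card_range]

/-- Nonzero marks stand both for vertices outside `A` and for visited ones. As the queue is
injective and stays in `C`, it has at most `C.card` entries. -/
structure QueueInv (M : ℕ) (A C : Finset ℕ) (s : State) : Prop where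
  inj : Set.InjOn (s.nat aQue) (Set.Iio (s.nat vCnt 0))
  sub : cells (s.nat aQue) (s.nat vCnt 0) ⊆ C
  mark : ∀ w < M, s.nat aMark w = 0 ↔ w ∈ A ∧ w ∉ cells (s.nat aQue) (s.nat vCnt 0)

theorem QueueInv.congr {M : ℕ} {A C : Finset ℕ} {s s' : State} (h : QueueInv M A C s)
    (h1 : s'.nat aQue = s.nat aQue) (h2 : s'.nat vCnt = s.nat vCnt)
    (h3 : s'.nat aMark = s.nat aMark) : QueueInv M A C s' :=
  ⟨by rw [h1, h2]; exact h.inj, by rw [h1, h2]; exact h.sub, by rw [h1, h2, h3]; exact h.mark⟩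

theorem QueueInv.cnt_le {M : ℕ} {A C : Finset ℕ} {s : State} (h : QueueInv M A C s) :
    s.nat vCnt 0 ≤ C.card := by
  rw [← card_cells h.inj]
  exact Finset.card_le_card h.sub

theorem QueueInv.push {M : ℕ} {A C : Finset ℕ} {s s' : State} {w : ℕ} (h : QueueInv M A C s)
    (hw : w ∈ C) (hn : w ∉ cells (s.nat aQue) (s.nat vCnt 0))
    (h1 : s'.nat aQue = Function.update (s.nat aQue) (s.nat vCnt 0) w)
    (h2 : s'.nat vCnt 0 = s.nat vCnt 0 + 1)
    (h3 : s'.nat aMark = Function.update (s.nat aMark) w 1) : QueueInv M A C s' := by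
  refine ⟨?_, ?_, fun x hx => ?_⟩
  · rw [h1, h2]
    exact injOn_update h.inj hn
  · rw [h1, h2, cells_update]
    exact Finset.insert_subset hw h.sub
  · rw [h1, h2, h3, cells_update, Function.update_apply, Finset.mem_insert]
    split_ifs with hxw
    · simp [hxw]
    · rw [h.mark x hx]
      simp [hxw]

theorem runs_scan {M : ℕ} {adj : ℕ → ℕ → Prop} {A : Finset ℕ} {v x : ℕ} {s : State}
    (hG : GraphMem M adj s) (hq : QueueInv M A (comp adj A v) s) (hx : x ∈ comp adj A v)
    (hxM : x < M) (hcur : s.nat vCur 0 = x * M) :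
    Runs scan s (M * 60 + 9) fun s' => QueueInv M A (comp adj A v) s' ∧
      s.nat vCnt 0 ≤ s'.nat vCnt 0 ∧ (∀ i < s.nat vCnt 0, s'.nat aQue i = s.nat aQue i) ∧
      ∀ y < M, y ∈ A → adj x y → y ∈ cells (s'.nat aQue) (s'.nat vCnt 0) := by
  refine Runs.for M (fun j s' => QueueInv M A (comp adj A v) s' ∧
      s.nat vCnt 0 ≤ s'.nat vCnt 0 ∧ (∀ i < s.nat vCnt 0, s'.nat aQue i = s.nat aQue i) ∧
      ∀ y < j, y ∈ A → adj x y → y ∈ cells (s'.nat aQue) (s'.nat vCnt 0)) 40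
    (by decide) (by decide) (by decide) hG.size ?_ ?_ (by omega) fun s' h _ _ => h
  · exact ⟨hq.congr (by simp) (by simp) (by simp), by simp, by simp, by simp⟩
  · rintro j hj s' ⟨h1, h2, h3, h4⟩ hf hij hM
    have hG' := hG.frame hf (by decide)
    have hcur' : s'.nat vCur 0 = x * M := by rw [hf.1 _ (by decide), hcur]
    simp [hij, hcur', hG'.adj x hxM j hj, h1.mark j hj]
    constructor
    · intro hjA hjn hxj _
      have hj' : j ∈ comp adj A v := mem_comp_of_adj hx hxj hjA
      refine ⟨h1.push hj' hjn (by simp) (by simp) (by simp), by omega, ?_, ?_⟩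
      · intro i hi
        rw [Function.update_of_ne (by omega), h3 i hi]
      · intro y hy hyA hxy
        rw [cells_update, Finset.mem_insert]
        by_cases hyj : y = j
        · exact .inl hyj
        · exact .inr (h4 y (by omega) hyA hxy)
    · intro hn _
      refine ⟨h1.congr (by simp) (by simp) (by simp), h2, h3, fun y hy hyA hxy => ?_⟩
      by_cases hyj : y = j
      · subst hyj
        by_contra hc
        exact hn hyA hc hxy
      · exact h4 y (by omega) hyA hxy

/-- Each vertex of the component is dequeued once and its matrix row scanned once. When the queue is
exhausted it is closed under adjacency in `A`, hence is the component. The unmarked vertices left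
over are the input for the next search. -/
theorem runs_bfs {M : ℕ} {adj : ℕ → ℕ → Prop} {A : Finset ℕ} {v : ℕ} {s : State}
    (hG : GraphMem M adj s) (hA : ∀ w ∈ A, w < M) (hm : ∀ w < M, s.nat aMark w = 0 ↔ w ∈ A)
    (hv : s.nat vSrc 0 = v) (hvA : v ∈ A) :
    Runs bfs s ((comp adj A v).card * (M * 60 + 40) + 40) fun s' =>
      (∀ w < M, s'.nat aMark w = 0 ↔ w ∈ A ∧ w ∉ comp adj A v) ∧
      s'.nat vCnt 0 = (comp adj A v).card ∧
      cells (s'.nat aQue) (comp adj A v).card = comp adj A v ∧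
      Set.InjOn (s'.nat aQue) (Set.Iio (comp adj A v).card) := by
  set C := comp adj A v with hC
  have hvC : v ∈ C := self_mem_comp hvA
  simp only [bfs, runs_seq_nstore]
  simp [hv]
  refine Runs.loop (fun N s' => s'.nat vHd 0 ≤ s'.nat vCnt 0 ∧ QueueInv M A C s' ∧
    v ∈ cells (s'.nat aQue) (s'.nat vCnt 0) ∧
    (∀ i < s'.nat vHd 0, ∀ y ∈ A, adj (s'.nat aQue i) y →
      y ∈ cells (s'.nat aQue) (s'.nat vCnt 0)) ∧ N = (C.card - s'.nat vHd 0) * (M * 60 + 40))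
    (C.card * (M * 60 + 40)) ?_ ?_ ?_ ?_
  · have h0 : cells (Function.update (s.nat aQue) 0 v) 1 = {v} := by
      rw [← zero_add 1, cells_update]
      simp
    refine ⟨by simp, ⟨?_, ?_, fun w hw => ?_⟩, by simp [h0], by simp, by simp⟩
    · intro i hi j hj _
      simp at hi hj
      omega
    · simp [h0, hvC]
    · simp [Function.update_apply, h0]
      split_ifs with hwv
      · simp [hwv]
      · simpa [hwv, Ne.symm hwv] using hm w hw
  · rintro N s₁ ⟨h1, h2, h3, h4, rfl⟩ hf hp
    simp at hp
    set x := s₁.nat aQue (s₁.nat vHd 0) with hx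
    have hG₁ : GraphMem M adj s₁ := (hG.congr (by simp) (by simp) (by simp)).frame hf (by decide)
    have hxC : x ∈ C := h2.sub (mem_cells.2 ⟨_, hp, rfl⟩)
    have hxM : x < M := hA x (comp_subset hxC)
    refine ⟨M * 60 + 9 + 12, ?_⟩
    simp [← hx, hG₁.off x hxM]
    refine (runs_scan (hG₁.congr (by simp) (by simp) (by simp))
      (h2.congr (by simp) (by simp) (by simp)) hxC hxM (by simp)).frame.mono
      (by simp) ?_
    rintro s₂ ⟨⟨h5, h6, h7, h8⟩, hf₂⟩
    have hhd : s₂.nat vHd 0 = s₁.nat vHd 0 + 1 := by rw [hf₂.1 _ (by decide)]; simp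
    simp at h6 h7
    have hmono : cells (s₁.nat aQue) (s₁.nat vCnt 0) ⊆ cells (s₂.nat aQue) (s₂.nat vCnt 0) := by
      intro y hy
      obtain ⟨i, hi, rfl⟩ := mem_cells.1 hy
      exact mem_cells.2 ⟨i, by omega, h7 i hi⟩
    refine ⟨?_, by omega, h5, hmono h3, fun i hi y hy hiy => ?_⟩
    · have := h2.cnt_le
      have : C.card - s₁.nat vHd 0 = C.card - s₂.nat vHd 0 + 1 := by omega
      rw [this, Nat.add_mul]
      omega
    · rw [h7 i (by omega)] at hiy
      by_cases hi' : i < s₁.nat vHd 0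
      · exact hmono (h4 i hi' y hy hiy)
      · have : i = s₁.nat vHd 0 := by omega
        subst this
        exact h8 y (hA y hy) hy hiy
  · simp
  · rintro N s₁ ⟨h1, h2, h3, h4, rfl⟩ hp
    simp at hp
    have hall : cells (s₁.nat aQue) (s₁.nat vCnt 0) = C := by
      refine h2.sub.antisymm fun w hw => ?_
      refine comp_induct (p := fun w => w ∈ cells (s₁.nat aQue) (s₁.nat vCnt 0)) h3
        (fun x y hxy _ hy hx => ?_) hw
      obtain ⟨i, hi, rfl⟩ := mem_cells.1 hx
      exact h4 i (by omega) y hy hxy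
    have hcnt : s₁.nat vCnt 0 = C.card := by rw [← hall, card_cells h2.inj]
    refine ⟨fun w hw => ?_, hcnt, ?_, ?_⟩
    · rw [h2.mark w hw, hall]
    · rw [← hcnt, hall]
    · rw [← hcnt]
      exact h2.inj

end RAM

namespace RAM
open Program NExpr BExpr

/-! ### Components and separators in the memory -/

/-- The set of vertices that have not been removed. -/
structure AliveMem (M : ℕ) (A : Finset ℕ) (s : State) : Prop where
  lt : ∀ w ∈ A, w < M
  rem : ∀ w < M, s.nat aRem w = 0 ↔ w ∈ A

theorem AliveMem.congr {M : ℕ} {A : Finset ℕ} {s s' : State} (h : AliveMem M A s)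
    (h9 : s'.nat aRem = s.nat aRem) : AliveMem M A s' := ⟨h.lt, h9 ▸ h.rem⟩

theorem AliveMem.card_le {M : ℕ} {A : Finset ℕ} {s : State} (h : AliveMem M A s) :
    A.card ≤ M := by
  rw [← Finset.card_range M]
  exact Finset.card_le_card fun w hw => Finset.mem_range.2 (h.lt w hw)

/-- The component that is being separated. -/
structure CompMem (C : Finset ℕ) (s : State) : Prop where
  card : s.nat vCsz 0 = C.card
  cells : cells (s.nat aCl) C.card = C
  inj : Set.InjOn (s.nat aCl) (Set.Iio C.card)

theorem CompMem.congr {C : Finset ℕ} {s s' : State} (h : CompMem C s)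
    (h1 : s'.nat vCsz = s.nat vCsz) (h2 : s'.nat aCl = s.nat aCl) : CompMem C s' :=
  ⟨h1 ▸ h.card, h2 ▸ h.cells, h2 ▸ h.inj⟩

theorem CompMem.mem {C : Finset ℕ} {s : State} (h : CompMem C s) {i : ℕ} (hi : i < C.card) :
    s.nat aCl i ∈ C := by
  have := (mem_cells (q := s.nat aCl)).2 ⟨i, hi, rfl⟩
  rwa [h.cells] at this

variable {M : ℕ} {adj : ℕ → ℕ → Prop} {A C : Finset ℕ} {v : ℕ} {s : State}

theorem cells_congr {q q' : ℕ → ℕ} {c : ℕ} (h : ∀ i < c, q i = q' i) : cells q c = cells q' c :=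
  Finset.image_congr fun i hi => h i (by simpa using hi)

theorem runs_resetMarks (hM : s.nat vM 0 = M) :
    Runs resetMarks s (M * 30 + 9) fun s' => ∀ w < M, s'.nat aMark w = s.nat aRem w := by
  refine Runs.for M (fun j s' => ∀ w < j, s'.nat aMark w = s.nat aRem w) 18
    (by decide) (by decide) (by decide) hM (by simp) ?_ (by omega) fun s' h _ _ => h
  intro j hj s' h hf hij _
  have h9 : s'.nat aRem = s.nat aRem := hf.1 _ (by decide)
  simp [hij, h9, Function.update_apply]
  intro _ w hw
  split_ifs with hwj
  · rw [hwj]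
  · exact h w (by omega)

theorem runs_component (hG : GraphMem M adj s) (hA : AliveMem M A s) (hv : s.nat vPick 0 = v)
    (hvA : v ∈ A) :
    Runs component s (M * (M * 60 + 100) + 80) (CompMem (comp adj A v)) := by
  have hle : (comp adj A v).card ≤ M := (Finset.card_le_card comp_subset).trans hA.card_le
  refine (runs_resetMarks hG.size).seq
    (T₂ := M * (M * 60 + 70) + 71) ?_ (by rw [Nat.mul_add, Nat.mul_add]; omega)
  intro s₁ h₁ hf₁
  simp [hf₁.1 vPick (by decide), hv]
  refine (runs_bfs (v := v) ((hG.frame hf₁ (by decide)).congr (by simp) (by simp) (by simp)) hA.lt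
    (fun w hw => ?_) (by simp) hvA).seq (T₂ := M * 30 + 20) ?_ ?_
  · simp [h₁ w hw, hA.rem w hw]
  · rintro s₂ ⟨-, h2, h3, h4⟩ -
    simp [h2]
    refine Runs.for (comp adj A v).card (fun j s' => ∀ i < j, s'.nat aCl i = s₂.nat aQue i) 18
      (by decide) (by decide) (by decide) (by simp) (by simp) ?_ (by omega) ?_
    · intro j hj s' h hf hij _
      have h9 : s'.nat aQue = s₂.nat aQue := by rw [hf.1 _ (by decide)]; simp
      simp [hij, h9, Function.update_apply]
      intro _ w hw
      split_ifs with hwj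
      · rw [hwj]
      · exact h w (by omega)
    · intro s' h hf _
      refine ⟨?_, ?_, ?_⟩
      · rw [hf.1 _ (by decide)]
        simp
      · rw [cells_congr h, h3]
      · intro i hi j hj hij
        rw [h i hi, h j hj] at hij
        exact h4 hi hj hij
  · have := Nat.mul_le_mul_right (M * 60 + 40) hle
    rw [Nat.mul_add, Nat.mul_add] at *
    omega

/-- Every component of `A \ S` that meets `C` has at most half of the size of `C`. -/
def Balanced (adj : ℕ → ℕ → Prop) (A C S : Finset ℕ) : Prop :=
  ∀ w ∈ C \ S, 2 * (comp adj (A \ S) w).card ≤ C.card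

/-- The set that is given by the digits. -/
def digitSet (s : State) : Finset ℕ := cells (fun i => s.nat aCl (s.nat aDig i)) (s.nat vLen 0)

theorem digitSet_congr {s' : State} (h1 : s'.nat aCl = s.nat aCl) (h2 : s'.nat aDig = s.nat aDig)
    (h3 : s'.nat vLen = s.nat vLen) : digitSet s' = digitSet s := by
  simp [digitSet, h1, h2, h3]

/-- The invariant of the balance test: `U` is the set of the unmarked vertices. -/
def CheckInv (M : ℕ) (adj : ℕ → ℕ → Prop) (A C S : Finset ℕ) (B i : ℕ) (s : State) : Prop :=
  ∃ U ⊆ A \ S, (∀ w < M, s.nat aMark w = 0 ↔ w ∈ U) ∧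
    (∀ x y, adj x y → x ∈ U → y ∈ A \ S → y ∈ U) ∧ (∀ j < i, s.nat aCl j ∉ U) ∧
    (A \ S) \ U ⊆ C ∧
    (1 ≤ s.nat vOk 0 ↔ ∀ w ∈ (A \ S) \ U, 2 * (comp adj (A \ S) w).card ≤ C.card) ∧
    B = U.card * (M * 60 + 40) + (C.card - i) * 100

/-- Each search is charged to the vertices it marks, so all searches together cost O(`M ^ 2`), not
O(`M ^ 2`) each. The unmarked set loses whole components only, so every search finds a component of
`A \ S`. -/
theorem runs_check (hs : ∀ x y, adj x y → adj y x) (hG : GraphMem M adj s) (hA : AliveMem M A s)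
    (hvA : v ∈ A) (hC : C = comp adj A v) (hCm : CompMem C s)
    (hd : ∀ i < s.nat vLen 0, s.nat aDig i < C.card) :
    Runs check s (M * (M * 60 + 240) + s.nat vLen 0 * 30 + 40) fun s' =>
      1 ≤ s'.nat vOk 0 ↔ Balanced adj A C (digitSet s) := by
  set S := digitSet s with hS
  have hCA : C ⊆ A := hC ▸ comp_subset
  have hcM : C.card ≤ M := (Finset.card_le_card hCA).trans hA.card_le
  have hSC : S ⊆ C := by
    intro x hx
    obtain ⟨i, hi, rfl⟩ := mem_cells.1 hx
    exact hCm.mem (hd i hi)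
  have hcomp : ∀ x ∈ C, comp adj A x = C := fun x hx => by
    rw [hC] at hx ⊢
    exact comp_eq_of_mem hs hvA hx
  refine (runs_resetMarks hG.size).seq
    (T₂ := M * (M * 60 + 210) + s.nat vLen 0 * 30 + 31) ?_
    (by rw [Nat.mul_add, Nat.mul_add]; omega)
  intro s₁ h₁ hf₁
  have hlen₁ : s₁.nat vLen = s.nat vLen := hf₁.1 _ (by decide)
  have hdig₁ : s₁.nat aDig = s.nat aDig := hf₁.1 _ (by decide)
  have hcl₁ : s₁.nat aCl = s.nat aCl := hf₁.1 _ (by decide)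
  refine Runs.seq (T₁ := s.nat vLen 0 * 30 + 9) (T₂ := M * (M * 60 + 210) + 22)
    (R := fun s' => ∀ w < M, s'.nat aMark w = 0 ↔ w ∈ A \ S) ?_ ?_ (by omega)
  · refine Runs.for (s.nat vLen 0) (fun j s' => ∀ w < M, s'.nat aMark w = 0 ↔
      w ∈ A ∧ w ∉ cells (fun i => s.nat aCl (s.nat aDig i)) j) 18
      (by decide) (by decide) (by decide) (by rw [hlen₁]) ?_ ?_ (by omega) ?_
    · intro w hw
      simp [h₁ w hw, hA.rem w hw]
    · intro j hj s' h hf hij _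
      have hdig' : s'.nat aDig = s.nat aDig := by rw [hf.1 _ (by decide), hdig₁]
      have hcl' : s'.nat aCl = s.nat aCl := by rw [hf.1 _ (by decide), hcl₁]
      simp [hij, hdig', hcl', Function.update_apply]
      intro _ w hw
      have := h w hw
      rw [mem_cells] at this
      rw [mem_cells]
      split_ifs with hwj
      · simp only [false_iff, not_and, not_not]
        exact fun _ => ⟨j, by omega, hwj.symm⟩
      · rw [this]
        refine and_congr_right fun _ => not_congr ⟨fun ⟨i, hi, h⟩ => ⟨i, by omega, h⟩,
          fun ⟨i, hi, h⟩ => ⟨i, ?_, h⟩⟩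
        rcases Nat.lt_succ_iff_lt_or_eq.1 hi with hi | hi
        · exact hi
        · exact absurd (hi ▸ h).symm hwj
    · intro s' h _ _ w hw
      rw [h w hw, Finset.mem_sdiff]
      rfl
  intro s₂ h₂ hf₂
  simp
  have hf₁₂ : ∀ r ∉ check.nats, s₂.nat r = s.nat r := fun r hr => by
    rw [hf₂.1 r (fun h => hr ?_), hf₁.1 r (fun h => hr ?_)]
    · exact List.mem_append_left _ h
    · exact List.mem_append_right _ (List.mem_append_left _ h)
  have hCm₂ : CompMem C s₂ := hCm.congr (hf₁₂ _ (by decide)) (hf₁₂ _ (by decide))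
  refine Runs.forBudget C.card (CheckInv M adj A C S)
    ((A \ S).card * (M * 60 + 40) + C.card * 100)
    (by decide) (by decide) (by decide) (by simp [hCm₂.card]) ?_ ?_ ?_ ?_
  · refine ⟨A \ S, subset_rfl, ?_, fun _ _ _ _ h => h, by simp, by simp, by simp, by simp⟩
    intro w hw
    simpa using h₂ w hw
  · rintro B i hi s₃ ⟨U, hU, hm, hcl, hj, hUC, hok, rfl⟩ hf hii hsz
    refine ⟨if s₃.nat aCl i ∈ U then (comp adj U (s₃.nat aCl i)).card * (M * 60 + 40) + 80
      else 20, ?_⟩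
    have hCm₃ : CompMem C s₃ := (hCm₂.congr (by simp) (by simp)).congr (hf.1 _ (by decide))
      (hf.1 _ (by decide))
    have hG₃ : GraphMem M adj s₃ :=
      (hG.congr (hf₁₂ _ (by decide)) (hf₁₂ _ (by decide)) (hf₁₂ _ (by decide))).congr
        (by rw [hf.1 _ (by decide)]; simp) (by rw [hf.1 _ (by decide)]; simp)
        (by rw [hf.1 _ (by decide)]; simp)
    set x := s₃.nat aCl i with hx
    have hxC : x ∈ C := hCm₃.mem hi
    have hxM : x < M := hA.lt x (hCA hxC)
    have hsub : C.card - i = C.card - (i + 1) + 1 := by omega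
    rw [runs_ite]
    simp [hii, ← hx, hm x hxM]
    refine ⟨by split_ifs <;> omega, fun hxU => ?_, fun hxU => ?_⟩
    · rw [if_pos hxU]
      have hD : comp adj U x = comp adj (A \ S) x := comp_eq_of_closed hU hcl hxU
      have hDC : comp adj (A \ S) x ⊆ C :=
        (comp_mono Finset.sdiff_subset).trans (hcomp x hxC).le
      have hxAS : x ∈ A \ S := hU hxU
      refine ⟨by omega, (runs_bfs (v := x) (hG₃.congr (by simp) (by simp) (by simp))
        (fun w hw => hA.lt w (Finset.sdiff_subset (hU hw))) (fun w hw => ?_) (by simp)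
        hxU).seq (T₂ := 22) ?_ (by omega)⟩
      · simpa using hm w hw
      rintro s₄ ⟨h5, h6, -, -⟩ hf₄
      have hok₄ : s₄.nat vOk = s₃.nat vOk := by rw [hf₄.1 _ (by decide)]; simp
      have hcl₄ : s₄.nat aCl = s₃.nat aCl := by rw [hf₄.1 _ (by decide)]; simp
      have hcs₄ : s₄.nat vCsz = s₃.nat vCsz := by rw [hf₄.1 _ (by decide)]; simp
      -- `s₅` stands for the state after either branch of the size comparison; the invariant is
      -- restored in the same way for both.
      have key : ∀ s₅ : State, s₅.nat aMark = s₄.nat aMark → s₅.nat aCl = s₃.nat aCl →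
          (1 ≤ s₅.nat vOk 0 ↔ 1 ≤ s₃.nat vOk 0 ∧ 2 * (comp adj (A \ S) x).card ≤ C.card) →
          ∃ U' ⊆ A \ S, (∀ w < M, s₅.nat aMark w = 0 ↔ w ∈ U') ∧
            (∀ x y, adj x y → x ∈ U' → y ∈ A \ S → y ∈ U') ∧ (∀ j < i + 1, s₅.nat aCl j ∉ U') ∧
            (A \ S) \ U' ⊆ C ∧
            (1 ≤ s₅.nat vOk 0 ↔ ∀ w ∈ (A \ S) \ U', 2 * (comp adj (A \ S) w).card ≤ C.card) ∧
            U'.card + (comp adj U x).card = U.card := by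
        intro s₅ hm₅ hcl₅ hok₅
        refine ⟨U \ comp adj U x, Finset.sdiff_subset.trans hU, fun w hw => ?_, ?_, ?_, ?_, ?_, ?_⟩
        · rw [hm₅, h5 w hw, Finset.mem_sdiff]
        · intro y z hyz hy hz
          rw [Finset.mem_sdiff] at hy ⊢
          exact ⟨hcl y z hyz hy.1 hz, fun hzD => hy.2 (mem_comp_of_adj hzD (hs _ _ hyz) hy.1)⟩
        · intro j hji
          rw [hcl₅, Finset.mem_sdiff, not_and, not_not]
          intro hjU
          by_cases hji' : j < i
          · exact absurd hjU (hj j hji')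
          · have : j = i := by omega
            subst this
            exact self_mem_comp hxU
        · intro w hw
          obtain ⟨hw1, hw2⟩ := Finset.mem_sdiff.1 hw
          rw [Finset.mem_sdiff, not_and, not_not] at hw2
          by_cases hwU : w ∈ U
          · exact hDC (hD ▸ hw2 hwU)
          · exact hUC (Finset.mem_sdiff.2 ⟨hw1, hwU⟩)
        · rw [hok₅, hok]
          constructor
          · rintro ⟨h7, h8⟩ w hw
            obtain ⟨hw1, hw2⟩ := Finset.mem_sdiff.1 hw
            rw [Finset.mem_sdiff, not_and, not_not] at hw2
            by_cases hwU : w ∈ U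
            · rw [comp_eq_of_mem hs hxAS (hD ▸ hw2 hwU)]
              exact h8
            · exact h7 w (Finset.mem_sdiff.2 ⟨hw1, hwU⟩)
          · intro h7
            refine ⟨fun w hw => h7 w ?_, h7 x ?_⟩
            · rw [Finset.mem_sdiff] at hw ⊢
              exact ⟨hw.1, fun h => hw.2 (Finset.mem_sdiff.1 h).1⟩
            · exact Finset.mem_sdiff.2 ⟨hxAS, fun h => (Finset.mem_sdiff.1 h).2 (self_mem_comp hxU)⟩
        · exact Finset.card_sdiff_add_card_eq_card comp_subset
      have hbud : ∀ U' : Finset ℕ, U'.card + (comp adj U x).card = U.card →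
          U'.card * (M * 60 + 40) + (C.card - (i + 1)) * 100 +
            ((comp adj U x).card * (M * 60 + 40) + 80) ≤
            U.card * (M * 60 + 40) + (C.card - i) * 100 := by
        intro U' hU'
        rw [← hU', hsub, Nat.add_mul, Nat.add_mul]
        omega
      simp [hcs₄, hCm₃.card, h6, hD]
      constructor
      · intro hlt _
        obtain ⟨U', h7, h8, h9, h10, h11, h12, h13⟩ := key
          ((s₄.nwrite vOk 0 0).nwrite vCi 0 (i + 1)) (by simp) (by simp [hcl₄])
          (by simp; omega)
        exact ⟨_, hD ▸ hbud U' h13, U', h7, h8, h9, h10, h11, h12, rfl⟩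
      · intro hlt _
        obtain ⟨U', h7, h8, h9, h10, h11, h12, h13⟩ := key
          (s₄.nwrite vCi 0 (i + 1)) (by simp) (by simp [hcl₄])
          (by simp [hok₄]; omega)
        exact ⟨_, hD ▸ hbud U' h13, U', h7, h8, h9, h10, h11, h12, rfl⟩
    · rw [if_neg hxU]
      refine ⟨by omega, fun _ => ⟨_, ?_, U, hU, by simpa using hm, hcl,
        ?_, hUC, by simpa using hok, rfl⟩⟩
      · rw [hsub]
        omega
      · intro j hji
        by_cases hji' : j < i
        · simpa using hj j hji'
        · have : j = i := by omega
          subst this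
          simpa [← hx] using hxU
  · have h1 : (A \ S).card ≤ M := (Finset.card_le_card Finset.sdiff_subset).trans hA.card_le
    have := Nat.mul_le_mul_right (M * 60 + 40) h1
    rw [Nat.mul_add, Nat.mul_add] at *
    omega
  · rintro B s₃ ⟨U, hU, hm, hcl, hj, hUC, hok, rfl⟩ hf -
    have hCm₃ : CompMem C s₃ := (hCm₂.congr (by simp) (by simp)).congr (hf.1 _ (by decide))
      (hf.1 _ (by decide))
    rw [hok]
    refine ⟨fun h w hw => h w ?_, fun h w hw => h w ?_⟩
    · rw [Finset.mem_sdiff] at hw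
      refine Finset.mem_sdiff.2 ⟨Finset.mem_sdiff.2 ⟨hCA hw.1, hw.2⟩, ?_⟩
      have := hw.1
      rw [← hCm₃.cells] at this
      obtain ⟨j, hj', rfl⟩ := mem_cells.1 this
      exact hj j hj'
    · rw [Finset.mem_sdiff]
      refine ⟨hUC hw, ?_⟩
      exact (Finset.mem_sdiff.1 (Finset.mem_sdiff.1 hw).1).2

end RAM

/-! ### Bijective numeration -/

/-- The number of a sequence of digits `< c` in bijective numeration. -/
def bijRank (c len : ℕ) (dig : ℕ → ℕ) : ℕ := ∑ i ∈ Finset.range len, (dig i + 1) * c ^ i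

theorem bijRank_succ (c len : ℕ) (dig : ℕ → ℕ) :
    bijRank c (len + 1) dig = c * bijRank c len (fun i => dig (i + 1)) + (dig 0 + 1) := by
  rw [bijRank, Finset.sum_range_succ', bijRank, Finset.mul_sum]
  congr 1
  · exact Finset.sum_congr rfl fun i _ => by ring
  · simp

theorem bijRank_update {c len : ℕ} (dig : ℕ → ℕ) {t : ℕ} (ht : t < len) (z : ℕ) :
    bijRank c len (Function.update dig t z) + (dig t + 1) * c ^ t =
      bijRank c len dig + (z + 1) * c ^ t := by
  have h : ∀ f : ℕ → ℕ, bijRank c len f =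
      (f t + 1) * c ^ t + ∑ i ∈ (Finset.range len).erase t, (f i + 1) * c ^ i := fun f =>
    (Finset.add_sum_erase _ _ (Finset.mem_range.2 ht)).symm
  rw [h, h dig, Finset.sum_congr rfl (g := fun i => (dig i + 1) * c ^ i) fun i hi => by
    rw [Function.update_of_ne (Finset.ne_of_mem_erase hi)], Function.update_self]
  ring

/-- Digits count as `1, …, c`. The lowest one is recovered modulo `c` after subtracting 1, and
division by `c` gives the rest. As no digit counts zero, the length is determined too. -/
theorem bijRank_injective {c len len' : ℕ} {dig dig' : ℕ → ℕ} (hd : ∀ i < len, dig i < c)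
    (hd' : ∀ i < len', dig' i < c) (h : bijRank c len dig = bijRank c len' dig') :
    len = len' ∧ ∀ i < len, dig i = dig' i := by
  induction len generalizing len' dig dig' with
  | zero =>
    cases len' with
    | zero => simp
    | succ l' =>
      rw [bijRank_succ] at h
      simp [bijRank] at h
  | succ l ih =>
    cases len' with
    | zero =>
      rw [bijRank_succ] at h
      simp [bijRank] at h
    | succ l' =>
      rw [bijRank_succ, bijRank_succ] at h
      have h0 := hd 0 (by omega)
      have h0' := hd' 0 (by omega)
      have h1 : c * bijRank c l (fun i => dig (i + 1)) + dig 0 =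
          c * bijRank c l' (fun i => dig' (i + 1)) + dig' 0 := by omega
      have h2 := congrArg (· % c) h1
      have h3 := congrArg (· / c) h1
      simp only [Nat.mul_add_mod, Nat.mod_eq_of_lt h0, Nat.mod_eq_of_lt h0',
        Nat.mul_add_div (by omega : 0 < c), Nat.div_eq_of_lt h0, Nat.div_eq_of_lt h0',
        add_zero] at h2 h3
      obtain ⟨h4, h5⟩ := ih (fun i hi => hd (i + 1) (by omega))
        (fun i hi => hd' (i + 1) (by omega)) h3
      refine ⟨by omega, fun i hi => ?_⟩
      cases i with
      | zero => exact h2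
      | succ i => exact h5 i (by omega)

/-- Enumerating by rank therefore tries shorter sequences first, so the search never exceeds the
length of a known separator. -/
theorem len_le_of_bijRank_le {c len len' : ℕ} {dig dig' : ℕ → ℕ} (hd' : ∀ i < len', dig' i < c)
    (h : bijRank c len dig ≤ bijRank c len' dig') : len ≤ len' := by
  induction len' generalizing len dig dig' with
  | zero =>
    cases len with
    | zero => rfl
    | succ l =>
      rw [bijRank_succ] at h
      simp [bijRank] at h
  | succ l' ih =>
    cases len with
    | zero => exact Nat.zero_le _
    | succ l =>
      rw [bijRank_succ, bijRank_succ] at h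
      have h0' := hd' 0 (by omega)
      refine Nat.succ_le_succ (ih (fun i hi => hd' (i + 1) (by omega))
        (dig := fun i => dig (i + 1)) ?_)
      by_contra hlt
      have h2 := Nat.mul_le_mul_left c (Nat.succ_le_of_lt (not_le.1 hlt))
      rw [Nat.mul_succ] at h2
      omega

theorem bijRank_le {c len : ℕ} {dig : ℕ → ℕ} (hd : ∀ i < len, dig i < c) (hc : 1 ≤ c) :
    bijRank c len dig ≤ len * c ^ len := by
  refine (Finset.sum_le_card_nsmul _ _ (c ^ len) fun i hi => ?_).trans (by simp)
  have hi := Finset.mem_range.1 hi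
  calc (dig i + 1) * c ^ i ≤ c * c ^ i := Nat.mul_le_mul_right _ (hd i hi)
    _ = c ^ (i + 1) := by ring
    _ ≤ c ^ len := Nat.pow_le_pow_right hc hi

/-! ### Brute force search for a balanced separator -/

namespace RAM
open Program NExpr BExpr

variable {M : ℕ} {adj : ℕ → ℕ → Prop} {A C : Finset ℕ} {v : ℕ} {s : State}

/-- The digits have the number `N`. -/
structure DigitInv (c N : ℕ) (s : State) : Prop where
  lt : ∀ i < s.nat vLen 0, s.nat aDig i < c
  rank_eq : bijRank c (s.nat vLen 0) (s.nat aDig) = N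

theorem DigitInv.congr {c N : ℕ} {s' : State} (h : DigitInv c N s)
    (h1 : s'.nat vLen 0 = s.nat vLen 0) (h2 : s'.nat aDig = s.nat aDig) : DigitInv c N s' :=
  ⟨by rw [h1, h2]; exact h.lt, by rw [h1, h2]; exact h.rank_eq⟩

/-- The invariant of the carry loop: the first `t` digits have been reset. -/
def CarryInv (c N L B : ℕ) (s : State) : Prop :=
  ∃ t ≤ L, s.nat vTi 0 = t ∧ s.nat vLen 0 = L ∧ s.nat vCsz 0 = c ∧ (∀ i < L, s.nat aDig i < c) ∧
    bijRank c L (s.nat aDig) + c ^ t = N + 1 ∧ B = (L - t) * 40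

theorem runs_increment {c N : ℕ} (hc : s.nat vCsz 0 = c) (hc1 : 1 ≤ c) (hd : DigitInv c N s) :
    Runs increment s (s.nat vLen 0 * 40 + 50) (DigitInv c (N + 1)) := by
  simp only [increment, runs_seq_nstore]
  simp
  -- Resetting `t` digits from `c - 1` to `0` lowers the rank by `c ^ t - 1`. The missing `c ^ t` is
  -- supplied by raising digit `t` or, if all digits overflowed, by appending a new digit `0`, which
  -- counts as 1.
  refine Runs.seq (T₁ := s.nat vLen 0 * 40 + 20) (T₂ := 25)
    (R := fun s' => ∃ t ≤ s.nat vLen 0, s'.nat vTi 0 = t ∧ (∀ i < s.nat vLen 0, s'.nat aDig i < c) ∧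
      bijRank c (s.nat vLen 0) (s'.nat aDig) + c ^ t = N + 1 ∧
      (t < s.nat vLen 0 → s'.nat aDig t + 1 < c)) ?_ ?_ (by omega)
  · refine Runs.loop (CarryInv c N (s.nat vLen 0)) (s.nat vLen 0 * 40) ?_ ?_ (by simp) ?_
    · refine ⟨0, by omega, by simp, by simp, by simpa using hc, by simpa using hd.lt, ?_, by simp⟩
      simp [hd.rank_eq]
    · rintro B s₁ ⟨t, ht, h1, hlen, hcs, h2, h3, rfl⟩ hf hp
      simp [h1, hlen, hcs] at hp
      refine ⟨15, ?_⟩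
      simp [h1]
      have hlt := h2 t hp.1
      have hr := bijRank_update (c := c) (s₁.nat aDig) hp.1 0
      have e : s₁.nat aDig t + 1 = c := by omega
      rw [e] at hr
      refine ⟨_, ?_, t + 1, hp.1, by simp, by simpa using hlen, by simpa using hcs,
        fun i hi => ?_, ?_, rfl⟩
      · have : s.nat vLen 0 - t = s.nat vLen 0 - (t + 1) + 1 := by omega
        rw [this, Nat.add_mul]
        omega
      · simp [Function.update_apply]
        split_ifs
        · omega
        · exact h2 i hi
      · simp
        rw [pow_succ, mul_comm (c ^ t)]
        omega
    · rintro B s₁ ⟨t, ht, h1, hlen, hcs, h2, h3, rfl⟩ hp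
      refine ⟨t, ht, h1, h2, h3, fun htl => ?_⟩
      simpa [h1, hlen, hcs, htl] using hp
  · rintro s₁ ⟨t, ht, h1, h2, h3, h4⟩ hf
    have hlen : s₁.nat vLen 0 = s.nat vLen 0 := by rw [hf.1 _ (by decide)]; simp
    simp [h1, hlen]
    constructor
    · intro htl
      refine ⟨?_, ?_⟩
      · simp [hlen, Function.update_apply]
        intro i hi
        split_ifs with hit
        · exact h4 htl
        · exact h2 i hi
      · have hr := bijRank_update (c := c) (s₁.nat aDig) htl (s₁.nat aDig t + 1)
        simp [hlen]
        rw [Nat.add_mul (s₁.nat aDig t + 1)] at hr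
        omega
    · intro htl
      have : t = s.nat vLen 0 := by omega
      subst this
      refine ⟨?_, ?_⟩
      · simp [Function.update_apply]
        intro i hi
        split_ifs with hit
        · omega
        · exact h2 i (by omega)
      · simp [bijRank, Finset.sum_range_succ]
        rw [← h3, bijRank]
        congr 1
        refine Finset.sum_congr rfl fun i hi => ?_
        rw [Function.update_of_ne (Finset.mem_range.1 hi).ne]

/-- The separator that was found. -/
structure Separator (adj : ℕ → ℕ → Prop) (A C : Finset ℕ) (k : ℕ) (s : State) : Prop where
  len_le : s.nat vLen 0 ≤ k + 1
  len_pos : 1 ≤ s.nat vLen 0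
  lt : ∀ i < s.nat vLen 0, s.nat aDig i < C.card
  balanced : Balanced adj A C (digitSet s)

/-- An existing separator is some digit sequence `τ`, so the search stops at the rank of `τ` at the
latest, after at most `(k + 1) * C.card ^ (k + 1)` attempts. It may stop earlier with a different
separator, which is not longer. -/
theorem runs_search {k : ℕ} (hs : ∀ x y, adj x y → adj y x) (hG : GraphMem M adj s)
    (hA : AliveMem M A s) (hvA : v ∈ A) (hC : C = comp adj A v) (hCm : CompMem C s)
    (hk : ∃ S ⊆ C, S.card ≤ k + 1 ∧ S.Nonempty ∧ Balanced adj A C S) :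
    Runs search s ((k + 1) * C.card ^ (k + 1) * (M * (M * 60 + 240) + (k + 1) * 80 + 100) + 20)
      (Separator adj A C k) := by
  obtain ⟨S, hSC, hSk, hSn, hSb⟩ := hk
  have hc1 : 1 ≤ C.card := Finset.card_pos.2 (hSn.mono hSC)
  have hidx : ∀ x ∈ S, ∃ i < C.card, s.nat aCl i = x := fun x hx => by
    rw [← mem_cells, hCm.cells]
    exact hSC hx
  choose! idx hidx₁ hidx₂ using hidx
  let τ : ℕ → ℕ := fun i => if h : i < S.card then idx (S.equivFin.symm ⟨i, h⟩) else 0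
  have hτ : ∀ i < S.card, τ i < C.card := fun i hi => by
    simp only [τ, hi, dif_pos]
    exact hidx₁ _ (S.equivFin.symm ⟨i, hi⟩).2
  have hτS : cells (fun i => s.nat aCl (τ i)) S.card = S := by
    ext x
    rw [mem_cells]
    constructor
    · rintro ⟨i, hi, rfl⟩
      simp only [τ, hi, dif_pos]
      rw [hidx₂ _ (S.equivFin.symm ⟨i, hi⟩).2]
      exact (S.equivFin.symm ⟨i, hi⟩).2
    · intro hx
      refine ⟨S.equivFin ⟨x, hx⟩, Fin.is_lt _, ?_⟩
      simp only [τ, Fin.is_lt, dif_pos]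
      simp [hidx₂ x hx]
  set N := bijRank C.card S.card τ with hN
  have hN0 : 1 ≤ N := by
    obtain ⟨l, hl⟩ : ∃ l, S.card = l + 1 := ⟨S.card - 1, by have := hSn.card_pos; omega⟩
    rw [hN, hl, bijRank_succ]
    omega
  have hNle : N ≤ (k + 1) * C.card ^ (k + 1) :=
    (bijRank_le hτ hc1).trans (Nat.mul_le_mul hSk (Nat.pow_le_pow_right hc1 hSk))
  simp only [search, runs_seq_nstore]
  simp
  set K := M * (M * 60 + 240) + (k + 1) * 80 + 100 with hK
  refine Runs.loop (fun B s' => ∃ N' ≤ N, DigitInv C.card N' s' ∧ B = (N - N') * K ∧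
    (s'.nat vOk 0 = 0 → N' < N) ∧ (1 ≤ s'.nat vOk 0 → Separator adj A C k s')) (N * K) ?_ ?_ ?_ ?_
  · refine ⟨0, by omega, ⟨by simp, by simp [bijRank]⟩, by simp, fun _ => hN0, by simp⟩
  · rintro B s₁ ⟨N', hN', hD, rfl, h1, h2⟩ hf hp
    simp at hp
    have hlt := h1 hp
    have hlen : s₁.nat vLen 0 ≤ k + 1 :=
      (len_le_of_bijRank_le hτ (hD.rank_eq.trans_le hN')).trans hSk
    have hCm₁ : CompMem C s₁ := (hCm.congr (by simp) (by simp)).congr (hf.1 _ (by decide))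
      (hf.1 _ (by decide))
    have hG₁ : GraphMem M adj s₁ := (hG.congr (by simp) (by simp) (by simp)).frame hf (by decide)
    have hA₁ : AliveMem M A s₁ := (hA.congr (by simp)).congr (hf.1 _ (by decide))
    refine ⟨K - 5, ?_⟩
    refine (runs_increment hCm₁.card hc1 hD).seq
      (T₂ := M * (M * 60 + 240) + (k + 1) * 30 + 40) ?_ (by omega)
    intro s₂ hD₂ hf₂
    have hCm₂ : CompMem C s₂ := hCm₁.congr (hf₂.1 _ (by decide)) (hf₂.1 _ (by decide))
    have hlen₂ : s₂.nat vLen 0 ≤ k + 1 :=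
      (len_le_of_bijRank_le hτ (hD₂.rank_eq.trans_le hlt)).trans hSk
    refine (runs_check hs (hG₁.frame hf₂ (by decide)) (hA₁.congr (hf₂.1 _ (by decide))) hvA hC hCm₂
      hD₂.lt).frame.mono (by omega) ?_
    rintro s₃ ⟨h3, hf₃⟩
    have hlen₃ : s₃.nat vLen = s₂.nat vLen := hf₃.1 _ (by decide)
    have hdig₃ : s₃.nat aDig = s₂.nat aDig := hf₃.1 _ (by decide)
    have hcl₃ : s₃.nat aCl = s₂.nat aCl := hf₃.1 _ (by decide)
    have hD₃ : DigitInv C.card (N' + 1) s₃ := hD₂.congr (by rw [hlen₃]) hdig₃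
    refine ⟨(N - (N' + 1)) * K, ?_, N' + 1, hlt, hD₃, rfl, fun h0 => ?_, fun hok => ?_⟩
    · have : N - N' = N - (N' + 1) + 1 := by omega
      rw [this, Nat.add_mul, one_mul]
      simp only [BExpr.cost, NExpr.cost]
      clear_value K
      omega
    -- At the rank of `τ` the digits are those of `τ`, and the check would have succeeded.
    · refine lt_of_le_of_ne hlt fun he => ?_
      have : ¬ Balanced adj A C (digitSet s₂) := fun h => by
        have := h3.2 h
        omega
      refine this ?_
      obtain ⟨h4, h5⟩ := bijRank_injective hD₂.lt hτ (by rw [hD₂.rank_eq, he])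
      have : digitSet s₂ = S := by
        rw [digitSet, cells_congr (q' := fun i => s.nat aCl (τ i)) fun i hi => ?_, h4, hτS]
        rw [h5 i hi, hf₂.1 aCl (by decide), hf.1 aCl (by decide)]
        simp
      rwa [this]
    · have hds : digitSet s₃ = digitSet s₂ := digitSet_congr hcl₃ hdig₃ hlen₃
      refine ⟨by rw [hlen₃]; exact hlen₂, ?_, hD₃.lt, by rw [hds]; exact h3.1 hok⟩
      by_contra h0
      have h6 := hD₃.rank_eq
      have : s₃.nat vLen 0 = 0 := by omega
      rw [this] at h6
      simp [bijRank] at h6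
  · have := Nat.mul_le_mul_right K hNle
    simp only [BExpr.cost, NExpr.cost]
    clear_value K
    omega
  · rintro B s₁ ⟨N', hN', hD, rfl, h1, h2⟩ hp
    simp at hp
    exact h2 (by omega)

end RAM

namespace RAM
open Program NExpr BExpr

/-! ### The table in the memory -/

/-- The data of the instance that the dynamic program uses. -/
structure DataMem (n M : ℕ) (w : ℕ → ℝ) (adj : ℕ → ℕ → Prop) (s : State) : Prop where
  graph : GraphMem M adj s
  players : s.nat 0 0 = n
  pow : ∀ i ≤ M, s.nat aPow i = 2 ^ i
  wgt : ∀ x < M, s.real aWgt x = w x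

theorem DataMem.congr {n M : ℕ} {w : ℕ → ℝ} {adj : ℕ → ℕ → Prop} {s s' : State}
    (h : DataMem n M w adj s) (h4 : s'.nat vM = s.nat vM) (h6 : s'.nat aOff = s.nat aOff)
    (h7 : s'.nat aAdj = s.nat aAdj) (h0 : s'.nat 0 = s.nat 0) (h8 : s'.nat aPow = s.nat aPow)
    (h3 : s'.real aWgt = s.real aWgt) : DataMem n M w adj s' :=
  ⟨h.graph.congr h4 h6 h7, h0 ▸ h.players, h8 ▸ h.pow, h3 ▸ h.wgt⟩

theorem DataMem.frame {n M : ℕ} {w : ℕ → ℝ} {adj : ℕ → ℕ → Prop} {P : Program} {s s' : State}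
    (h : DataMem n M w adj s) (hf : Frame P s s')
    (hP : vM ∉ P.nats ∧ aOff ∉ P.nats ∧ aAdj ∉ P.nats ∧ 0 ∉ P.nats ∧ aPow ∉ P.nats ∧
      aWgt ∉ P.reals) : DataMem n M w adj s' :=
  h.congr (hf.1 _ hP.1) (hf.1 _ hP.2.1) (hf.1 _ hP.2.2.1) (hf.1 _ hP.2.2.2.1)
    (hf.1 _ hP.2.2.2.2.1) (hf.2 _ hP.2.2.2.2.2)

/-- The positions of the stack in `Y` whose vertices are not adjacent to `x`. -/
noncomputable def clear (adj : ℕ → ℕ → Prop) (x : ℕ) (stk : ℕ → ℕ) (Y : Finset ℕ) : Finset ℕ :=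
  open Classical in Y.filter fun i => ¬ adj x (stk i)

theorem mem_clear {adj : ℕ → ℕ → Prop} {x : ℕ} {stk : ℕ → ℕ} {Y : Finset ℕ} {i : ℕ} :
    i ∈ clear adj x stk Y ↔ i ∈ Y ∧ ¬ adj x (stk i) := by
  simp [clear]

theorem clear_subset {adj : ℕ → ℕ → Prop} {x : ℕ} {stk : ℕ → ℕ} {Y : Finset ℕ} :
    clear adj x stk Y ⊆ Y := fun _ h => (mem_clear.1 h).1

/-- Deleting an element strictly lowers the code, so one comparison of numbers detects whether
anything was deleted. -/
theorem code_clear_eq_iff {adj : ℕ → ℕ → Prop} {x : ℕ} {stk : ℕ → ℕ} {Y : Finset ℕ} :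
    code Y ≤ code (clear adj x stk Y) ↔ ¬ ∃ y ∈ Y.image stk, adj x y := by
  constructor
  · rintro h ⟨y, hy, hxy⟩
    obtain ⟨i, hi, rfl⟩ := Finset.mem_image.1 hy
    have : code (clear adj x stk Y) < code Y := by
      refine Finset.sum_lt_sum_of_subset clear_subset hi ?_ (by positivity) fun _ _ _ => by
        positivity
      simp [mem_clear, hxy]
    omega
  · intro h
    have : clear adj x stk Y = Y := by
      ext i
      rw [mem_clear]
      exact ⟨And.left, fun hi => ⟨hi, fun hx => h ⟨_, Finset.mem_image_of_mem _ hi, hx⟩⟩⟩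
    rw [this]

/-- Entry `y` belongs to the set of stack positions with binary code `y`. Pushing a vertex adds a
new highest bit: the old indices keep their meaning and the table doubles. -/
structure TableMem (n : ℕ) (w : ℕ → ℝ) (adj : ℕ → ℕ → Prop) (P : Finset ℕ) (s : State) :
    Prop where
  size : s.nat vTsz 0 = 2 ^ s.nat vHt 0
  inj : Set.InjOn (s.nat aStk) (Set.Iio (s.nat vHt 0))
  sub : cells (s.nat aStk) (s.nat vHt 0) ⊆ P
  tab : ∀ Y ⊆ Finset.range (s.nat vHt 0), ∃ X, s.nat aSel (code Y) = code X ∧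
    IsBest n w adj P (cells (s.nat aStk) (s.nat vHt 0)) (Y.image (s.nat aStk)) X
      (s.real aTab (code Y))

variable {n M : ℕ} {w : ℕ → ℝ} {adj : ℕ → ℕ → Prop} {P : Finset ℕ} {x : ℕ} {s s' : State}

theorem TableMem.congr (h : TableMem n w adj P s) (h1 : s'.nat vTsz = s.nat vTsz)
    (h2 : s'.nat vHt = s.nat vHt) (h3 : s'.nat aStk = s.nat aStk) (h4 : s'.nat aSel = s.nat aSel)
    (h5 : s'.real aTab = s.real aTab) : TableMem n w adj P s' :=
  ⟨by rw [h1, h2]; exact h.size, by rw [h2, h3]; exact h.inj, by rw [h2, h3]; exact h.sub,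
    by rw [h2, h3, h4, h5]; exact h.tab⟩

theorem TableMem.mem (h : TableMem n w adj P s) {i : ℕ} (hi : i < s.nat vHt 0) :
    s.nat aStk i ∈ P := h.sub (mem_cells.2 ⟨i, hi, rfl⟩)

theorem TableMem.ht_le (h : TableMem n w adj P s) : s.nat vHt 0 ≤ P.card := by
  rw [← card_cells h.inj]
  exact Finset.card_le_card h.sub

theorem subset_range_succ {Y : Finset ℕ} {d : ℕ} (h : Y ⊆ Finset.range (d + 1)) :
    Y ⊆ Finset.range d ∨ ∃ Z ⊆ Finset.range d, d ∉ Z ∧ Y = insert d Z := by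
  by_cases hd : d ∈ Y
  · refine .inr ⟨Y.erase d, fun i hi => ?_, by simp, (Finset.insert_erase hd).symm⟩
    have h1 := Finset.mem_range.1 (h (Finset.mem_of_mem_erase hi))
    have h2 := Finset.ne_of_mem_erase hi
    exact Finset.mem_range.2 (by omega)
  · refine .inl fun i hi => ?_
    have h1 := Finset.mem_range.1 (h hi)
    have h2 : i ≠ d := fun e => hd (e ▸ hi)
    exact Finset.mem_range.2 (by omega)

theorem TableMem.push (h : TableMem n w adj P s) (hx : x ∉ P)
    (h1 : s'.nat vHt 0 = s.nat vHt 0 + 1) (h2 : s'.nat vTsz 0 = s.nat vTsz 0 + s.nat vTsz 0)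
    (h3 : s'.nat aStk = Function.update (s.nat aStk) (s.nat vHt 0) x)
    (h4 : ∀ Y ⊆ Finset.range (s.nat vHt 0), ∃ X, s'.nat aSel (code Y) = code X ∧
      IsBest n w adj (insert x P) (insert x (cells (s.nat aStk) (s.nat vHt 0)))
        (Y.image (s.nat aStk)) X (s'.real aTab (code Y)))
    (h5 : ∀ Y ⊆ Finset.range (s.nat vHt 0), ∃ X, s'.nat aSel (2 ^ s.nat vHt 0 + code Y) = code X ∧
      IsBest n w adj (insert x P) (insert x (cells (s.nat aStk) (s.nat vHt 0)))
        (insert x (Y.image (s.nat aStk))) X (s'.real aTab (2 ^ s.nat vHt 0 + code Y))) :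
    TableMem n w adj (insert x P) s' := by
  have himg : ∀ Y ⊆ Finset.range (s.nat vHt 0),
      Y.image (Function.update (s.nat aStk) (s.nat vHt 0) x) = Y.image (s.nat aStk) := by
    intro Y hY
    refine Finset.image_congr fun i hi => ?_
    rw [Function.update_of_ne (Finset.mem_range.1 (hY hi)).ne]
  refine ⟨?_, ?_, ?_, fun Y hY => ?_⟩
  · rw [h1, h2, h.size]
    ring
  · rw [h1, h3]
    exact injOn_update h.inj fun hc => hx (h.sub hc)
  · rw [h1, h3, cells_update]
    exact Finset.insert_subset_insert _ h.sub
  · rw [h1] at hY ⊢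
    rw [h3, cells_update]
    rcases subset_range_succ hY with hY | ⟨Z, hZ, hdZ, rfl⟩
    · rw [himg Y hY]
      exact h4 Y hY
    · rw [Finset.image_insert, himg Z hZ, Function.update_self, code_insert hdZ, add_comm]
      exact h5 Z hZ

/-- The invariant of the loop in `decode`: the digits from `j` on have been treated. -/
def DecodeInv (Y Z : Finset ℕ) (d B : ℕ) (s : State) : Prop :=
  ∃ j ≤ d, s.nat vTj 0 = j ∧ s.nat vTr 0 = code (Y.filter (· < j)) ∧
    s.nat vTz 0 + code (Z.filter (· < j)) = code Z ∧ B = j * 60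

/-- `vTr` holds the bits of `Y` still to be read and `vTz` the collected bits of the result, so
`vTz` plus the untreated part of the result is constant. -/
theorem runs_decode {Y : Finset ℕ} (hD : DataMem n M w adj s) (hx : s.nat vX 0 = x) (hxM : x < M)
    (hd : s.nat vHt 0 ≤ M) (hst : ∀ i < s.nat vHt 0, s.nat aStk i < M)
    (hY : Y ⊆ Finset.range (s.nat vHt 0)) (hy : s.nat vTy 0 = code Y) :
    Runs decode s (s.nat vHt 0 * 60 + 20) fun s' =>
      s'.nat vTz 0 = code (clear adj x (s.nat aStk) Y) := by
  set d := s.nat vHt 0 with hd'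
  set Z := clear adj x (s.nat aStk) Y with hZ
  have hfull : ∀ W ⊆ Finset.range d, W.filter (· < d) = W := fun W hW =>
    Finset.filter_true_of_mem fun i hi => Finset.mem_range.1 (hW hi)
  simp only [decode, runs_seq_nstore]
  simp [hy, ← hd']
  refine Runs.loop (DecodeInv Y Z d) (d * 60) ?_ ?_ ?_ ?_
  · exact ⟨d, le_rfl, by simp, by simp [hfull Y hY], by simp [hfull Z (clear_subset.trans hY)], rfl⟩
  · rintro B s₁ ⟨j, hj, h1, h2, h3, rfl⟩ hf hp
    simp [h1] at hp
    obtain ⟨i, rfl⟩ : ∃ i, j = i + 1 := ⟨j - 1, by omega⟩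
    have hD₁ : DataMem n M w adj s₁ :=
      (hD.congr (by simp) (by simp) (by simp) (by simp) (by simp) (by simp)).frame hf (by decide)
    have hst₁ : s₁.nat aStk = s.nat aStk := by rw [hf.1 _ (by decide)]; simp
    have hx₁ : s₁.nat vX 0 = x := by rw [hf.1 _ (by decide)]; simp [hx]
    have hlt := code_filter_lt Y i
    rw [code_filter_range_succ] at h2 h3
    have hpow := hD₁.pow i (by omega)
    have hadj := hD₁.graph.adj x hxM (s.nat aStk i) (hst i (by omega))
    have hiZ : i ∈ Z ↔ i ∈ Y ∧ ¬ adj x (s.nat aStk i) := mem_clear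
    refine ⟨48, ?_⟩
    simp [h1, hpow, hx₁, hst₁, hD₁.graph.off x hxM]
    refine ⟨fun hle => ⟨fun h0 => ?_, fun h0 => ?_⟩, fun hle => ?_⟩
    · have hiY : i ∈ Y := by
        by_contra hc
        rw [if_neg hc] at h2
        omega
      have hna : ¬ adj x (s.nat aStk i) := fun h => by
        have := hadj.2 h
        omega
      rw [if_pos hiY] at h2
      rw [if_pos (hiZ.2 ⟨hiY, hna⟩)] at h3
      exact ⟨_, by omega, i, by omega, by simp, by simp; omega, by simp; omega, rfl⟩
    · have hiY : i ∈ Y := by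
        by_contra hc
        rw [if_neg hc] at h2
        omega
      have hna : adj x (s.nat aStk i) := hadj.1 (by omega)
      rw [if_pos hiY] at h2
      rw [if_neg fun h => (hiZ.1 h).2 hna] at h3
      exact ⟨_, by omega, i, by omega, by simp, by simp; omega, by simp; omega, rfl⟩
    · have hiY : i ∉ Y := by
        intro hc
        rw [if_pos hc] at h2
        omega
      rw [if_neg hiY] at h2
      rw [if_neg fun h => hiY (hiZ.1 h).1] at h3
      exact ⟨_, by omega, i, by omega, by simp, by simp; omega, by simp; omega, rfl⟩
  · simp
  · rintro B s₁ ⟨j, hj, h1, h2, h3, rfl⟩ hp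
    simp [h1] at hp
    subst hp
    simpa [code] using h3

end RAM

/-! ### Pushing and popping a vertex -/

namespace RAM
open Program NExpr BExpr

variable {n M : ℕ} {w : ℕ → ℝ} {adj : ℕ → ℕ → Prop} {P : Finset ℕ} {x : ℕ} {s : State}

/-- The lower half of the table is unchanged. -/
def LowerEq (D : ℕ) (s s' : State) : Prop :=
  ∀ z < D, s'.real aTab z = s.real aTab z ∧ s'.nat aSel z = s.nat aSel z

/-- The first `y` entries of the upper half of the table of a new vertex have been computed: the
set `Y` of positions obtains the profit `f Y` and the selection `g Y`. -/
structure UpperInv (d : ℕ) (f : Finset ℕ → ℝ) (g : Finset ℕ → ℕ) (y : ℕ) (s s' : State) : Prop where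
  lower : LowerEq (2 ^ d) s s'
  upper : ∀ Y ⊆ Finset.range d, code Y < y →
    s'.real aTab (2 ^ d + code Y) = f Y ∧ s'.nat aSel (2 ^ d + code Y) = g Y

theorem UpperInv.step {d y : ℕ} {f : Finset ℕ → ℝ} {g : Finset ℕ → ℕ} {s' s'' : State}
    (h : UpperInv d f g y s s') {Y : Finset ℕ} (hY : code Y = y)
    (ht : s''.real aTab = Function.update (s'.real aTab) (2 ^ d + y) (f Y))
    (hn : s''.nat aSel = Function.update (s'.nat aSel) (2 ^ d + y) (g Y)) :
    UpperInv d f g (y + 1) s s'' := by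
  refine ⟨fun z hz => ?_, fun Z hZ hz => ?_⟩
  · rw [ht, hn, Function.update_of_ne (by omega), Function.update_of_ne (by omega)]
    exact h.lower z hz
  · rw [ht, hn]
    by_cases hzy : code Z = y
    · have : Z = Y := code_injective (hzy.trans hY.symm)
      subst this
      simp [hzy]
    · rw [Function.update_of_ne (by omega), Function.update_of_ne (by omega)]
      exact h.upper Z hZ (by omega)

/-- The situation in which the vertex `x` is pushed on the stack. -/
structure PushMem (n M : ℕ) (w : ℕ → ℝ) (adj : ℕ → ℕ → Prop) (P : Finset ℕ) (x : ℕ) (s : State) :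
    Prop where
  data : DataMem n M w adj s
  table : TableMem n w adj P s
  lt : x < M
  vertex : s.nat vX 0 = x
  processed : P ⊆ Finset.range M

theorem PushMem.ht_le (h : PushMem n M w adj P x s) : s.nat vHt 0 ≤ M := by
  refine h.table.ht_le.trans ?_
  simpa using Finset.card_le_card h.processed

theorem PushMem.stk_lt (h : PushMem n M w adj P x s) : ∀ i < s.nat vHt 0, s.nat aStk i < M :=
  fun _ hi => Finset.mem_range.1 (h.processed (h.table.mem hi))

theorem PushMem.runs_decode {s₀ : State} {L : Program} {Y : Finset ℕ}
    (h : PushMem n M w adj P x s₀) (hf : Frame L s₀ s)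
    (hL : vM ∉ L.nats ∧ aOff ∉ L.nats ∧ aAdj ∉ L.nats ∧ 0 ∉ L.nats ∧ aPow ∉ L.nats ∧
      aWgt ∉ L.reals) (hL' : vX ∉ L.nats ∧ vHt ∉ L.nats ∧ aStk ∉ L.nats)
    (hY : Y ⊆ Finset.range (s₀.nat vHt 0)) (hy : s.nat vTy 0 = code Y) :
    Runs decode s (s₀.nat vHt 0 * 60 + 20) fun s' =>
      s'.nat vTz 0 = code (clear adj x (s₀.nat aStk) Y) := by
  have h1 := hf.1 _ hL'.1
  have h2 := hf.1 _ hL'.2.1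
  have h3 := hf.1 _ hL'.2.2
  have := RAM.runs_decode (h.data.frame hf hL) (by rw [h1, h.vertex]) h.lt
    (by rw [h2]; exact h.ht_le) (by rw [h2, h3]; exact h.stk_lt) (by rw [h2]; exact hY) hy
  rwa [h2, h3] at this

theorem runs_dropPlayer (h : PushMem n M w adj P x s) :
    Runs dropPlayer s (2 ^ s.nat vHt 0 * (s.nat vHt 0 * 60 + 60) + 9)
      (UpperInv (s.nat vHt 0) (fun Y => s.real aTab (code (clear adj x (s.nat aStk) Y)))
        (fun Y => s.nat aSel (code (clear adj x (s.nat aStk) Y))) (2 ^ s.nat vHt 0) s) := by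
  set d := s.nat vHt 0 with hd
  refine Runs.for (2 ^ d) (fun y s' => UpperInv d
      (fun Y => s.real aTab (code (clear adj x (s.nat aStk) Y)))
        (fun Y => s.nat aSel (code (clear adj x (s.nat aStk) Y))) y s s') (d * 60 + 20 + 28)
    (by decide) (by decide) (by decide) h.table.size ?_ ?_ (by rw [add_assoc, add_assoc])
    fun s' h _ _ => h
  · exact ⟨fun z _ => by simp, by simp⟩
  · intro y hy s₁ hI hf hty hsz
    obtain ⟨Y, hY, rfl⟩ := exists_code_eq_of_lt hy
    refine (h.runs_decode hf (by decide) (by decide) hY hty).seq (T₂ := 28) ?_ le_rfl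
    intro s₂ hz hf₂
    have h1 : s₂.nat vTsz 0 = 2 ^ d := by rw [hf₂.1 _ (by decide), hsz]
    have h2 : s₂.nat vTy 0 = code Y := by rw [hf₂.1 _ (by decide), hty]
    have h3 : s₂.real aTab = s₁.real aTab := hf₂.2 _ (by decide)
    have h4 : s₂.nat aSel = s₁.nat aSel := hf₂.1 _ (by decide)
    -- The entry that is read lies in the lower half, which this loop leaves untouched.
    have hlow := hI.lower (code (clear adj x (s.nat aStk) Y)) (code_lt (clear_subset.trans hY))
    simp [h1, h2, hz]
    intro _
    refine hI.step (Y := Y) rfl ?_ ?_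
    · simp [h3, hlow.1]
    · simp [h4, hlow.2]

theorem runs_demandPenalty (h : PushMem n M w adj P x s) :
    Runs demandPenalty s (2 ^ s.nat vHt 0 * (s.nat vHt 0 * 60 + 70) + 9)
      (UpperInv (s.nat vHt 0) (fun Y => if code Y ≤ code (clear adj x (s.nat aStk) Y)
        then s.real aTab (code Y) - w x else s.real aTab (code Y))
        (fun Y => s.nat aSel (code Y)) (2 ^ s.nat vHt 0) s) := by
  set d := s.nat vHt 0 with hd
  refine Runs.for (2 ^ d) (fun y s' => UpperInv d
      (fun Y => if code Y ≤ code (clear adj x (s.nat aStk) Y)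
        then s.real aTab (code Y) - w x else s.real aTab (code Y))
        (fun Y => s.nat aSel (code Y)) y s s') (d * 60 + 20 + 38)
    (by decide) (by decide) (by decide) h.table.size ?_ ?_ (by rw [add_assoc, add_assoc])
    fun s' h _ _ => h
  · exact ⟨fun z _ => by simp, by simp⟩
  · intro y hy s₁ hI hf hty hsz
    obtain ⟨Y, hY, rfl⟩ := exists_code_eq_of_lt hy
    refine (h.runs_decode hf (by decide) (by decide) hY hty).seq (T₂ := 38) ?_ le_rfl
    intro s₂ hz hf₂
    have h1 : s₂.nat vTsz 0 = 2 ^ d := by rw [hf₂.1 _ (by decide), hsz]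
    have h2 : s₂.nat vTy 0 = code Y := by rw [hf₂.1 _ (by decide), hty]
    have h3 : s₂.real aTab = s₁.real aTab := hf₂.2 _ (by decide)
    have h4 : s₂.nat aSel = s₁.nat aSel := hf₂.1 _ (by decide)
    have h5 : s₂.real aWgt x = w x := by
      rw [hf₂.2 _ (by decide), hf.2 _ (by decide)]
      exact h.data.wgt x h.lt
    have h6 : s₂.nat vX 0 = x := by rw [hf₂.1 _ (by decide), hf.1 _ (by decide), h.vertex]
    have hlow := hI.lower (code Y) (code_lt hY)
    simp [h1, h2, hz, h6, h5]
    constructor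
    · intro hle _
      refine hI.step (Y := Y) rfl ?_ ?_
      · simp [h3, hlow.1, hle]
      · simp [h4, hlow.2]
    · intro hle _
      refine hI.step (Y := Y) rfl ?_ ?_
      · simp [h3, hlow.1, not_le.2 hle]
      · simp [h4, hlow.2]

/-- The first `y` entries have been updated for the selected player `x`, the others are unchanged. -/
def SelectInv (w : ℕ → ℝ) (x : ℕ) (s : State) (y : ℕ) (s' : State) : Prop :=
  ∀ z, (z < y → s'.real aTab z = s.real aTab z + w x ∧ s'.nat aSel z = s.nat aSel z + 2 ^ x) ∧
    (y ≤ z → s'.real aTab z = s.real aTab z ∧ s'.nat aSel z = s.nat aSel z)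

theorem runs_selectPlayer {D : ℕ} (hD : s.nat vTsz 0 = D) (hx : s.nat vX 0 = x)
    (hp : s.nat aPow x = 2 ^ x) (hw : s.real aWgt x = w x) :
    Runs selectPlayer s (D * 50 + 9) (SelectInv w x s D) := by
  refine Runs.for D (SelectInv w x s) 30
    (by decide) (by decide) (by decide) hD (fun z => by simp) ?_ (by omega) fun s' h _ _ => h
  intro y hy s₁ hI hf hty _
  have h1 : s₁.nat vX 0 = x := by rw [hf.1 _ (by decide), hx]
  have h2 : s₁.nat aPow x = 2 ^ x := by rw [hf.1 _ (by decide), hp]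
  have h3 : s₁.real aWgt x = w x := by rw [hf.2 _ (by decide), hw]
  simp [hty, h1, h2, h3]
  intro _ z
  have hy' := (hI y).2 le_rfl
  simp [Function.update_apply]
  refine ⟨fun hz => ?_, fun hz => ?_⟩
  · split_ifs with hzy
    · subst hzy
      simp [hy'.1, hy'.2]
    · exact (hI z).1 (by omega)
  · rw [if_neg (by omega), if_neg (by omega)]
    exact (hI z).2 (by omega)

theorem image_clear (stk : ℕ → ℕ) (Y : Finset ℕ) [DecidablePred fun y => ¬ adj x y] :
    (clear adj x stk Y).image stk = (Y.image stk).filter fun y => ¬ adj x y := by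
  ext y
  simp only [Finset.mem_image, mem_clear, Finset.mem_filter]
  constructor
  · rintro ⟨i, ⟨h1, h2⟩, rfl⟩
    exact ⟨⟨i, h1, rfl⟩, h2⟩
  · rintro ⟨⟨i, h1, rfl⟩, h2⟩
    exact ⟨i, ⟨h1, h2⟩, rfl⟩

theorem image_subset_cells {stk : ℕ → ℕ} {d : ℕ} {Y : Finset ℕ} (hY : Y ⊆ Finset.range d) :
    Y.image stk ⊆ cells stk d := Finset.image_subset_image hY

/-- All rests on `hN`: processed neighbours of `x` have not been popped yet. The labels of the main
loop guarantee it. -/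
theorem runs_introduce (hb : Bip n adj) (h : PushMem n M w adj P x s) (hx : x ∉ P)
    (hN : ∀ y ∈ P, adj x y → y ∈ cells (s.nat aStk) (s.nat vHt 0)) :
    Runs introduce s (2 ^ s.nat vHt 0 * (s.nat vHt 0 * 60 + 120) + 70) fun s' =>
      TableMem n w adj (insert x P) s' ∧ s'.nat vHt 0 = s.nat vHt 0 + 1 ∧
      s'.nat aStk = Function.update (s.nat aStk) (s.nat vHt 0) x ∧
      s'.nat aRem = Function.update (s.nat aRem) x 1 := by
  classical
  obtain ⟨d, hd⟩ : ∃ d, s.nat vHt 0 = d := ⟨_, rfl⟩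
  have hKP := h.table.sub
  have htab := h.table.tab
  have hdrop := runs_dropPlayer h
  have hdemand := runs_demandPenalty h
  rw [hd] at hN hKP htab hdrop hdemand
  rw [hd]
  have hpos : 1 ≤ 2 ^ d := Nat.one_le_two_pow
  have hnP : ∀ {X : Finset ℕ} {Z : Finset ℕ} {t : ℝ}, IsBest n w adj P (cells (s.nat aStk) d) Z X t → x ∉ X :=
    fun h hxX => hx (h.1.1 x hxX).1
  have hexp : 2 ^ d * (d * 60 + 120) = 2 ^ d * (d * 60 + 60) + 2 ^ d * 60 := by ring
  have hexp' : 2 ^ d * (d * 60 + 120) = 2 ^ d * (d * 60 + 70) + 2 ^ d * 50 := by ring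
  rw [introduce, runs_seq_ite]
  simp only [BExpr.cost, NExpr.cost, BExpr.Holds, NExpr.eval, h.vertex, h.data.players, not_le, not_lt]
  refine ⟨by omega, fun hxn => ?_, fun hxn => ?_⟩
  · rw [runs_seq_assoc]
    refine hdrop.seq (T₂ := 2 ^ d * 50 + 50) ?_ (by omega)
    intro s₁ h₁ hf₁
    refine (runs_selectPlayer (D := 2 ^ d) (x := x) (w := w) ?_ ?_ ?_ ?_).seq (T₂ := 41) ?_
      (by omega)
    · rw [hf₁.1 _ (by decide), h.table.size, hd]
    · rw [hf₁.1 _ (by decide), h.vertex]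
    · rw [hf₁.1 _ (by decide), h.data.pow x h.lt.le]
    · rw [hf₁.2 _ (by decide), h.data.wgt x h.lt]
    intro s₂ h₂ hf₂
    have e1 : s₂.nat vX 0 = x := by rw [hf₂.1 _ (by decide), hf₁.1 _ (by decide), h.vertex]
    have e2 : s₂.nat vHt 0 = d := by rw [hf₂.1 _ (by decide), hf₁.1 _ (by decide), hd]
    have e3 : s₂.nat vTsz 0 = s.nat vTsz 0 := by rw [hf₂.1 _ (by decide), hf₁.1 _ (by decide)]
    have e4 : s₂.nat aStk = s.nat aStk := by rw [hf₂.1 _ (by decide), hf₁.1 _ (by decide)]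
    have e5 : s₂.nat aRem = s.nat aRem := by rw [hf₂.1 _ (by decide), hf₁.1 _ (by decide)]
    simp [e1, e2, e3, e4, e5]
    refine h.table.push hx (by simp [hd]) (by simp) (by simp [e4, hd]) ?_ ?_ <;> rw [hd]
    · intro Y hY
      obtain ⟨X, hX, hbest⟩ := htab Y hY
      have hlt := code_lt hY
      obtain ⟨h3, h4⟩ := (h₂ (code Y)).1 hlt
      obtain ⟨h5, h6⟩ := h₁.lower (code Y) hlt
      refine ⟨insert x X, ?_, ?_⟩
      · simp [h4, h6, hX, code_insert (hnP hbest)]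
      · simp [h3, h5]
        exact hbest.selectPlayer hx hxn hKP (image_subset_cells hY)
    · intro Y hY
      obtain ⟨X, hX, hbest⟩ := htab (clear adj x (s.nat aStk) Y) (clear_subset.trans hY)
      obtain ⟨h3, h4⟩ := (h₂ (2 ^ d + code Y)).2 (by omega)
      obtain ⟨h5, h6⟩ := h₁.upper Y hY (code_lt hY)
      refine ⟨X, ?_, ?_⟩
      · simp [h4, h6, hX]
      · simp [h3, h5]
        rw [image_clear] at hbest
        exact IsBest.dropPlayer hb (by convert hbest) hx hxn hKP hN
  · refine hdemand.seq (T₂ := 41) ?_ (by omega)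
    intro s₂ h₂ hf₂
    have e1 : s₂.nat vX 0 = x := by rw [hf₂.1 _ (by decide), h.vertex]
    have e2 : s₂.nat vHt 0 = d := by rw [hf₂.1 _ (by decide), hd]
    have e3 : s₂.nat vTsz 0 = s.nat vTsz 0 := by rw [hf₂.1 _ (by decide)]
    have e4 : s₂.nat aStk = s.nat aStk := by rw [hf₂.1 _ (by decide)]
    have e5 : s₂.nat aRem = s.nat aRem := by rw [hf₂.1 _ (by decide)]
    simp [e1, e2, e3, e4, e5]
    refine h.table.push hx (by simp [hd]) (by simp) (by simp [e4, hd]) ?_ ?_ <;> rw [hd]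
    · intro Y hY
      obtain ⟨X, hX, hbest⟩ := htab Y hY
      obtain ⟨h5, h6⟩ := h₂.lower (code Y) (code_lt hY)
      refine ⟨X, ?_, ?_⟩
      · simp [h6, hX]
      · simp [h5]
        exact hbest.ignorePenalty hx hxn hKP (image_subset_cells hY)
    · intro Y hY
      obtain ⟨X, hX, hbest⟩ := htab Y hY
      obtain ⟨h5, h6⟩ := h₂.upper Y hY (code_lt hY)
      refine ⟨X, ?_, ?_⟩
      · simp [h6, hX]
      · have := IsBest.demandPenalty hb hbest hx hxn hKP (image_subset_cells hY) hN
        simp only [nwrite_real, h5]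
        convert this using 1
        by_cases hc : ∃ y ∈ Y.image (s.nat aStk), adj x y
        · rw [if_neg (fun h => code_clear_eq_iff.1 h hc), if_pos hc]
        · rw [if_pos (code_clear_eq_iff.2 hc), if_neg hc]

/-- The first `y` entries of the table have been updated after the top vertex `x` of the stack has
been removed. -/
def ForgetInv (n x D : ℕ) (s : State) (y : ℕ) (s' : State) : Prop :=
  ∀ z, (y ≤ z → s'.real aTab z = s.real aTab z ∧ s'.nat aSel z = s.nat aSel z) ∧
    (z < y → (x < n ∧ s.real aTab (D + z) ≤ s.real aTab z ∧ s'.real aTab z = s.real aTab z ∧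
        s'.nat aSel z = s.nat aSel z) ∨
      (¬ (x < n ∧ s.real aTab (D + z) ≤ s.real aTab z) ∧
        s'.real aTab z = s.real aTab (D + z) ∧ s'.nat aSel z = s.nat aSel (D + z)))

theorem runs_forget {d : ℕ} (hD : DataMem n M w adj s) (hT : TableMem n w adj P s)
    (hP : P ⊆ Finset.range M) (hd : s.nat vHt 0 = d + 1) :
    Runs forget s (2 ^ d * 60 + 60) fun s' =>
      TableMem n w adj P s' ∧ s'.nat vHt 0 = d := by
  have hdM : d + 1 ≤ M := by
    rw [← hd]
    refine hT.ht_le.trans ?_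
    simpa using Finset.card_le_card hP
  set x := s.nat aStk d with hx
  simp only [forget, runs_seq_nstore]
  simp [hd, hD.pow d (by omega), ← hx]
  set s₀ := ((s.nwrite vHt 0 d).nwrite vTsz 0 (2 ^ d)).nwrite vX 0 x with hs₀
  refine Runs.for (2 ^ d) (ForgetInv n x (2 ^ d) s) 40 (by decide) (by decide) (by decide)
    (by simp [hs₀]) (fun z => by simp [hs₀]) ?_ (by omega) ?_
  · intro y hy s₁ hI hf hty hsz
    have h1 : s₁.nat vX 0 = x := by rw [hf.1 _ (by decide)]; simp [hs₀]
    have h2 : s₁.nat 0 0 = n := by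
      rw [hf.1 _ (by decide)]
      simp [hs₀, hD.players]
    have hy1 := (hI y).2
    have hy2 := (hI (2 ^ d + y)).1 (by omega)
    have hy3 := (hI y).1 le_rfl
    simp [h1, h2, hty, hsz]
    constructor
    · intro hxn hle _ z
      simp
      refine ⟨fun hz => (hI z).1 (by omega), fun hz => ?_⟩
      by_cases hzy : z = y
      · subst hzy
        left
        rw [hy2.1, hy3.1] at hle
        exact ⟨hxn, hle, hy3.1, hy3.2⟩
      · simpa using (hI z).2 (by omega)
    · intro hn _ z
      simp [Function.update_apply]
      refine ⟨fun hz => ?_, fun hz => ?_⟩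
      · rw [if_neg (by omega), if_neg (by omega)]
        exact (hI z).1 (by omega)
      · by_cases hzy : z = y
        · subst hzy
          right
          rw [hy2.1, hy3.1] at hn
          simp only [if_true]
          exact ⟨fun hxn => hn hxn, hy2.1, hy2.2⟩
        · simp only [if_neg hzy]
          have := (hI z).2 (by omega)
          simpa using this
  · intro s₁ hI hf _
    have e1 : s₁.nat vHt 0 = d := by rw [hf.1 _ (by decide)]; simp [hs₀]
    have e2 : s₁.nat vTsz 0 = 2 ^ d := by rw [hf.1 _ (by decide)]; simp [hs₀]
    have e3 : s₁.nat aStk = s.nat aStk := by rw [hf.1 _ (by decide)]; simp [hs₀]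
    have hinj := hT.inj
    have hxd : x ∉ cells (s.nat aStk) d := by
      rw [mem_cells]
      rintro ⟨i, hi, hix⟩
      have := hinj (Set.mem_Iio.2 (by omega)) (Set.mem_Iio.2 (by omega)) hix
      omega
    have hins : cells (s.nat aStk) (d + 1) = insert x (cells (s.nat aStk) d) := by
      rw [cells, Finset.range_add_one, Finset.image_insert]
      rfl
    have hcells : cells (s.nat aStk) d = (cells (s.nat aStk) (d + 1)).erase x := by
      rw [hins, Finset.erase_insert hxd]
    refine ⟨⟨by rw [e1, e2], ?_, ?_, fun Y hY => ?_⟩, e1⟩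
    · rw [e1, e3]
      exact hinj.mono fun i hi => Set.mem_Iio.2 (by rw [Set.mem_Iio] at hi; omega)
    · rw [e1, e3, hcells, ← hd]
      exact (Finset.erase_subset _ _).trans hT.sub
    · rw [e1] at hY ⊢
      rw [e3, hcells]
      have hdY : d ∉ Y := fun h => by simpa using hY h
      have hxY : x ∉ Y.image (s.nat aStk) := fun h => hxd (image_subset_cells hY h)
      have hsub : Finset.range d ⊆ Finset.range (d + 1) := Finset.range_subset_range.2 (by omega)
      obtain ⟨X₀, hX₀, hb₀⟩ := hT.tab Y (by rw [hd]; exact hY.trans hsub)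
      obtain ⟨X₁, hX₁, hb₁⟩ := hT.tab (insert d Y) (by
        rw [hd, Finset.insert_subset_iff]
        exact ⟨by simp, hY.trans hsub⟩)
      rw [code_insert hdY, add_comm] at hX₁ hb₁
      rw [Finset.image_insert, ← hx] at hb₁
      rw [hd] at hb₀ hb₁
      -- The indices `code Y` and `2 ^ d + code Y` differ only in the popped vertex. For a player
      -- the better entry survives, for a penalty node the demanded one.
      rcases (hI (code Y)).2 (code_lt hY) with ⟨hxn, hle, h3, h4⟩ | ⟨hn, h3, h4⟩
      · exact ⟨X₀, by rw [h4, hX₀], by rw [h3]; exact (hb₀.forgetPlayer hxn hxY hb₁).2 hle⟩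
      · refine ⟨X₁, by rw [h4, hX₁], ?_⟩
        rw [h3]
        by_cases hxn : x < n
        · exact (hb₀.forgetPlayer hxn hxY hb₁).1 (by
            by_contra hc
            exact hn ⟨hxn, (not_le.1 hc).le⟩)
        · exact hb₁.forgetPenalty (not_lt.1 hxn)

end RAM

namespace RAM
open Program NExpr BExpr

/-! ### The main loop -/

/-- What the running time depends on: `V` is the vertex set of the graph, and every component of an
induced subgraph has a balanced separator with at most `k + 1` vertices. -/
structure Separable (n M k E : ℕ) (adj : ℕ → ℕ → Prop) (V : Finset ℕ) : Prop where
  bip : Bip n adj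
  lt : V ⊆ Finset.range M
  separator : ∀ A ⊆ V, ∀ v ∈ A, ∃ S ⊆ comp adj A v, S.card ≤ k + 1 ∧ S.Nonempty ∧
    Balanced adj A (comp adj A v) S
  pow_le : ∀ A ⊆ V, ∀ v ∈ A, (comp adj A v).card ^ (k + 1) ≤ E

/-- `V \ A` has been processed. By `stack`, a remaining vertex `v` needs only the first `aLab v`
stack positions, so anything above all labels may be popped. In `level`, the number `j` counts
halvings: at most `k + 1` positions were spent on each, which keeps the stack logarithmic in `M` for
fixed `k`. -/
structure MainInv (n M k : ℕ) (w : ℕ → ℝ) (adj : ℕ → ℕ → Prop) (V A : Finset ℕ) (s : State) :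
    Prop where
  data : DataMem n M w adj s
  alive : AliveMem M A s
  sub : A ⊆ V
  table : TableMem n w adj (V \ A) s
  lab_le : ∀ v ∈ A, s.nat aLab v ≤ s.nat vHt 0
  stack : ∀ v ∈ A, ∀ x ∈ V \ A, adj v x → ∃ i < s.nat aLab v, s.nat aStk i = x
  level : ∀ v ∈ A, ∃ j, s.nat aLab v ≤ (k + 1) * j ∧ (comp adj A v).card * 2 ^ j ≤ M
  height : 2 ^ s.nat vHt 0 ≤ (2 * M) ^ (k + 1)

variable {n M k E : ℕ} {w : ℕ → ℝ} {adj : ℕ → ℕ → Prop} {V A C : Finset ℕ} {v : ℕ} {s : State}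

theorem MainInv.congr {s' : State} (h : MainInv n M k w adj V A s)
    (h4 : s'.nat vM = s.nat vM) (h6 : s'.nat aOff = s.nat aOff) (h7 : s'.nat aAdj = s.nat aAdj)
    (h0 : s'.nat 0 = s.nat 0) (h8 : s'.nat aPow = s.nat aPow) (h3 : s'.real aWgt = s.real aWgt)
    (h9 : s'.nat aRem = s.nat aRem) (h10 : s'.nat aLab = s.nat aLab)
    (h25 : s'.nat aStk = s.nat aStk) (h26 : s'.nat vHt = s.nat vHt)
    (h27 : s'.nat vTsz = s.nat vTsz) (h28 : s'.nat aSel = s.nat aSel)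
    (hr4 : s'.real aTab = s.real aTab) : MainInv n M k w adj V A s' where
  data := h.data.congr h4 h6 h7 h0 h8 h3
  alive := h.alive.congr h9
  sub := h.sub
  table := h.table.congr h27 h26 h25 h28 hr4
  lab_le := by rw [h10, h26]; exact h.lab_le
  stack := by rw [h10, h25]; exact h.stack
  level := by rw [h10]; exact h.level
  height := by rw [h26]; exact h.height

/-- The invariant of the loop that pushes the separator: `S` has been pushed. -/
structure PushInv (n M : ℕ) (w : ℕ → ℝ) (adj : ℕ → ℕ → Prop) (V A S : Finset ℕ) (s₀ s : State) :
    Prop where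
  data : DataMem n M w adj s
  alive : AliveMem M (A \ S) s
  table : TableMem n w adj (V \ (A \ S)) s
  ht : s.nat vHt 0 = s₀.nat vHt 0 + S.card
  stk : ∀ i < s₀.nat vHt 0, s.nat aStk i = s₀.nat aStk i
  sub : S ⊆ cells (s.nat aStk) (s.nat vHt 0)

theorem PushInv.congr {S : Finset ℕ} {s₀ s' : State} (h : PushInv n M w adj V A S s₀ s)
    (h4 : s'.nat vM = s.nat vM) (h6 : s'.nat aOff = s.nat aOff) (h7 : s'.nat aAdj = s.nat aAdj)
    (h0 : s'.nat 0 = s.nat 0) (h8 : s'.nat aPow = s.nat aPow) (h3 : s'.real aWgt = s.real aWgt)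
    (h9 : s'.nat aRem = s.nat aRem)
    (h25 : s'.nat aStk = s.nat aStk) (h26 : s'.nat vHt = s.nat vHt)
    (h27 : s'.nat vTsz = s.nat vTsz) (h28 : s'.nat aSel = s.nat aSel)
    (hr4 : s'.real aTab = s.real aTab) : PushInv n M w adj V A S s₀ s' where
  data := h.data.congr h4 h6 h7 h0 h8 h3
  alive := h.alive.congr h9
  table := h.table.congr h27 h26 h25 h28 hr4
  ht := by rw [h26]; exact h.ht
  stk := by rw [h25]; exact h.stk
  sub := by rw [h25, h26]; exact h.sub

theorem sdiff_insert_sdiff {x : ℕ} {S : Finset ℕ} (hAV : A ⊆ V) (hx : x ∈ A) :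
    V \ (A \ insert x S) = insert x (V \ (A \ S)) := by
  ext y
  simp only [Finset.mem_sdiff, Finset.mem_insert]
  by_cases hy : y = x
  · subst hy
    simp [hAV hx]
  · simp [hy]

theorem runs_pushStep {S : Finset ℕ} {s₀ : State} {x : ℕ} (hS : Separable n M k E adj V)
    (h₀ : MainInv n M k w adj V A s₀) (h : PushInv n M w adj V A S s₀ s) (hx : s.nat vX 0 = x)
    (hxA : x ∈ A) (hH : 2 ^ s.nat vHt 0 ≤ (2 * M) ^ (k + 1)) :
    Runs (.ite (nle (load aRem (var vX)) (#0)) introduce .skip) s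
      ((2 * M) ^ (k + 1) * (M * 60 + 120) + 80) (PushInv n M w adj V A (insert x S) s₀) := by
  have hxM : x < M := h₀.alive.lt x hxA
  have hproc : V \ (A \ S) ⊆ Finset.range M := Finset.sdiff_subset.trans hS.lt
  have hpm : PushMem n M w adj (V \ (A \ S)) x s := ⟨h.data, h.table, hxM, hx, hproc⟩
  simp [hx, h.alive.rem x hxM, hxA]
  refine ⟨fun hxS => ?_, fun hxS => ?_⟩
  · have hxP : x ∉ V \ (A \ S) := by simp [hxA, hxS]
    refine (runs_introduce hS.bip hpm hxP ?_).frame.mono ?_ ?_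
    · intro y hy hxy
      -- A processed neighbour of `x` is either in the part of the separator pushed so far or was
      -- processed earlier; then it sits on the stack below the label of `x`.
      by_cases hyS : y ∈ S
      · exact h.sub hyS
      · have hy' : y ∈ V \ A := by
          simp only [Finset.mem_sdiff] at hy ⊢
          tauto
        obtain ⟨i, hi, rfl⟩ := h₀.stack x hxA y hy' hxy
        have := h₀.lab_le x hxA
        refine mem_cells.2 ⟨i, ?_, h.stk i (by omega)⟩
        rw [h.ht]
        omega
    · have := hpm.ht_le
      have := Nat.mul_le_mul hH (show s.nat vHt 0 * 60 + 120 ≤ M * 60 + 120 by omega)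
      omega
    · rintro s' ⟨⟨h1, h2, h3, h4⟩, hf⟩
      refine ⟨h.data.frame hf (by decide), ⟨fun y hy => ?_, fun y hy => ?_⟩, ?_, ?_, ?_, ?_⟩
      · exact h₀.alive.lt y (Finset.mem_sdiff.1 hy).1
      · rw [h4, Function.update_apply]
        split_ifs with hyx
        · simp [hyx]
        · rw [h.alive.rem y hy]
          simp [hyx]
      · rw [sdiff_insert_sdiff h₀.sub hxA]
        exact h1
      · rw [h2, h.ht, Finset.card_insert_of_notMem hxS, add_assoc]
      · intro i hi
        rw [h3, Function.update_of_ne, h.stk i hi]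
        rw [h.ht]
        omega
      · rw [h2, h3, cells_update]
        exact Finset.insert_subset_insert _ h.sub
  -- Digits may repeat; a vertex that was already pushed is skipped.
  · rw [Finset.insert_eq_of_mem hxS]
    exact h

/-- Since `2 ^ j ≤ M`, a stack of at most `(k + 1) * j` vertices with one more separator on top has
at most `(2 * 2 ^ j) ^ (k + 1)` subsets. -/
theorem height_le {d j c : ℕ} (hd : d ≤ (k + 1) * j) (hc : 1 ≤ c) (h : c * 2 ^ j ≤ M) :
    2 ^ (d + (k + 1)) ≤ (2 * M) ^ (k + 1) := by
  have h2 : 2 ^ j ≤ M := (Nat.le_mul_of_pos_left _ hc).trans h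
  calc 2 ^ (d + (k + 1)) ≤ 2 ^ ((j + 1) * (k + 1)) := Nat.pow_le_pow_right two_pos (by
        rw [add_mul, mul_comm j]
        omega)
    _ = (2 ^ (j + 1)) ^ (k + 1) := by rw [pow_mul]
    _ ≤ (2 * M) ^ (k + 1) := Nat.pow_le_pow_left (by rw [pow_succ]; omega) _

theorem runs_pushDigits (hS : Separable n M k E adj V)
    (h : MainInv n M k w adj V A s) (hA : ∀ i < s.nat vLen 0, s.nat aCl (s.nat aDig i) ∈ A)
    (hlen : s.nat vLen 0 ≤ k + 1) (hH : 2 ^ (s.nat vHt 0 + (k + 1)) ≤ (2 * M) ^ (k + 1)) :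
    Runs pushDigits s ((k + 1) * ((2 * M) ^ (k + 1) * (M * 60 + 120) + 110) + 9)
      (PushInv n M w adj V A (digitSet s) s) := by
  obtain ⟨K, hK⟩ : ∃ K, K = (2 * M) ^ (k + 1) * (M * 60 + 120) := ⟨_, rfl⟩
  rw [← hK]
  refine Runs.for (s.nat vLen 0) (fun i s' => PushInv n M w adj V A
    (cells (fun i => s.nat aCl (s.nat aDig i)) i) s s') (K + 98)
    (by decide) (by decide) (by decide) rfl ?_ ?_ ?_ fun s' h _ _ => h
  · refine PushInv.congr (s := s) ⟨h.data, ?_, ?_, ?_, fun i _ => rfl, ?_⟩ (by simp) (by simp)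
      (by simp) (by simp) (by simp) (by simp) (by simp) (by simp) (by simp) (by simp) (by simp)
      (by simp)
    · simpa using h.alive
    · simpa using h.table
    · simp
    · simp
  · intro i hi s₃ hI hf hii _
    have hcl₃ : s₃.nat aCl = s.nat aCl := hf.1 _ (by decide)
    have hdig₃ : s₃.nat aDig = s.nat aDig := hf.1 _ (by decide)
    have hle : 2 ^ s₃.nat vHt 0 ≤ (2 * M) ^ (k + 1) := by
      refine le_trans (Nat.pow_le_pow_right two_pos ?_) hH
      have h1 := hI.ht
      have h2 : (cells (fun i => s.nat aCl (s.nat aDig i)) i).card ≤ i :=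
        Finset.card_image_le.trans (by simp)
      omega
    have hset : cells (fun i => s.nat aCl (s.nat aDig i)) (i + 1) =
        insert (s.nat aCl (s.nat aDig i)) (cells (fun i => s.nat aCl (s.nat aDig i)) i) := by
      rw [cells, Finset.range_add_one, Finset.image_insert, cells]
    rw [hset, runs_seq_nstore]
    simp only [NExpr.cost, NExpr.eval, hii, hcl₃, hdig₃]
    have hI' : PushInv n M w adj V A (cells (fun i => s.nat aCl (s.nat aDig i)) i) s
        (s₃.nwrite vX 0 (s.nat aCl (s.nat aDig i))) :=
      hI.congr (by simp) (by simp) (by simp) (by simp) (by simp) (by simp) (by simp) (by simp)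
        (by simp) (by simp) (by simp) (by simp)
    refine ⟨by omega, (runs_pushStep hS h hI' (by simp) (hA i hi) (by simpa using hle)).mono
      (by omega) ?_⟩
    intro s₄ hI' _
    exact hI'.congr (by simp) (by simp) (by simp) (by simp) (by simp) (by simp) (by simp)
      (by simp) (by simp) (by simp) (by simp) (by simp)
  · exact Nat.add_le_add_right (Nat.mul_le_mul_right _ hlen) _

theorem runs_label (h : CompMem C s) :
    Runs label s (C.card * 30 + 9) fun s' => ∀ u, (u ∈ C → s'.nat aLab u = s.nat vHt 0) ∧
      (u ∉ C → s'.nat aLab u = s.nat aLab u) := by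
  refine Runs.for C.card (fun i s' => ∀ u, (u ∈ cells (s.nat aCl) i →
      s'.nat aLab u = s.nat vHt 0) ∧ (u ∉ cells (s.nat aCl) i → s'.nat aLab u = s.nat aLab u)) 18
    (by decide) (by decide) (by decide) h.card (by simp) ?_ le_rfl ?_
  · intro i hi s₄ hI hf hii _
    have hcl₄ : s₄.nat aCl = s.nat aCl := hf.1 _ (by decide)
    have hht₄ : s₄.nat vHt = s.nat vHt := hf.1 _ (by decide)
    have : cells (s.nat aCl) (i + 1) = insert (s.nat aCl i) (cells (s.nat aCl) i) := by
      rw [cells, Finset.range_add_one, Finset.image_insert, cells]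
    simp only [runs_nstore, NExpr.cost, NExpr.eval, hii, hcl₄, hht₄, this]
    refine ⟨by omega, fun _ u => ?_⟩
    simp [Function.update_apply]
    split_ifs with hu
    · simp [hu]
    · simpa [hu] using hI u
  · intro s₄ hI _ _
    rwa [h.cells] at hI

/-- Vertices of `C` may use the whole new stack, and their components have halved once more.
Remaining vertices outside `C` keep their labels, because no vertex of `S ⊆ C` is adjacent to them.
-/
theorem MainInv.label {s₂ s₃ s₄ : State} {j : ℕ} (hsymm : ∀ x y, adj x y → adj y x)
    (h : MainInv n M k w adj V A s) (hC : C = comp adj A v)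
    (hj1 : s.nat vHt 0 ≤ (k + 1) * j) (hj2 : C.card * 2 ^ j ≤ M)
    (hH : 2 ^ (s.nat vHt 0 + (k + 1)) ≤ (2 * M) ^ (k + 1))
    {S : Finset ℕ} (hSC : S ⊆ C) (hScard : S.card ≤ k + 1) (hbal : Balanced adj A C S)
    (hht₂ : s₂.nat vHt = s.nat vHt) (hstk₂ : s₂.nat aStk = s.nat aStk)
    (h₃ : PushInv n M w adj V A S s₂ s₃) (hf : Frame label s₃ s₄)
    (hI : ∀ u, (u ∈ C → s₄.nat aLab u = s₃.nat vHt 0) ∧ (u ∉ C → s₄.nat aLab u = s.nat aLab u)) :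
    MainInv n M k w adj V (A \ S) s₄ := by
  have hht₃ : s₃.nat vHt 0 = s.nat vHt 0 + S.card := by rw [h₃.ht, hht₂]
  have hht₄ : s₄.nat vHt 0 = s.nat vHt 0 + S.card := by rw [hf.1 _ (by decide), hht₃]
  have hstk₄ : s₄.nat aStk = s₃.nat aStk := hf.1 _ (by decide)
  have hstk : ∀ i < s.nat vHt 0, s₃.nat aStk i = s.nat aStk i := fun i hi => by
    rw [h₃.stk i (by rw [hht₂]; exact hi), hstk₂]
  refine ⟨h₃.data.frame hf (by decide), h₃.alive.congr (hf.1 _ (by decide)),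
    Finset.sdiff_subset.trans h.sub, h₃.table.congr (hf.1 _ (by decide)) (hf.1 _ (by decide))
      (hf.1 _ (by decide)) (hf.1 _ (by decide)) (hf.2 _ (by decide)), ?_, ?_, ?_, ?_⟩
  · intro u hu
    have := h.lab_le u (Finset.mem_sdiff.1 hu).1
    by_cases huC : u ∈ C
    · rw [(hI u).1 huC, hht₃, hht₄]
    · rw [(hI u).2 huC, hht₄]
      omega
  · intro u hu x hx hux
    have huA := (Finset.mem_sdiff.1 hu).1
    have hule := h.lab_le u huA
    rw [hstk₄]
    by_cases hxS : x ∈ S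
    · by_cases huC : u ∈ C
      · rw [(hI u).1 huC]
        exact mem_cells.1 (h₃.sub hxS)
      · refine absurd ?_ huC
        have := hSC hxS
        rw [hC] at this ⊢
        exact mem_comp_of_adj this (hsymm _ _ hux) huA
    · have hx' : x ∈ V \ A := by
        simp only [Finset.mem_sdiff] at hx ⊢
        tauto
      obtain ⟨i, hi, hix⟩ := h.stack u huA x hx' hux
      rw [← hstk i (by omega)] at hix
      by_cases huC : u ∈ C
      · exact ⟨i, by rw [(hI u).1 huC, hht₃]; omega, hix⟩
      · exact ⟨i, by rw [(hI u).2 huC]; exact hi, hix⟩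
  · intro u hu
    obtain ⟨huA, huS⟩ := Finset.mem_sdiff.1 hu
    by_cases huC : u ∈ C
    · refine ⟨j + 1, ?_, ?_⟩
      · rw [(hI u).1 huC, hht₃, mul_add]
        omega
      · have := Nat.mul_le_mul_right (2 ^ j) (hbal u (Finset.mem_sdiff.2 ⟨huC, huS⟩))
        rw [pow_succ]
        calc _ = 2 * (comp adj (A \ S) u).card * 2 ^ j := by ring
          _ ≤ M := this.trans hj2
    · obtain ⟨i, h5, h6⟩ := h.level u huA
      refine ⟨i, by rw [(hI u).2 huC]; exact h5, le_trans (Nat.mul_le_mul_right _ ?_) h6⟩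
      exact Finset.card_le_card (comp_mono Finset.sdiff_subset)
  · rw [hht₄]
    exact (Nat.pow_le_pow_right two_pos (by omega)).trans hH

/-- The time for one separator. -/
def sepTime (M k E : ℕ) : ℕ :=
  M * (M * 60 + 100) + 80 + ((k + 1) * E * (M * (M * 60 + 240) + (k + 1) * 80 + 100) + 20 +
    ((k + 1) * ((2 * M) ^ (k + 1) * (M * 60 + 120) + 110) + 9 + (M * 30 + 9)))

/-- The potential is twice the number of remaining vertices plus the stack height: each pushed
vertex lowers the first term by 2 and raises the second by 1, and at least one is pushed. -/
theorem runs_separate (hS : Separable n M k E adj V) (h : MainInv n M k w adj V A s)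
    (hv : s.nat vPick 0 = v) (hvA : v ∈ A) (hlab : s.nat vHt 0 ≤ s.nat aLab v) :
    Runs separate s (sepTime M k E) fun s' => ∃ A' : Finset ℕ, MainInv n M k w adj V A' s' ∧
      2 * A'.card + s'.nat vHt 0 < 2 * A.card + s.nat vHt 0 := by
  have hsymm : ∀ x y, adj x y → adj y x := fun x y h => (hS.bip x y h).1
  have hld : s.nat aLab v = s.nat vHt 0 := le_antisymm (h.lab_le v hvA) hlab
  obtain ⟨C, hC⟩ : ∃ C, C = comp adj A v := ⟨_, rfl⟩
  have hCA : C ⊆ A := hC ▸ comp_subset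
  have hCM : C.card ≤ M := (Finset.card_le_card hCA).trans h.alive.card_le
  obtain ⟨j, hj1, hj2⟩ := h.level v hvA
  have hC1 : 1 ≤ C.card := Finset.card_pos.2 ⟨v, hC ▸ self_mem_comp hvA⟩
  rw [← hC] at hj2
  rw [hld] at hj1
  have hH := height_le hj1 hC1 hj2
  have hsep := hS.separator A h.sub v hvA
  have hE := hS.pow_le A h.sub v hvA
  rw [← hC] at hsep hE
  refine (runs_component h.data.graph h.alive hv hvA).seq ?_ le_rfl
  intro s₁ hCm₁ hf₁
  rw [← hC] at hCm₁
  refine ((runs_search hsymm (h.data.graph.frame hf₁ (by decide))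
    (h.alive.congr (hf₁.1 _ (by decide))) hvA hC hCm₁ hsep).mono (Nat.add_le_add_right
      (Nat.mul_le_mul_right _ (Nat.mul_le_mul_left _ hE)) _) fun _ h => h).seq ?_ le_rfl
  intro s₂ hsp hf₂
  have hfr : ∀ r ∉ component.nats ++ search.nats, s₂.nat r = s.nat r := fun r hr => by
    rw [List.mem_append, not_or] at hr
    rw [hf₂.1 r hr.2, hf₁.1 r hr.1]
  have hfr' : ∀ r, s₂.real r = s.real r := fun r => by
    rw [hf₂.2 r (by simp [show search.reals = [] from rfl]),
      hf₁.2 r (by simp [show component.reals = [] from rfl])]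
  have hCm₂ : CompMem C s₂ := hCm₁.congr (hf₂.1 _ (by decide)) (hf₂.1 _ (by decide))
  have h₂ : MainInv n M k w adj V A s₂ :=
    h.congr (hfr _ (by decide)) (hfr _ (by decide)) (hfr _ (by decide)) (hfr _ (by decide))
      (hfr _ (by decide)) (hfr' _) (hfr _ (by decide)) (hfr _ (by decide)) (hfr _ (by decide))
      (hfr _ (by decide)) (hfr _ (by decide)) (hfr _ (by decide)) (hfr' _)
  have hht₂ : s₂.nat vHt = s.nat vHt := hfr _ (by decide)
  have hlab₂ : s₂.nat aLab = s.nat aLab := hfr _ (by decide)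
  have hstk₂ : s₂.nat aStk = s.nat aStk := hfr _ (by decide)
  have hdC : ∀ i < s₂.nat vLen 0, s₂.nat aCl (s₂.nat aDig i) ∈ C := fun i hi => by
    have : s₂.nat aCl (s₂.nat aDig i) ∈ cells (s₂.nat aCl) C.card :=
      mem_cells.2 ⟨_, hsp.lt i hi, rfl⟩
    rwa [hCm₂.cells] at this
  refine (runs_pushDigits hS h₂ (fun i hi => hCA (hdC i hi)) hsp.len_le
    (by rw [hht₂]; exact hH)).seq ?_ le_rfl
  intro s₃ h₃ hf₃
  have hCm₃ : CompMem C s₃ := hCm₂.congr (hf₃.1 _ (by decide)) (hf₃.1 _ (by decide))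
  have hlab₃ : s₃.nat aLab = s.nat aLab := by rw [hf₃.1 _ (by decide), hlab₂]
  have hSC : digitSet s₂ ⊆ C := by
    intro x hx
    obtain ⟨i, hi, rfl⟩ := mem_cells.1 hx
    exact hdC i hi
  have hScard : (digitSet s₂).card ≤ k + 1 :=
    (Finset.card_image_le.trans (by simp)).trans hsp.len_le
  have hSpos : 1 ≤ (digitSet s₂).card :=
    Finset.card_pos.2 ⟨_, mem_cells.2 ⟨0, hsp.len_pos, rfl⟩⟩
  refine (runs_label hCm₃).frame.mono (by omega) ?_
  rintro s₄ ⟨hI, hf⟩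
  rw [hlab₃] at hI
  have hht₄ : s₄.nat vHt 0 = s.nat vHt 0 + (digitSet s₂).card := by
    rw [hf.1 _ (by decide), h₃.ht, hht₂]
  have hAS : (A \ digitSet s₂).card + (digitSet s₂).card = A.card :=
    Finset.card_sdiff_add_card_eq_card (hSC.trans hCA)
  exact ⟨A \ digitSet s₂, h.label hsymm hC hj1 hj2 hH hSC hScard hsp.balanced hht₂ hstk₂ h₃ hf hI,
    by rw [hht₄]; omega⟩

theorem runs_pick (hM : s.nat vM 0 = M) (hA : AliveMem M A s) :
    Runs pick s (M * 60 + 20) fun s' =>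
      (s'.nat vPick 0 = M ∧ ∀ v ∈ A, s.nat aLab v < s.nat vHt 0) ∨
      (s'.nat vPick 0 ∈ A ∧ s.nat vHt 0 ≤ s.nat aLab (s'.nat vPick 0)) := by
  rw [pick, runs_seq_nstore]
  simp only [NExpr.cost, NExpr.eval, hM]
  refine ⟨by omega, ?_⟩
  refine Runs.for M (fun j s' =>
      (s'.nat vPick 0 = M ∧ ∀ v ∈ A, v < j → s.nat aLab v < s.nat vHt 0) ∨
      (s'.nat vPick 0 ∈ A ∧ s.nat vHt 0 ≤ s.nat aLab (s'.nat vPick 0))) 30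
    (by decide) (by decide) (by decide) (by simp [hM]) (by simp) ?_ (by omega) ?_
  · intro j hj s₁ hI hf hij _
    have h9 : s₁.nat aRem = s.nat aRem := by rw [hf.1 _ (by decide)]; simp
    have h10 : s₁.nat aLab = s.nat aLab := by rw [hf.1 _ (by decide)]; simp
    have h26 : s₁.nat vHt = s.nat vHt := by rw [hf.1 _ (by decide)]; simp
    simp [hij, h9, h10, h26, hA.rem j hj]
    refine ⟨fun hjA hle _ => .inr ⟨hjA, hle⟩, fun hn _ => ?_⟩
    refine hI.imp (fun h => ⟨h.1, fun v hv hvj => ?_⟩) id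
    by_cases hvj' : v < j
    · exact h.2 v hv hvj'
    · have : v = j := by omega
      subst this
      exact hn hv
  · intro s₁ h _ _
    exact h.imp (fun h => ⟨h.1, fun v hv => h.2 v hv (hA.lt v hv)⟩) id

/-- Popping lowers the potential as well, so there are at most `2 * M` plus the initial height such
rounds, and one more to stop. At the end nothing remains and the stack is empty; the single table
entry is the answer. -/
theorem runs_mainLoop (hS : Separable n M k E adj V) (h : MainInv n M k w adj V V s) :
    Runs mainLoop s ((2 * M + s.nat vHt 0 + 1) * (sepTime M k E + M * 60 + 60) + 20) fun s' =>
      ∃ X, s'.nat aSel 0 = code X ∧ IsBest n w adj V ∅ ∅ X (s'.real aTab 0) := by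
  obtain ⟨K, hK⟩ : ∃ K, K = sepTime M k E + M * 60 + 60 := ⟨_, rfl⟩
  rw [← hK, mainLoop, runs_seq_nstore]
  simp only [NExpr.cost, NExpr.eval]
  refine ⟨by omega, ?_⟩
  refine Runs.loop (fun B s' => ∃ A, MainInv n M k w adj V A s' ∧
    ((s'.nat vDone 0 = 0 ∧ B = (2 * A.card + s'.nat vHt 0 + 1) * K) ∨
      (s'.nat vDone 0 = 1 ∧ A = ∅ ∧ s'.nat vHt 0 = 0 ∧ B = 0)))
    ((2 * V.card + s.nat vHt 0 + 1) * K) ?_ ?_ ?_ ?_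
  · refine ⟨V, h.congr (by simp) (by simp) (by simp) (by simp) (by simp) (by simp) (by simp)
      (by simp) (by simp) (by simp) (by simp) (by simp) (by simp), .inl ⟨by simp, by simp⟩⟩
  · rintro B s₁ ⟨A, h₁, hd⟩ hf hp
    simp only [BExpr.Holds, NExpr.eval] at hp
    obtain ⟨hd0, rfl⟩ : s₁.nat vDone 0 = 0 ∧ B = (2 * A.card + s₁.nat vHt 0 + 1) * K := by
      rcases hd with h | h
      · exact h
      · omega
    refine ⟨K - 4, ?_⟩
    have hbud : ∀ m, m < 2 * A.card + s₁.nat vHt 0 + 1 →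
        m * K + (K - 4) + 4 ≤ (2 * A.card + s₁.nat vHt 0 + 1) * K := by
      intro m hm
      have := Nat.mul_le_mul_right K (Nat.succ_le_of_lt hm)
      rw [Nat.succ_mul] at this
      omega
    refine (runs_pick h₁.data.graph.size h₁.alive).seq (T₂ := sepTime M k E + 36) ?_ (by omega)
    intro s₂ hpk hf₂
    have h₂ : MainInv n M k w adj V A s₂ :=
      h₁.congr (hf₂.1 _ (by decide)) (hf₂.1 _ (by decide)) (hf₂.1 _ (by decide))
        (hf₂.1 _ (by decide)) (hf₂.1 _ (by decide)) (hf₂.2 _ (by decide)) (hf₂.1 _ (by decide))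
        (hf₂.1 _ (by decide)) (hf₂.1 _ (by decide)) (hf₂.1 _ (by decide)) (hf₂.1 _ (by decide))
        (hf₂.1 _ (by decide)) (hf₂.2 _ (by decide))
    have hht₂ : s₂.nat vHt = s₁.nat vHt := hf₂.1 _ (by decide)
    have hlab₂ : s₂.nat aLab = s₁.nat aLab := hf₂.1 _ (by decide)
    have hdone₂ : s₂.nat vDone 0 = 0 := by rw [hf₂.1 _ (by decide), hd0]
    rw [runs_ite]
    simp only [BExpr.cost, NExpr.cost, BExpr.Holds, NExpr.eval, h₂.data.graph.size]
    refine ⟨by omega, fun hlt => ?_, fun hge => ?_⟩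
    · rcases hpk with ⟨he, _⟩ | ⟨hpA, hple⟩
      · omega
      · rw [← hlab₂, ← hht₂] at hple
        refine (runs_separate hS h₂ rfl hpA hple).frame.mono (by omega) ?_
        rintro s₃ ⟨⟨A', h₃, hdec⟩, hf₃⟩
        refine ⟨_, hbud (2 * A'.card + s₃.nat vHt 0 + 1) (by rw [hht₂] at hdec; omega), A', h₃,
          .inl ⟨by rw [hf₃.1 _ (by decide), hdone₂], rfl⟩⟩
    · rcases hpk with ⟨he, hlow⟩ | ⟨hpA, hple⟩
      swap
      · exact absurd (h₂.alive.lt _ hpA) (by omega)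
      rw [runs_ite]
      simp only [BExpr.cost, NExpr.cost, BExpr.Holds, NExpr.eval]
      refine ⟨by omega, fun h0 => ?_, fun h0 => ?_⟩
      · rw [runs_nstore]
        simp only [NExpr.cost, NExpr.eval]
        refine ⟨by omega, 0, ?_, A, h₂.congr (by simp) (by simp) (by simp) (by simp) (by simp)
          (by simp) (by simp) (by simp) (by simp) (by simp) (by simp) (by simp) (by simp),
          .inr ⟨by simp, ?_, ?_, rfl⟩⟩
        · have := hbud 0 (by omega)
          omega
        -- All labels are below the height, which is 0, so no vertex can remain.
        · refine Finset.eq_empty_of_forall_notMem fun v hv => ?_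
          have := hlow v hv
          rw [hht₂] at h0
          omega
        · simp
          omega
      · obtain ⟨d, hd⟩ : ∃ d, s₂.nat vHt 0 = d + 1 := ⟨s₂.nat vHt 0 - 1, by omega⟩
        refine (runs_forget h₂.data h₂.table (Finset.sdiff_subset.trans hS.lt) hd).frame.mono ?_ ?_
        · have h1 := h₂.height
          rw [hd, pow_succ] at h1
          have h2 : 2 ^ d ≤ (2 * M) ^ (k + 1) := by omega
          -- A pop is paid for by the term of `sepTime` that pays for the pushes.
          have h3 : (2 * M) ^ (k + 1) * 60 ≤
              (k + 1) * ((2 * M) ^ (k + 1) * (M * 60 + 120) + 110) :=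
            calc (2 * M) ^ (k + 1) * 60 ≤ (2 * M) ^ (k + 1) * (M * 60 + 120) :=
                  Nat.mul_le_mul_left _ (by omega)
              _ ≤ (2 * M) ^ (k + 1) * (M * 60 + 120) + 110 := by omega
              _ ≤ _ := Nat.le_mul_of_pos_left _ (by omega)
          simp only [sepTime]
          omega
        · rintro s₃ ⟨⟨hT, hht₃⟩, hf₃⟩
          have hlab₃ : s₃.nat aLab = s₁.nat aLab := by rw [hf₃.1 _ (by decide), hlab₂]
          have hstk₃ : s₃.nat aStk = s₂.nat aStk := hf₃.1 _ (by decide)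
          rw [hht₂] at hd
          refine ⟨_, hbud (2 * A.card + s₃.nat vHt 0 + 1) (by omega), A,
            ⟨h₂.data.frame hf₃ (by decide), h₂.alive.congr (hf₃.1 _ (by decide)), h₂.sub, hT,
            fun v hv => ?_, ?_, ?_, ?_⟩, .inl ⟨by rw [hf₃.1 _ (by decide), hdone₂], rfl⟩⟩
          -- No vertex could be picked, so all labels were below the old height and are at most the
          -- new one.
          · have := hlow v hv
            rw [hlab₃, hht₃]
            omega
          · rw [hlab₃, ← hlab₂, hstk₃]
            exact h₂.stack
          · rw [hlab₃, ← hlab₂]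
            exact h₂.level
          · refine le_trans (Nat.pow_le_pow_right two_pos ?_) h₂.height
            rw [hht₃, hht₂]
            omega
  · have : V.card ≤ M := by simpa using Finset.card_le_card hS.lt
    have := Nat.mul_le_mul_right K (show 2 * V.card + s.nat vHt 0 + 1 ≤ 2 * M + s.nat vHt 0 + 1 by
      omega)
    simp only [BExpr.cost, NExpr.cost]
    omega
  · rintro B s₁ ⟨A, h₁, hd⟩ hp
    simp only [BExpr.Holds, NExpr.eval] at hp
    rcases hd with h | ⟨_, rfl, hht, _⟩
    · omega
    · obtain ⟨X, hX, hbest⟩ := h₁.table.tab ∅ (by simp)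
      refine ⟨X, by simpa [code] using hX, ?_⟩
      simpa [hht, code] using hbest

end RAM

namespace RAM
open Program NExpr BExpr

/-! ### Reading the instance and writing the solution -/

/-- The machine cannot multiply: powers of two come from doubling, and the row starts of the
adjacency matrix in `offsets` from repeated addition. -/
def powers : Program :=
  .for vI vM (nstore aPow (var vI ⊹ #1) (load aPow (var vI) ⊹ load aPow (var vI)))

def offsets : Program :=
  .for vI vM (nstore aOff (var vI ⊹ #1) (load aOff (var vI) ⊹ var vM))

/-- Players count as removed until a reward is read for them. -/
def removePlayers : Program := .for vI 0 (nstore aRem (var vI) (#1))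

def prepare : Program :=
  set vM (load 0 (#0) ⊹ load 0 (#2)) ;; set vH (load 0 (#1)) ;; set vL (load 0 (#2)) ;;
  set vTsz (#1) ;; nstore aPow (#0) (#1) ;; powers ;; offsets ;; removePlayers

/-- A singleton is encoded by two cells, its cardinality and its element; hence the index `2 * i +
1`. -/
def readRewards : Program :=
  .for vI vH (set vU (load 1 (var vI ⊹ var vI ⊹ #1)) ;; nstore aRem (var vU) (#0) ;;
    rstore aWgt (var vU) (.add (.load aWgt (var vU)) (.load 0 (var vI))))

/-- Join the player `vU` and the penalty node `vNode` by an edge, unless the player has no reward, in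
which case the penalty can be avoided at no cost. -/
def link : Program :=
  .ite (nle (load aRem (var vU)) (#0))
    (nstore aAdj (load aOff (var vU) ⊹ var vNode) (#1) ;;
      nstore aAdj (load aOff (var vNode) ⊹ var vU) (#1))
    (rstore aWgt (var vNode) .zero)

def readSet : Program :=
  .for vQ vCard (set vU (load 2 (var vPtr)) ;; set vPtr (var vPtr ⊹ #1) ;; link)

def readPenalties : Program :=
  set vPtr (#0) ;;
  .for vI vL (set vNode (load 0 (#0) ⊹ var vI) ;; rstore aWgt (var vNode) (.load 1 (var vI)) ;;
    set vCard (load 2 (var vPtr)) ;; set vPtr (var vPtr ⊹ #1) ;; readSet)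

def output : Program :=
  rstore 2 (#0) (.load aTab (#0)) ;; set vTr (load aSel (#0)) ;; set vTj (load 0 (#0)) ;;
  .while (lt (#0) (var vTj))
    (set vTj (var vTj ⊖ #1) ;;
      .ite (nle (load aPow (var vTj)) (var vTr))
        (set vTr (var vTr ⊖ load aPow (var vTj)) ;; nstore aOut (var vTj) (#1)) .skip)

def program : Program := prepare ;; readRewards ;; readPenalties ;; mainLoop ;; output

/-- The instance in the memory: the `i`-th reward set is `{a i}` with the reward `r i`, the `j`-th
penalty set is `N j` with the penalty `b j` and starts in cell `p j`. -/
structure InputMem (n h l : ℕ) (a : ℕ → ℕ) (r : ℕ → ℝ) (N : ℕ → Finset ℕ) (b : ℕ → ℝ) (p : ℕ → ℕ)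
    (s : State) : Prop where
  players : s.nat 0 0 = n
  rewards : s.nat 0 1 = h
  penalties : s.nat 0 2 = l
  reward_set : ∀ i < h, s.nat 1 (i + i + 1) = a i
  lt : ∀ i < h, a i < n
  reward : ∀ i < h, s.real 0 i = r i
  penalty : ∀ j < l, s.real 1 j = b j
  start : p 0 = 0
  card : ∀ j < l, s.nat 2 (p j) = (N j).card
  mem : ∀ j < l, cells (fun i => s.nat 2 (p j + 1 + i)) (N j).card = N j
  next : ∀ j < l, p (j + 1) = p j + 1 + (N j).card
  sub : ∀ j < l, N j ⊆ Finset.range n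

theorem InputMem.congr {n h l : ℕ} {a : ℕ → ℕ} {r : ℕ → ℝ} {N : ℕ → Finset ℕ} {b : ℕ → ℝ}
    {p : ℕ → ℕ} {s s' : State} (hI : InputMem n h l a r N b p s) (h0 : s'.nat 0 = s.nat 0)
    (h1 : s'.nat 1 = s.nat 1) (h2 : s'.nat 2 = s.nat 2) (h3 : s'.real 0 = s.real 0)
    (h4 : s'.real 1 = s.real 1) : InputMem n h l a r N b p s' where
  players := h0 ▸ hI.players
  rewards := h0 ▸ hI.rewards
  penalties := h0 ▸ hI.penalties
  reward_set := h1 ▸ hI.reward_set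
  lt := hI.lt
  reward := h3 ▸ hI.reward
  penalty := h4 ▸ hI.penalty
  start := hI.start
  card := h2 ▸ hI.card
  mem := h2 ▸ hI.mem
  next := hI.next
  sub := hI.sub

/-- The players with a reward. -/
def covered (h : ℕ) (a : ℕ → ℕ) : Finset ℕ := cells a h

/-- The sum of the rewards of a player. -/
noncomputable def totalReward (h : ℕ) (a : ℕ → ℕ) (r : ℕ → ℝ) (u : ℕ) : ℝ :=
  ∑ i ∈ Finset.range h, if a i = u then r i else 0

/-- The graph on players with a reward and penalty nodes. -/
def linked (n : ℕ) (S : Finset ℕ) (N : ℕ → Finset ℕ) (x y : ℕ) : Prop :=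
  (x ∈ S ∧ n ≤ y ∧ x ∈ N (y - n)) ∨ (y ∈ S ∧ n ≤ x ∧ y ∈ N (x - n))

/-- The weights: only those penalties count whose players have rewards. -/
noncomputable def weight (n : ℕ) (S : Finset ℕ) (N : ℕ → Finset ℕ) (r b : ℕ → ℝ) (x : ℕ) : ℝ :=
  if x < n then r x else if N (x - n) ⊆ S then b (x - n) else 0

/-- The vertices of the graph. -/
def vertices (n M : ℕ) (S : Finset ℕ) : Finset ℕ := S ∪ Finset.Ico n M

variable {n h l M : ℕ} {a p : ℕ → ℕ} {r b : ℕ → ℝ} {N : ℕ → Finset ℕ} {S : Finset ℕ} {s : State}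

theorem runs_powers (hM : s.nat vM 0 = M) (h0 : s.nat aPow 0 = 1) :
    Runs powers s (M * 30 + 9) fun s' => ∀ i ≤ M, s'.nat aPow i = 2 ^ i := by
  refine Runs.for M (fun j s' => ∀ i ≤ j, s'.nat aPow i = 2 ^ i) 18 (by decide) (by decide)
    (by decide) hM ?_ ?_ le_rfl fun _ h _ _ => h
  · intro i hi
    obtain rfl : i = 0 := by omega
    simpa using h0
  · intro j hj s₁ hI _ hij _
    simp only [runs_nstore, NExpr.cost, NExpr.eval, hij, hI j le_rfl]
    refine ⟨by omega, fun _ i hi => ?_⟩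
    simp [Function.update_apply]
    split_ifs with hij'
    · rw [hij', pow_succ]
      omega
    · exact hI i (by omega)

theorem runs_offsets (hM : s.nat vM 0 = M) (h0 : s.nat aOff 0 = 0) :
    Runs offsets s (M * 30 + 9) fun s' => ∀ i < M, s'.nat aOff i = i * M := by
  refine Runs.for M (fun j s' => ∀ i ≤ j, s'.nat aOff i = i * M) 18 (by decide) (by decide)
    (by decide) hM ?_ ?_ le_rfl fun _ h _ _ i hi => h i hi.le
  · intro i hi
    obtain rfl : i = 0 := by omega
    simpa using h0
  · intro j hj s₁ hI _ hij hM'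
    simp only [runs_nstore, NExpr.cost, NExpr.eval, hij, hI j le_rfl, hM']
    refine ⟨by omega, fun _ i hi => ?_⟩
    simp [Function.update_apply]
    split_ifs with hij'
    · rw [hij', add_mul, one_mul]
    · exact hI i (by omega)

theorem runs_removePlayers (hn : s.nat 0 0 = n) (h0 : ∀ i, s.nat aRem i = 0) :
    Runs removePlayers s (n * 30 + 9) fun s' => ∀ i, s'.nat aRem i = 0 ↔ n ≤ i := by
  refine Runs.for n (fun j s' => ∀ i, s'.nat aRem i = 0 ↔ j ≤ i) 18 (by decide) (by decide)
    (by decide) hn ?_ ?_ le_rfl fun _ h _ _ => h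
  · simpa using h0
  · intro j hj s₁ hI _ hij _
    simp only [runs_nstore, NExpr.cost, NExpr.eval, hij]
    refine ⟨by omega, fun _ i => ?_⟩
    have := hI i
    simp only [nwrite_nat, if_true]
    rw [if_neg (by decide), Function.update_apply]
    split_ifs with hij'
    · simp [hij']
    · omega

/-- The state after `prepare`. -/
structure PrepMem (n M : ℕ) (s : State) : Prop where
  size : s.nat vM 0 = M
  off : ∀ v < M, s.nat aOff v = v * M
  pow : ∀ i ≤ M, s.nat aPow i = 2 ^ i
  rem : ∀ i, s.nat aRem i = 0 ↔ n ≤ i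

theorem runs_prepare (hI : InputMem n h l a r N b p s) (h6 : s.nat aOff 0 = 0)
    (h9 : ∀ i, s.nat aRem i = 0) :
    Runs prepare s ((n + l) * 90 + 100) fun s' => PrepMem n (n + l) s' ∧ s'.nat vH 0 = h ∧
      s'.nat vL 0 = l ∧ s'.nat vTsz 0 = 1 := by
  simp [prepare, hI.players, hI.rewards, hI.penalties]
  refine (runs_powers (M := n + l) (by simp) (by simp)).seq
    (T₂ := (n + l) * 60 + 30) ?_ (by omega)
  intro s₁ h₁ hf₁
  refine (runs_offsets (M := n + l) (by rw [hf₁.1 _ (by decide)]; simp)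
    (by rw [hf₁.1 _ (by decide)]; simpa using h6)).seq (T₂ := (n + l) * 30 + 20) ?_ (by omega)
  intro s₂ h₂ hf₂
  refine (runs_removePlayers (n := n)
    (by rw [hf₂.1 _ (by decide), hf₁.1 _ (by decide)]; simpa using hI.players)
    (by rw [hf₂.1 _ (by decide), hf₁.1 _ (by decide)]; simpa using h9)).frame.mono (by omega) ?_
  rintro s₃ ⟨h₃, hf₃⟩
  refine ⟨⟨?_, ?_, ?_, h₃⟩, ?_, ?_, ?_⟩
  · rw [hf₃.1 _ (by decide), hf₂.1 _ (by decide), hf₁.1 _ (by decide)]; simp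
  · rw [hf₃.1 _ (by decide)]; exact h₂
  · rw [hf₃.1 _ (by decide), hf₂.1 _ (by decide)]; exact h₁
  · rw [hf₃.1 _ (by decide), hf₂.1 _ (by decide), hf₁.1 _ (by decide)]; simp
  · rw [hf₃.1 _ (by decide), hf₂.1 _ (by decide), hf₁.1 _ (by decide)]; simp
  · rw [hf₃.1 _ (by decide), hf₂.1 _ (by decide), hf₁.1 _ (by decide)]; simp

/-- The invariant of `readRewards`: `j` rewards have been read. -/
structure RewardInv (n j : ℕ) (a : ℕ → ℕ) (r : ℕ → ℝ) (s : State) : Prop where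
  rem : ∀ i, s.nat aRem i = 0 ↔ n ≤ i ∨ i ∈ covered j a
  wgt : ∀ i, s.real aWgt i = totalReward j a r i

theorem runs_readRewards (hI : InputMem n h l a r N b p s) (hh : s.nat vH 0 = h)
    (h9 : ∀ i, s.nat aRem i = 0 ↔ n ≤ i) (h3 : ∀ i, s.real aWgt i = 0) :
    Runs readRewards s (h * 60 + 9) (RewardInv n h a r) := by
  refine Runs.for h (fun j s' => RewardInv n j a r s') 48 (by decide) (by decide) (by decide) hh
    ⟨by simpa [covered] using h9, by simpa [totalReward] using h3⟩ ?_ le_rfl fun _ h _ _ => h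
  intro j hj s₁ h₁ hf hij _
  have hI₁ := hI.congr (hf.1 _ (by decide)) (hf.1 _ (by decide)) (hf.1 _ (by decide))
    (hf.2 _ (by decide)) (hf.2 _ (by decide))
  simp [hij, hI₁.reward_set j hj, hI₁.reward j hj]
  refine fun _ => ⟨fun i => ?_, fun i => ?_⟩
  · have : covered (j + 1) a = insert (a j) (covered j a) := by
      rw [covered, cells, Finset.range_add_one, Finset.image_insert, covered, cells]
    simp [this, Function.update_apply]
    by_cases hi : i = a j
    · simp [hi]
    · simpa [hi] using h₁.rem i
  · rw [totalReward, Finset.sum_range_succ, ← totalReward, ← h₁.wgt i]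
    simp [Function.update_apply]
    split_ifs with hi h' h'
    · simp [hi]
    · exact absurd hi.symm h'
    · exact absurd h'.symm hi
    · simp

/-- The state while the penalties are being read. -/
structure PenaltyMem (n M : ℕ) (S : Finset ℕ) (N : ℕ → Finset ℕ) (r b : ℕ → ℝ) (s : State) :
    Prop where
  graph : GraphMem M (linked n S N) s
  rem : ∀ i, s.nat aRem i = 0 ↔ n ≤ i ∨ i ∈ S
  wgt : ∀ x < M, s.real aWgt x = weight n S N r b x

theorem PenaltyMem.congr {s' : State} (h : PenaltyMem n M S N r b s) (h4 : s'.nat vM = s.nat vM)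
    (h6 : s'.nat aOff = s.nat aOff) (h7 : s'.nat aAdj = s.nat aAdj)
    (h9 : s'.nat aRem = s.nat aRem) (h3 : s'.real aWgt = s.real aWgt) :
    PenaltyMem n M S N r b s' :=
  ⟨h.graph.congr h4 h6 h7, h9 ▸ h.rem, h3 ▸ h.wgt⟩

theorem cell_eq_iff {x y x' y' : ℕ} (hy : y < M) (hy' : y' < M) :
    x * M + y = x' * M + y' ↔ x = x' ∧ y = y' := by
  refine ⟨fun h => ?_, fun h => by rw [h.1, h.2]⟩
  have h1 := congrArg (· / M) h
  have hM : 0 < M := by omega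
  simp only [mul_comm _ M, Nat.mul_add_div hM, Nat.div_eq_of_lt hy, Nat.div_eq_of_lt hy'] at h1
  have : x = x' := by omega
  subst this
  omega

theorem GraphMem.insert {adj : ℕ → ℕ → Prop} {x y : ℕ} (h : GraphMem M adj s) (hx : x < M)
    (hy : y < M) :
    GraphMem M (fun v w => adj v w ∨ (v = x ∧ w = y) ∨ (v = y ∧ w = x))
      ((s.nwrite aAdj (x * M + y) 1).nwrite aAdj (y * M + x) 1) := by
  refine ⟨by simpa using h.size, by simpa using h.off, fun v hv w hw => ?_⟩
  simp [Function.update_apply, cell_eq_iff hw hx, cell_eq_iff hw hy]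
  rw [← h.adj v hv w hw]
  split_ifs with h1 h2
  · simp [h1]
  · simp [h2]
  · tauto

theorem linked_update {u j x y : ℕ} : linked n S (Function.update N j (insert u (N j))) x y ↔
    linked n S N x y ∨ u ∈ S ∧ ((x = u ∧ y = n + j) ∨ (x = n + j ∧ y = u)) := by
  have key : ∀ x y, (x ∈ S ∧ n ≤ y ∧ x ∈ Function.update N j (insert u (N j)) (y - n)) ↔
      (x ∈ S ∧ n ≤ y ∧ x ∈ N (y - n)) ∨ u ∈ S ∧ x = u ∧ y = n + j := by
    intro x y
    rw [Function.update_apply]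
    by_cases hy : n ≤ y
    · split_ifs with hj
      · have : y = n + j := by omega
        subst this
        by_cases hx : x = u
        · subst hx
          simp
          tauto
        · simp [hx]
      · have : y ≠ n + j := by omega
        simp [this]
    · have : y ≠ n + j := by omega
      simp [hy, this]
  rw [linked, linked, key, key]
  tauto

theorem PenaltyMem.runs_link {u j : ℕ} (h : PenaltyMem n M S N r b s) (hu : u < n) (hj : n + j < M)
    (h1 : s.nat vU 0 = u) (h2 : s.nat vNode 0 = n + j) :
    Runs link s 40 (PenaltyMem n M S (Function.update N j (insert u (N j))) r b) := by
  have hw : ∀ x, x ≠ n + j → weight n S (Function.update N j (insert u (N j))) r b x =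
      weight n S N r b x := by
    intro x hx
    rw [weight, weight]
    split_ifs with h1 h2 h3 h3 <;> first | rfl | (rw [Function.update_of_ne (by omega)] at h2; tauto)
  have hrem := h.rem u
  simp [link, h1, h2, h.graph.off u (by omega), h.graph.off (n + j) hj, hrem]
  rw [show n ≤ u ↔ False by simp; omega, false_or]
  refine ⟨fun huS => ?_, fun _ huS => ?_⟩
  · have hg := h.graph.insert (x := u) (y := n + j) (by omega) hj
    refine ⟨⟨by simpa using hg.size, by simpa using hg.off, fun v hv w hw => ?_⟩,
      by simpa using h.rem, fun x hx => ?_⟩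
    · rw [linked_update]
      simpa [huS] using hg.adj v hv w hw
    · rw [nwrite_real, nwrite_real, h.wgt x hx]
      by_cases hxj : x = n + j
      · subst hxj
        simp [weight, Finset.insert_subset_iff, huS]
      · exact (hw x hxj).symm
  · refine ⟨⟨by simpa using h.graph.size, by simpa using h.graph.off, fun v hv w hw => ?_⟩,
      by simpa using h.rem, fun x hx => ?_⟩
    · rw [linked_update]
      simpa [huS] using h.graph.adj v hv w hw
    · rw [rwrite_real, if_pos rfl, Function.update_apply]
      split_ifs with hxj
      · subst hxj
        simp [weight, Finset.insert_subset_iff, huS]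
      · rw [h.wgt x hx, hw x hxj]

/-- The invariant of `readSet`: the elements `X` of the penalty set `j` have been read. -/
structure SetInv (n M j q : ℕ) (S X : Finset ℕ) (N : ℕ → Finset ℕ) (r b : ℕ → ℝ) (s : State) :
    Prop where
  mem : PenaltyMem n M S (Function.update N j X) r b s
  ptr : s.nat vPtr 0 = q

theorem cells_succ (q : ℕ → ℕ) (c : ℕ) : cells q (c + 1) = insert (q c) (cells q c) := by
  rw [cells, Finset.range_add_one, Finset.image_insert, cells]

theorem runs_readSet {c j q : ℕ} (h : SetInv n M j q S ∅ N r b s) (hj : n + j < M)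
    (h2 : s.nat vNode 0 = n + j) (hc : s.nat vCard 0 = c) (hq : ∀ i < c, s.nat 2 (q + i) < n) :
    Runs readSet s (c * 80 + 9)
      (SetInv n M j (q + c) S (cells (fun i => s.nat 2 (q + i)) c) N r b) := by
  refine Runs.for c (fun i s' => SetInv n M j (q + i) S (cells (fun i => s.nat 2 (q + i)) i) N r b s')
    68 (by decide) (by decide) (by decide) hc
    ⟨h.mem.congr (by simp) (by simp) (by simp) (by simp) (by simp), by simpa using h.ptr⟩
    ?_ le_rfl fun _ h _ _ => h
  intro i hi s₁ h₁ hf _ _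
  have hnode : s₁.nat vNode 0 = n + j := by rw [hf.1 _ (by decide), h2]
  have harr : s₁.nat 2 = s.nat 2 := hf.1 _ (by decide)
  rw [runs_seq_nstore]
  simp only [NExpr.cost, NExpr.eval, h₁.ptr, harr]
  refine ⟨by omega, ?_⟩
  rw [runs_seq_nstore]
  simp only [NExpr.cost, NExpr.eval]
  refine ⟨by omega, ?_⟩
  refine (PenaltyMem.runs_link (u := s.nat 2 (q + i)) (j := j)
    (h₁.mem.congr (by simp) (by simp) (by simp) (by simp) (by simp)) (hq i hi) hj (by simp)
    (by simpa using hnode)).frame.mono (by omega) ?_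
  rintro s₂ ⟨h₃, hf₂⟩ _
  rw [Function.update_idem, Function.update_self] at h₃
  refine ⟨?_, ?_⟩
  · rw [cells_succ]
    exact h₃.congr (by simp) (by simp) (by simp) (by simp) (by simp)
  · rw [nwrite_nat, if_neg (by decide), hf₂.1 _ (by decide)]
    simp [h₁.ptr, add_assoc]

/-- The invariant of `readPenalties`: `j` penalty sets have been read. -/
structure PenaltyInv (n M j q : ℕ) (S : Finset ℕ) (N : ℕ → Finset ℕ) (r b : ℕ → ℝ) (s : State) :
    Prop where
  mem : PenaltyMem n M S (fun i => if i < j then N i else ∅) r (fun i => if i < j then b i else 0) s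
  ptr : s.nat vPtr 0 = q

/-- Sets that are not yet read count as empty with penalty zero. Set `j` starts out empty with its
full penalty, which is the right weight because `∅ ⊆ S`. -/
theorem PenaltyMem.start {r' : ℕ → ℝ} {j : ℕ}
    (h : PenaltyMem n M S (fun i => if i < j then N i else ∅) r (fun i => if i < j then b i else 0) s)
    (h3 : r' = Function.update (s.real aWgt) (n + j) (b j)) {s' : State}
    (h4 : s'.nat vM = s.nat vM)
    (h6 : s'.nat aOff = s.nat aOff) (h7 : s'.nat aAdj = s.nat aAdj)
    (h9 : s'.nat aRem = s.nat aRem) (hr : s'.real aWgt = r') :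
    PenaltyMem n M S (Function.update (fun i => if i < j then N i else ∅) j ∅) r
      (fun i => if i < j + 1 then b i else 0) s' := by
  have hN : Function.update (fun i => if i < j then N i else ∅) j ∅ =
      fun i => if i < j then N i else ∅ := by
    rw [Function.update_eq_self_iff]
    simp
  rw [hN]
  refine ⟨h.graph.congr h4 h6 h7, h9 ▸ h.rem, fun x hx => ?_⟩
  rw [hr, h3, Function.update_apply]
  split_ifs with hxj
  · subst hxj
    simp [weight]
  · rw [h.wgt x hx, weight, weight]
    split_ifs with h1 h2 h3 h4 <;> first | rfl | omega

theorem runs_readPenalties (hI : InputMem n h l a r N b p s) (hL : s.nat vL 0 = l)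
    (hM : s.nat vM 0 = n + l) (hoff : ∀ v < n + l, s.nat aOff v = v * (n + l))
    (hrem : ∀ i, s.nat aRem i = 0 ↔ n ≤ i ∨ i ∈ S) {R : ℕ → ℝ} (hwgt : ∀ i, s.real aWgt i = R i)
    (hR : ∀ i, n ≤ i → R i = 0) (hadj : ∀ i, s.nat aAdj i = 0) :
    Runs readPenalties s (l * (n * 80 + 60) + 20) (PenaltyMem n (n + l) S N R b) := by
  rw [readPenalties, runs_seq_nstore]
  simp only [NExpr.cost, NExpr.eval]
  refine ⟨by omega, ?_⟩
  refine Runs.for l (fun j s' => PenaltyInv n (n + l) j (p j) S N R b s') (n * 80 + 48) (by decide)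
    (by decide) (by decide) (by simpa using hL) ?_ ?_
    (by rw [show n * 80 + 48 + 12 = n * 80 + 60 from rfl]; omega) ?_
  · refine ⟨⟨⟨by simpa using hM, by simpa using hoff, ?_⟩, by simpa using hrem, fun x _ => ?_⟩, ?_⟩
    · simp [hadj, linked]
    · have := hR x
      simp [weight, hwgt]
      exact this
    · simp [hI.start]
  · intro j hj s₁ h₁ hf hij _
    have hI₁ := hI.congr (s' := s₁) (by rw [hf.1 _ (by decide)]; simp)
      (by rw [hf.1 _ (by decide)]; simp) (by rw [hf.1 _ (by decide)]; simp)
      (by rw [hf.2 _ (by decide)]; simp) (by rw [hf.2 _ (by decide)]; simp)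
    have hcard : (N j).card ≤ n := by simpa using Finset.card_le_card (hI.sub j hj)
    rw [runs_seq_nstore]
    simp only [NExpr.cost, NExpr.eval, hij, hI₁.players]
    refine ⟨by omega, ?_⟩
    rw [runs_seq_rstore]
    simp [hij, hI₁.penalty j hj, h₁.ptr, hI₁.card j hj]
    refine (runs_readSet (j := j) (q := p j + 1) (c := (N j).card)
      ⟨h₁.mem.start (b := b) rfl (by simp) (by simp) (by simp) (by simp) (by simp), by simp⟩
      (by omega) (by simp) (by simp) ?_).frame.mono (by omega) ?_
    · intro i hi
      have : s₁.nat 2 (p j + 1 + i) ∈ N j := by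
        rw [← hI₁.mem j hj]
        exact mem_cells.2 ⟨i, hi, rfl⟩
      simpa using Finset.mem_range.1 (hI.sub j hj this)
    · rintro s₂ ⟨h₂, hf₂⟩ _
      have hcells := h₂.mem
      simp only [nwrite_nat, rwrite_nat] at hcells
      simp only [if_neg (show ¬ 2 = vPtr by decide), if_neg (show ¬ 2 = vCard by decide),
        if_neg (show ¬ 2 = vNode by decide), hI₁.mem j hj] at hcells
      refine ⟨?_, ?_⟩
      · refine PenaltyMem.congr (s := s₂) ?_ (by simp) (by simp) (by simp) (by simp) (by simp)
        convert hcells using 1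
        funext i
        rw [Function.update_apply]
        split_ifs <;> first | rfl | omega | simp_all
      · rw [nwrite_nat, if_neg (by decide), h₂.ptr, hI.next j hj]
  · intro s₁ h₁ _ _
    have := h₁.mem
    refine ⟨⟨this.graph.size, this.graph.off, fun v hv w hw => ?_⟩, this.rem, fun x hx => ?_⟩
    · rw [this.graph.adj v hv w hw, linked, linked]
      have h1 : v - n < l ∨ ¬ n ≤ v := by omega
      have h2 : w - n < l ∨ ¬ n ≤ w := by omega
      rcases h1 with h1 | h1 <;> rcases h2 with h2 | h2 <;> simp [h1, h2]
    · rw [this.wgt x hx, weight, weight]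
      by_cases hxn : x < n
      · simp [hxn]
      · simp [hxn, show x - n < l by omega]

/-- The invariant of the loop in `output`: the players from `j` on have been treated. -/
structure OutputInv (n j : ℕ) (X : Finset ℕ) (s : State) : Prop where
  le : j ≤ n
  idx : s.nat vTj 0 = j
  rest : s.nat vTr 0 = code (X.filter (· < j))
  out : ∀ i, s.nat aOut i = if i ∈ X ∧ j ≤ i then 1 else 0

theorem runs_output {X : Finset ℕ} (hn : s.nat 0 0 = n) (hpow : ∀ i ≤ n, s.nat aPow i = 2 ^ i)
    (h3 : ∀ i, s.nat aOut i = 0) (hX : X ⊆ Finset.range n) (hs : s.nat aSel 0 = code X) :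
    Runs output s (n * 40 + 40) fun s' => s'.real 2 0 = s.real aTab 0 ∧
      ∀ i, s'.nat aOut i = if i ∈ X then 1 else 0 := by
  have hXn : ∀ i ∈ X, i < n := fun i hi => Finset.mem_range.1 (hX hi)
  simp [output, hn, hs]
  refine Runs.mono (Runs.loop (T := n * 40 + 20) (fun B s' => ∃ j, OutputInv n j X s' ∧ B = j * 40)
    (n * 40) ⟨n, ⟨le_rfl, by simp, ?_, fun i => ?_⟩, rfl⟩ ?_ ?_
    (R := fun s' => ∀ i, s'.nat aOut i = if i ∈ X then 1 else 0) ?_).frame (by omega) ?_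
  · simp
    congr 1
    ext i
    simpa using hXn i
  · have := hXn i
    simp [h3]
    omega
  · rintro B s₁ ⟨j, h₁, rfl⟩ hf hp
    have hpow₁ : s₁.nat aPow = s.nat aPow := by rw [hf.1 _ (by decide)]; simp
    simp [h₁.idx] at hp
    obtain ⟨j, rfl⟩ : ∃ i, j = i + 1 := ⟨j - 1, by omega⟩
    have hle := h₁.le
    have hlt := code_filter_lt X j
    have hcode := code_filter_range_succ X j
    refine ⟨30, ?_⟩
    have hrest := h₁.rest.trans hcode
    simp [h₁.idx, hpow₁, hpow j (by omega), hrest]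
    refine ⟨fun hj => ?_, fun hj => ?_⟩
    · have hjX : j ∈ X := by
        by_contra hjX
        rw [if_neg hjX] at hj
        omega
      refine ⟨j, by omega, by omega, by simp, ?_, fun i => ?_⟩
      · simp [hjX]
      · by_cases hi : i = j
        · simp [hi, hjX]
        · have : j < i ↔ j ≤ i := by omega
          simp [h₁.out, hi, this]
    · have hjX : j ∉ X := fun hjX => by
        rw [if_pos hjX] at hj
        omega
      refine ⟨j, by omega, by omega, by simp, ?_, fun i => ?_⟩
      · simp [hrest, hjX]
      · by_cases hi : i = j
        · simp [hi, hjX, h₁.out]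
        · have : j < i ↔ j ≤ i := by omega
          simp [h₁.out, this]
  · simp
  · rintro B s₁ ⟨j, h₁, rfl⟩ hp
    simp [h₁.idx] at hp
    subst hp
    simpa using h₁.out
  · rintro s₁ ⟨h₁, hf₁⟩
    exact ⟨by rw [hf₁.2 _ (by decide)]; simp, h₁⟩

/-- Before anything is processed, the only entry is that of the empty set, with value 0 and empty
selection: exactly the zero memory. All labels and levels are 0. -/
theorem MainInv.initial {k : ℕ} {w : ℕ → ℝ} {adj : ℕ → ℕ → Prop} {V : Finset ℕ}
    (hD : DataMem n M w adj s) (hA : AliveMem M V s) (hT : s.nat vTsz 0 = 1)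
    (hH : s.nat vHt 0 = 0) (hL : ∀ v, s.nat aLab v = 0) (hS : s.nat aSel 0 = 0)
    (ht : s.real aTab 0 = 0) (hM : 1 ≤ M) : MainInv n M k w adj V V s := by
  refine ⟨hD, hA, subset_rfl, ⟨by simp [hT, hH], by simp [hH], by simp [hH], fun Y hY => ?_⟩,
    by simp [hL], by simp, fun v hv => ⟨0, by simp [hL], ?_⟩, ?_⟩
  · obtain rfl : Y = ∅ := by simpa [hH] using hY
    refine ⟨∅, by simp [code, hS], ?_, ?_, ?_⟩
    · simp [Feasible, hH]
    · simp [gain, paid, code, ht]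
    · intro X hX
      obtain rfl : X = ∅ := Finset.eq_empty_of_forall_notMem fun u hu => by
        have := (hX.1 u hu).1
        simp at this
      simp [gain, paid, code, ht]
  · simpa using (Finset.card_le_card comp_subset).trans hA.card_le
  · rw [hH]
    exact Nat.one_le_pow _ _ (by omega)

/-- The running time of the program. -/
def runTime (n h l k E : ℕ) : ℕ :=
  (n + l) * 90 + 100 + (h * 60 + 9 + (l * (n * 80 + 60) + 20 +
    ((2 * (n + l) + 1) * (sepTime (n + l) k E + (n + l) * 60 + 60) + 20 + (n * 40 + 40))))

theorem runs_program {k E : ℕ} (hI : InputMem n h l a r N b p s) (hn : 1 ≤ n)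
    (hn0 : ∀ i ≥ 3, ∀ x, s.nat i x = 0) (hr0 : ∀ i ≥ 2, ∀ x, s.real i x = 0)
    (hS : Separable n (n + l) k E (linked n (covered h a) N) (vertices n (n + l) (covered h a))) :
    Runs program s (runTime n h l k E) fun s' => ∃ X, IsBest n
      (weight n (covered h a) N (totalReward h a r) b) (linked n (covered h a) N)
      (vertices n (n + l) (covered h a)) ∅ ∅ X (s'.real 2 0) ∧
      ∀ i, s'.nat 3 i = if i ∈ X then 1 else 0 := by
  have hzn : ∀ i ≥ 3, s.nat i = 0 := fun i hi => funext (hn0 i hi)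
  have hzr : ∀ i ≥ 2, s.real i = 0 := fun i hi => funext (hr0 i hi)
  refine (runs_prepare hI (hn0 _ (by decide) _) (hn0 _ (by decide))).seq ?_ le_rfl
  rintro s₁ ⟨h₁, hH₁, hL₁, hT₁⟩ hf₁
  have hI₁ := hI.congr (hf₁.1 _ (by decide)) (hf₁.1 _ (by decide)) (hf₁.1 _ (by decide))
    (hf₁.2 _ (by decide)) (hf₁.2 _ (by decide))
  refine (runs_readRewards hI₁ hH₁ h₁.rem (by rw [hf₁.2 _ (by decide)]; exact hr0 _ (by decide))).seq
    ?_ le_rfl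
  intro s₂ h₂ hf₂
  have hI₂ := hI₁.congr (hf₂.1 _ (by decide)) (hf₂.1 _ (by decide)) (hf₂.1 _ (by decide))
    (hf₂.2 _ (by decide)) (hf₂.2 _ (by decide))
  have hR : ∀ i, n ≤ i → totalReward h a r i = 0 := fun i hi =>
    Finset.sum_eq_zero fun j hj => if_neg fun e => by
      have := hI.lt j (Finset.mem_range.1 hj)
      omega
  refine (runs_readPenalties hI₂ (by rw [hf₂.1 _ (by decide), hL₁])
    (by rw [hf₂.1 _ (by decide), h₁.size]) (by rw [hf₂.1 _ (by decide)]; exact h₁.off) h₂.rem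
    h₂.wgt hR (by rw [hf₂.1 _ (by decide), hf₁.1 _ (by decide)]; exact hn0 _ (by decide))).seq
    ?_ le_rfl
  intro s₃ h₃ hf₃
  have hpow₃ : s₃.nat aPow = s₁.nat aPow := by rw [hf₃.1 _ (by decide), hf₂.1 _ (by decide)]
  have hcl : ∀ r ∉ prepare.nats ++ (readRewards.nats ++ readPenalties.nats), 3 ≤ r →
      s₃.nat r = 0 := fun r hr h3 => by
    rw [List.mem_append, List.mem_append, not_or, not_or] at hr
    rw [hf₃.1 r hr.2.2, hf₂.1 r hr.2.1, hf₁.1 r hr.1, hzn r h3]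
  have hpl₃ : s₃.nat 0 = s.nat 0 := by
    rw [hf₃.1 _ (by decide), hf₂.1 _ (by decide), hf₁.1 _ (by decide)]
  have hht₃ : s₃.nat vHt = 0 := hcl _ (by decide) (by decide)
  have hA₃ : AliveMem (n + l) (vertices n (n + l) (covered h a)) s₃ := by
    refine ⟨fun x hx => Finset.mem_range.1 (hS.lt hx), fun x hx => ?_⟩
    rw [h₃.rem, vertices, Finset.mem_union, Finset.mem_Ico]
    tauto
  have hD₃ : DataMem n (n + l) (weight n (covered h a) N (totalReward h a r) b)
      (linked n (covered h a) N) s₃ :=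
    ⟨h₃.graph, by rw [hpl₃, hI.players], by rw [hpow₃]; exact h₁.pow, h₃.wgt⟩
  have hlab₃ : s₃.nat aLab = 0 := hcl _ (by decide) (by decide)
  have hsel₃ : s₃.nat aSel = 0 := hcl _ (by decide) (by decide)
  have htab₃ : s₃.real aTab = 0 := by
    rw [hf₃.2 _ (by decide), hf₂.2 _ (by decide), hf₁.2 _ (by decide), hzr _ (by decide)]
  have hT₃ : s₃.nat vTsz 0 = 1 := by rw [hf₃.1 _ (by decide), hf₂.1 _ (by decide), hT₁]
  have hloop := runs_mainLoop hS (MainInv.initial hD₃ hA₃ hT₃ (congrFun hht₃ 0) (congrFun hlab₃)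
    (congrFun hsel₃ 0) (congrFun htab₃ 0) (by omega))
  rw [hht₃] at hloop
  refine hloop.seq ?_ le_rfl
  rintro s₄ ⟨X, hX, hbest⟩ hf₄
  refine (runs_output (n := n) (X := X) ?_ ?_ (congrFun ?_) ?_ hX).mono le_rfl ?_
  · rw [hf₄.1 _ (by decide), hpl₃, hI.players]
  · rw [hf₄.1 _ (by decide), hpow₃]
    exact fun i hi => h₁.pow i (by omega)
  · rw [hf₄.1 _ (by decide)]
    exact hcl _ (by decide) (by decide)
  · exact fun u hu => Finset.mem_range.2 (hbest.1.1 u hu).2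
  · rintro s₅ ⟨h5, h6⟩
    exact ⟨X, by rw [h5]; exact hbest, h6⟩

end RAM

/-! ### The running time -/

theorem sepTime_le {M k E : ℕ} (hM : 1 ≤ M) (hE : 1 ≤ E) :
    RAM.sepTime M k E ≤ 1000 * ((k + 1) ^ 2 * E * M ^ 2) + 180 * ((k + 1) * (2 * M) ^ (k + 1) * M) := by
  -- Powers are made opaque, so that after expansion the monomials are atoms for `omega`.
  obtain ⟨K, hK⟩ : ∃ K, K = k + 1 := ⟨_, rfl⟩
  obtain ⟨F, hF⟩ : ∃ F, F = (2 * M) ^ (k + 1) := ⟨_, rfl⟩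
  have hK1 : 1 ≤ K := by omega
  rw [RAM.sepTime, ← hF, ← hK]
  have h1 : M ≤ M ^ 2 := Nat.le_self_pow two_ne_zero M
  have h2 : M ^ 2 ≤ K ^ 2 * E * M ^ 2 := Nat.le_mul_of_pos_left _ (by positivity)
  have h3 : K * E * M ≤ K ^ 2 * E * M ^ 2 :=
    Nat.mul_le_mul (Nat.mul_le_mul_right _ (Nat.le_self_pow two_ne_zero K)) h1
  have h4 : K * E * M ^ 2 ≤ K ^ 2 * E * M ^ 2 :=
    Nat.mul_le_mul (Nat.mul_le_mul_right _ (Nat.le_self_pow two_ne_zero K)) le_rfl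
  have h5 : K ^ 2 * E ≤ K ^ 2 * E * M ^ 2 := Nat.le_mul_of_pos_right _ (by positivity)
  have h6 : K * E ≤ K ^ 2 * E := Nat.mul_le_mul_right _ (Nat.le_self_pow two_ne_zero K)
  have h7 : K ≤ K * E := Nat.le_mul_of_pos_right _ hE
  have h8 : K * F ≤ K * F * M := Nat.le_mul_of_pos_right _ hM
  have e1 : M * (M * 60 + 100) = 60 * M ^ 2 + 100 * M := by ring
  have e2 : K * E * (M * (M * 60 + 240) + K * 80 + 100) =
    60 * (K * E * M ^ 2) + 240 * (K * E * M) + 80 * (K ^ 2 * E) + 100 * (K * E) := by ring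
  have e3 : K * (F * (M * 60 + 120) + 110) = 60 * (K * F * M) + 120 * (K * F) + 110 * K := by ring
  rw [e1, e2, e3]
  omega

theorem runTime_le {n h l k E : ℕ} (hn : 1 ≤ n) (hE : 1 ≤ E) :
    RAM.runTime n h l k E ≤ 4000 * ((k + 1) ^ 2 * E * (n + l) ^ 3) +
      600 * ((k + 1) * (2 * (n + l)) ^ (k + 1) * (n + l) ^ 2) + 60 * h := by
  obtain ⟨M, hM⟩ : ∃ M, M = n + l := ⟨_, rfl⟩
  have hM1 : 1 ≤ M := by omega
  have hs := sepTime_le (k := k) hM1 hE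
  rw [RAM.runTime, ← hM]
  obtain ⟨T, hT⟩ : ∃ T, T = RAM.sepTime M k E := ⟨_, rfl⟩
  rw [← hT] at hs ⊢
  obtain ⟨X, hX⟩ : ∃ X, X = (k + 1) ^ 2 * E := ⟨_, rfl⟩
  obtain ⟨F, hF⟩ : ∃ F, F = (k + 1) * (2 * M) ^ (k + 1) := ⟨_, rfl⟩
  rw [← hX, ← hF] at hs ⊢
  have hX1 : 1 ≤ X := by rw [hX]; exact Nat.mul_pos (by positivity) hE
  have h1 : M ≤ M ^ 2 := Nat.le_self_pow two_ne_zero M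
  have h2 : M ^ 2 ≤ X * M ^ 2 := Nat.le_mul_of_pos_left _ hX1
  have h3 : X * M ^ 2 ≤ X * M ^ 3 := Nat.mul_le_mul_left _ (Nat.pow_le_pow_right hM1 (by omega))
  have h4 : l * (n * 80 + 60) ≤ M * (M * 80 + 60) := Nat.mul_le_mul (by omega) (by omega)
  have h5 : (2 * M + 1) * (T + M * 60 + 60) ≤
      3 * M * ((1000 * (X * M ^ 2) + 180 * (F * M)) + M * 60 + 60) :=
    Nat.mul_le_mul (by omega) (by omega)
  have e1 : M * (M * 80 + 60) = 80 * M ^ 2 + 60 * M := by ring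
  have e2 : 3 * M * ((1000 * (X * M ^ 2) + 180 * (F * M)) + M * 60 + 60) =
    3000 * (X * M ^ 3) + 540 * (F * M ^ 2) + 180 * M ^ 2 + 180 * M := by ring
  rw [e1] at h4
  rw [e2] at h5
  omega

/-- If `N ^ (k - 1)` exceeds `2 ^ (16 * k ^ 2)`, it absorbs that factor and the exponent becomes `2
* (k + 1)`. Otherwise `k + 3 ≤ 5 * (k - 1)` bounds `N ^ (k + 3)` by `2 ^ (80 * k ^ 2)`. This is the
source of the constant `96 = 16 + 80`. -/
theorem two_pow_mul_le {N k : ℕ} (hk : 2 ≤ k) (hN : 1 ≤ N) :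
    2 ^ (16 * k ^ 2) * N ^ (k + 3) ≤ 2 ^ (96 * k ^ 3) + 2 ^ (k + 1) * (N ^ (k + 1)) ^ 2 := by
  rcases le_total (2 ^ (16 * k ^ 2)) (N ^ (k - 1)) with h | h
  · calc 2 ^ (16 * k ^ 2) * N ^ (k + 3) ≤ N ^ (k - 1) * N ^ (k + 3) := Nat.mul_le_mul_right _ h
      _ = (N ^ (k + 1)) ^ 2 := by
        rw [← pow_add, ← pow_mul]
        congr 1
        omega
      _ ≤ 2 ^ (k + 1) * (N ^ (k + 1)) ^ 2 := Nat.le_mul_of_pos_left _ (by positivity)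
      _ ≤ _ := Nat.le_add_left _ _
  · have h1 : N ^ (k + 3) ≤ 2 ^ (80 * k ^ 2) :=
      calc N ^ (k + 3) ≤ N ^ ((k - 1) * 5) := Nat.pow_le_pow_right hN (by omega)
        _ = (N ^ (k - 1)) ^ 5 := by rw [pow_mul]
        _ ≤ (2 ^ (16 * k ^ 2)) ^ 5 := Nat.pow_le_pow_left h 5
        _ = 2 ^ (80 * k ^ 2) := by
          rw [← pow_mul]
          congr 1
          ring
    calc 2 ^ (16 * k ^ 2) * N ^ (k + 3) ≤ 2 ^ (16 * k ^ 2) * 2 ^ (80 * k ^ 2) :=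
          Nat.mul_le_mul_left _ h1
      _ = 2 ^ (96 * k ^ 2) := by
        rw [← pow_add]
        congr 1
        ring
      _ ≤ 2 ^ (96 * k ^ 3) := Nat.pow_le_pow_right two_pos
        (Nat.mul_le_mul_left _ (Nat.pow_le_pow_right (by omega) (by omega)))
      _ ≤ _ := Nat.le_add_right _ _

/-- A bound for the size of components of a graph of treewidth at most `k`, raised to the power
`k + 1`. -/
def compBound (M k : ℕ) : ℕ := if k = 0 then 1 else M ^ (k + 1)

/-- The slack `2 ^ (3 * (k + 1))` between `n + l` and `N` lets the same estimate serve for `N = max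
n h + l` and for `N = n`. -/
theorem runTime_le_timeBound {n h l k N : ℕ} (hn : 1 ≤ n) (hN : 1 ≤ N)
    (hM : n + l ≤ 2 ^ (3 * (k + 1)) * N) (hh : h ≤ N) :
    RAM.runTime n h l k (compBound (n + l) k) ≤ 2 ^ 50 * RPSP.timeBound 96 N k := by
  obtain ⟨M, hM'⟩ : ∃ M, M = n + l := ⟨_, rfl⟩
  have hM1 : 1 ≤ M := by omega
  have hE : 1 ≤ compBound (n + l) k := by
    rw [compBound]
    split_ifs
    · rfl
    · exact Nat.one_le_pow _ _ (by omega)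
  refine (runTime_le hn hE).trans ?_
  rw [← hM'] at hM ⊢
  rw [RPSP.timeBound]
  rcases Nat.eq_zero_or_pos k with rfl | hk
  -- For `k = 0` the general search bound would be of degree 4, but only a cubic one is allowed;
  -- here components are single vertices and `compBound` is 1.
  · have h1 : M ^ 3 ≤ 2 ^ 9 * N ^ 3 := by
      calc M ^ 3 ≤ (2 ^ (3 * (0 + 1)) * N) ^ 3 := Nat.pow_le_pow_left hM 3
        _ = _ := by ring
    have h2 : N ≤ N ^ 3 := Nat.le_self_pow three_ne_zero N
    have e1 : (0 + 1) ^ 2 * compBound M 0 * M ^ 3 = M ^ 3 := by simp [compBound]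
    have e2 : (0 + 1) * (2 * M) ^ (0 + 1) * M ^ 2 = 2 * M ^ 3 := by ring
    have e3 : N * (2 ^ (96 * 0 ^ 3) + 2 ^ (0 + 1) * (N ^ (0 + 1)) ^ 2) = N + 2 * N ^ 3 := by
      simp
      ring
    rw [e1, e2, e3]
    omega
  · have hKK : (k + 1) ^ 2 ≤ 2 ^ (2 * (k + 1)) := by
      rw [mul_comm, pow_mul]
      exact Nat.pow_le_pow_left Nat.lt_two_pow_self.le 2
    have hKK' : k + 1 ≤ 2 ^ (2 * (k + 1)) := (Nat.le_self_pow two_ne_zero _).trans hKK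
    obtain ⟨D, hD⟩ : ∃ D, D = 2 ^ (3 * (k + 1) ^ 2 + 12 * (k + 1)) * N ^ (k + 4) := ⟨_, rfl⟩
    have hM4 : 2 ^ (3 * (k + 1)) * M ^ (k + 4) ≤ D := by
      calc 2 ^ (3 * (k + 1)) * M ^ (k + 4) ≤
            2 ^ (3 * (k + 1)) * (2 ^ (3 * (k + 1)) * N) ^ (k + 4) :=
          Nat.mul_le_mul_left _ (Nat.pow_le_pow_left hM _)
        _ = D := by
          rw [hD, mul_pow, ← mul_assoc, ← pow_mul, ← pow_add]
          congr 2
          ring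
    have h1 : (k + 1) ^ 2 * compBound M k * M ^ 3 ≤ D := by
      refine le_trans ?_ hM4
      rw [compBound, if_neg (by omega), mul_assoc, ← pow_add]
      exact Nat.mul_le_mul (hKK.trans (Nat.pow_le_pow_right two_pos (by omega))) le_rfl
    have h2 : (k + 1) * (2 * M) ^ (k + 1) * M ^ 2 ≤ D := by
      refine le_trans ?_ hM4
      calc (k + 1) * (2 * M) ^ (k + 1) * M ^ 2 = ((k + 1) * 2 ^ (k + 1)) * M ^ (k + 3) := by
            rw [mul_pow]
            ring
        _ ≤ (2 ^ (2 * (k + 1)) * 2 ^ (k + 1)) * M ^ (k + 4) :=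
          Nat.mul_le_mul (Nat.mul_le_mul_right _ hKK') (Nat.pow_le_pow_right hM1 (by omega))
        _ = _ := by
          rw [← pow_add]
          congr 2
          ring
    have h3 : h ≤ D := by
      rw [hD]
      refine (hh.trans (Nat.le_self_pow (by omega) N)).trans (Nat.le_mul_of_pos_left _ ?_)
      positivity
    -- The exponent of 2 in `D` is at most `16 * k ^ 2` for `k ≥ 2`. For `k = 1` it equals 36, and
    -- `N ^ 5` is exactly `N * (N ^ 2) ^ 2`.
    have h4 : D ≤ 2 ^ 36 * (N * (2 ^ (96 * k ^ 3) + 2 ^ (k + 1) * (N ^ (k + 1)) ^ 2)) := by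
      rcases Nat.lt_or_ge 1 k with hk2 | hk1
      · have h5 := Nat.mul_le_mul_left N (two_pow_mul_le hk2 hN)
        refine le_trans ?_ (h5.trans (Nat.le_mul_of_pos_left _ (by positivity)))
        have h6 : 3 * (k + 1) ^ 2 + 12 * (k + 1) ≤ 16 * k ^ 2 := by nlinarith
        calc D ≤ 2 ^ (16 * k ^ 2) * N ^ (k + 4) := by
              rw [hD]
              exact Nat.mul_le_mul_right _ (Nat.pow_le_pow_right two_pos h6)
          _ = _ := by ring
      · obtain rfl : k = 1 := by omega
        rw [hD]
        have : N ^ (1 + 4) = N * (N ^ (1 + 1)) ^ 2 := by ring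
        rw [this]
        have h7 : N * (N ^ (1 + 1)) ^ 2 ≤
            N * (2 ^ (96 * 1 ^ 3) + 2 ^ (1 + 1) * (N ^ (1 + 1)) ^ 2) :=
          Nat.mul_le_mul_left _ (by omega)
        exact Nat.mul_le_mul_left _ h7
    omega

/-! ### Separators from a tree decomposition -/

theorem RootedDecomposition.separable {W : Type} (R : RootedDecomposition W) {n M k : ℕ}
    {adj : ℕ → ℕ → Prop} {V : Finset ℕ} (hB : Bip n adj) (hV : V ⊆ Finset.range M) (φ : ℕ → W)
    (hφ : Set.InjOn φ V) (hk : ∀ t, (R.bag t).card ≤ k + 1)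
    (he : ∀ v ∈ V, ∀ w ∈ V, adj v w → ∃ t, φ v ∈ R.bag t ∧ φ w ∈ R.bag t) :
    RAM.Separable n M k (compBound M k) adj V := by
  refine ⟨hB, hV, fun A hA v hv => ?_, fun A hA v hv => ?_⟩
  · have hCV : comp adj A v ⊆ V := comp_subset.trans hA
    obtain ⟨S, hSC, hSk, hS⟩ := R.exists_balanced adj (comp adj A v) φ (hφ.mono hCV) k hk
      fun x hx y hy => he x (hCV hx) y (hCV hy)
    refine ⟨S, hSC, hSk, ?_, fun w hw => ?_⟩
    -- With an empty separator the component would be at most half of itself.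
    · by_contra hne
      obtain rfl := Finset.not_nonempty_iff_eq_empty.1 hne
      have hvC := self_mem_comp (adj := adj) hv
      have h1 := hS v (by simpa using hvC)
      have h2 := Finset.card_le_card (comp_sdiff_subset hvC (Finset.notMem_empty v))
      have h3 : 1 ≤ (comp adj A v).card := Finset.card_pos.2 ⟨v, hvC⟩
      rw [Finset.sdiff_empty (s := A)] at h2
      omega
    · obtain ⟨hwC, hwS⟩ := Finset.mem_sdiff.1 hw
      exact le_trans (Nat.mul_le_mul_left _ (Finset.card_le_card (comp_sdiff_subset hwC hwS)))
        (hS w hw)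
  · rw [compBound]
    split_ifs with h0
    -- Bags have at most one vertex and `φ` is injective, so adjacent vertices coincide.
    · subst h0
      have : comp adj A v ⊆ {v} := fun w hw => Finset.mem_singleton.2 <|
        comp_induct (p := fun w => w = v) rfl (fun x y hxy hx hy h => by
          obtain ⟨t, h1, h2⟩ := he x (hA hx) y (hA hy) hxy
          rw [← h]
          exact hφ (hA hy) (hA hx) (Finset.card_le_one.1 (hk t) _ h2 _ h1)) hw
      simpa using Finset.card_le_card this
    · refine Nat.pow_le_pow_left ?_ _
      simpa using Finset.card_le_card (comp_subset.trans (hA.trans hV))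

/-! ### The value of a selection -/

namespace RAM

variable {n h l : ℕ} {a : ℕ → ℕ} {r b : ℕ → ℝ} {N : ℕ → Finset ℕ} {S : Finset ℕ}

theorem bip_linked (hS : S ⊆ Finset.range n) : Bip n (linked n S N) := by
  intro x y hxy
  refine ⟨hxy.symm, ?_⟩
  rcases hxy with ⟨h1, h2, _⟩ | ⟨h1, h2, _⟩
  · have := Finset.mem_range.1 (hS h1)
    omega
  · have := Finset.mem_range.1 (hS h1)
    omega

theorem feasible_iff (hS : S ⊆ Finset.range n) {X : Finset ℕ} :
    Feasible n (vertices n (n + l) S) ∅ ∅ X ↔ X ⊆ S := by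
  simp only [Feasible, vertices, Finset.mem_union, Finset.mem_Ico, Finset.notMem_empty,
    false_imp_iff, implies_true, and_true]
  refine ⟨fun h u hu => ?_, fun h u hu => ⟨.inl (h hu), Finset.mem_range.1 (hS (h hu))⟩⟩
  rcases (h u hu).1 with h1 | h1
  · exact h1
  · have := (h u hu).2
    omega

/-- The graph sees only the covered part of a penalty set. If a set is not fully covered, its weight
is zero, and it is not contained in `X` either. -/
theorem gain_eq (hS : covered h a ⊆ Finset.range n) {X : Finset ℕ} (hX : X ⊆ covered h a) :
    gain n (weight n (covered h a) N (totalReward h a r) b) (linked n (covered h a) N)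
      (vertices n (n + l) (covered h a)) ∅ ∅ X =
    ∑ i ∈ Finset.range h, (if a i ∈ X then r i else 0) -
      ∑ j ∈ Finset.range l, if N j ⊆ X then b j else 0 := by
  classical
  rw [gain]
  congr 1
  · have hw : ∀ u ∈ X, weight n (covered h a) N (totalReward h a r) b u = totalReward h a r u :=
      fun u hu => if_pos (Finset.mem_range.1 (hS (hX hu)))
    refine (Finset.sum_congr rfl hw).trans ?_
    unfold totalReward
    rw [Finset.sum_comm]
    refine Finset.sum_congr rfl fun i _ => ?_
    rw [Finset.sum_ite_eq]
  · have h1 : paid n (linked n (covered h a) N) (vertices n (n + l) (covered h a)) ∅ ∅ X =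
        (Finset.Ico n (n + l)).filter fun x => N (x - n) ∩ covered h a ⊆ X := by
      ext x
      simp only [mem_paid, vertices, Finset.mem_union, Finset.mem_filter, Finset.mem_Ico,
        Finset.notMem_empty, false_imp_iff, true_and]
      constructor
      · rintro ⟨hx, hnx, h⟩
        have hx' : x < n + l := by
          rcases hx with hx | hx
          · have := Finset.mem_range.1 (hS hx)
            omega
          · exact hx.2
        refine ⟨⟨hnx, hx'⟩, fun u hu => ?_⟩
        rw [Finset.mem_inter] at hu
        exact h u (.inl hu.2) (Finset.mem_range.1 (hS hu.2)) (.inr ⟨hu.2, hnx, hu.1⟩)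
      · rintro ⟨⟨hnx, hx⟩, h⟩
        refine ⟨.inr ⟨hnx, hx⟩, hnx, fun u _ hun hux => h ?_⟩
        rcases hux with hux | hux
        · omega
        · exact Finset.mem_inter.2 ⟨hux.2.2, hux.1⟩
    rw [h1, Finset.sum_filter, Finset.sum_Ico_eq_sum_range, Nat.add_sub_cancel_left]
    refine Finset.sum_congr rfl fun j _ => ?_
    have hw : weight n (covered h a) N (totalReward h a r) b (n + j) =
        if N j ⊆ covered h a then b j else 0 := by simp [weight]
    rw [hw, Nat.add_sub_cancel_left]
    by_cases hNS : N j ⊆ covered h a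
    · rw [Finset.inter_eq_left.2 hNS, if_pos hNS]
    · have hNX : ¬ N j ⊆ X := fun hN => hNS (hN.trans hX)
      simp [hNS, hNX]

end RAM

/-! ### The instance in the memory -/

namespace RPSP

open RAM

theorem getD_flatten (L : List (List ℕ)) (j : ℕ) (hj : j < L.length) (i : ℕ)
    (hi : i < L[j].length) :
    L.flatten.getD ((L.take j).flatten.length + i) 0 = L[j].getD i 0 := by
  have h : L.flatten = (L.take j).flatten ++ (L[j] ++ (L.drop (j + 1)).flatten) := by
    rw [← List.flatten_cons, ← List.flatten_append, List.cons_getElem_drop_succ,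
      List.take_append_drop]
  rw [h, List.getD_append_right _ _ _ _ (Nat.le_add_right _ _), Nat.add_sub_cancel_left,
    List.getD_append _ _ _ _ hi]

theorem cells_getD (L : List ℕ) : cells (fun i => L.getD i 0) L.length = L.toFinset := by
  ext x
  rw [mem_cells, List.mem_toFinset, List.mem_iff_getElem]
  constructor
  · rintro ⟨i, hi, rfl⟩
    exact ⟨i, hi, (List.getD_eq_getElem _ _ hi).symm⟩
  · rintro ⟨i, hi, rfl⟩
    exact ⟨i, hi, List.getD_eq_getElem _ _ hi⟩

theorem exists_pointers {n m : ℕ} (F : Fin m → Finset (Fin n)) :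
    ∃ p : ℕ → ℕ, p 0 = 0 ∧ ∀ j : Fin m, p (j + 1) = p j + 1 + (F j).card ∧
      (encodeSets F).getD (p j) 0 = (F j).card ∧
      cells (fun i => (encodeSets F).getD (p j + 1 + i) 0) (F j).card =
        (F j).map Fin.valEmbedding := by
  obtain ⟨L, hL⟩ : ∃ L, L = List.ofFn fun i =>
    (F i).card :: ((F i).sort (· ≤ ·)).map Fin.val := ⟨_, rfl⟩
  have henc : encodeSets F = L.flatten := by rw [hL, encodeSets]
  refine ⟨fun j => (L.take j).flatten.length, by simp, fun j => ?_⟩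
  have hjL : (j : ℕ) < L.length := by simp [hL]
  have hLj : L[(j : ℕ)] = (F j).card :: ((F j).sort (· ≤ ·)).map Fin.val := by
    simp [hL]
  have hlen : L[(j : ℕ)].length = (F j).card + 1 := by simp [hLj]
  refine ⟨?_, ?_, ?_⟩
  · simp only
    rw [List.take_add_one, List.getElem?_eq_getElem hjL, List.flatten_append, List.length_append]
    simp [hlen]
    omega
  · rw [henc]
    have := getD_flatten L j hjL 0 (by omega)
    rw [add_zero] at this
    rw [this, hLj]
    rfl
  · have hl : (((F j).sort (· ≤ ·)).map Fin.val).length = (F j).card := by simp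
    have hc := cells_getD (((F j).sort (· ≤ ·)).map Fin.val)
    rw [hl] at hc
    rw [← show (((F j).sort (· ≤ ·)).map Fin.val).toFinset = (F j).map Fin.valEmbedding by
      ext x; simp, ← hc]
    refine Finset.image_congr fun i hi => ?_
    have hi' : i < (F j).card := by simpa using hi
    rw [henc, add_assoc, add_comm 1 i]
    rw [getD_flatten L j hjL (i + 1) (by omega)]
    simp only [hLj, List.getD_cons_succ]

variable (I : RPSP)

/-- The penalty sets as sets of natural numbers. -/
def penaltySet (j : ℕ) : Finset ℕ :=
  if h : j < I.l then (I.B ⟨j, h⟩).map Fin.valEmbedding else ∅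

theorem penaltySet_val (j : Fin I.l) : I.penaltySet j = (I.B j).map Fin.valEmbedding := by
  rw [penaltySet, dif_pos j.2]

variable {I}

theorem exists_inputMem (hI : I.RewardSingletons) :
    ∃ (a p : ℕ → ℕ) (r b : ℕ → ℝ), (∀ (i : Fin I.h) (u : Fin I.n), u ∈ I.A i ↔ a i = u) ∧
      (∀ i : Fin I.h, r i = I.a i) ∧ (∀ j : Fin I.l, b j = I.b j) ∧
      InputMem I.n I.h I.l a r I.penaltySet b p I.input := by
  obtain ⟨p, hp0, hp⟩ := exists_pointers I.B
  obtain ⟨q, hq0, hq⟩ := exists_pointers I.A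
  -- Blocks of singletons have length two, so no pointers are needed for the reward sets.
  have hqj : ∀ j ≤ I.h, q j = j + j := by
    intro j
    induction j with
    | zero => simp [hq0]
    | succ j ih =>
      intro hj
      have := (hq ⟨j, hj⟩).1
      rw [hI] at this
      simp only at this
      rw [this, ih (by omega)]
      omega
  have ha : ∀ (i : Fin I.h), ((encodeSets I.A).getD (i + i + 1) 0) ∈
      (I.A i).map Fin.valEmbedding := fun i => by
    rw [← (hq i).2.2, mem_cells, hI]
    exact ⟨0, one_pos, by rw [hqj i i.2.le, add_zero]⟩
  refine ⟨fun i => (encodeSets I.A).getD (i + i + 1) 0, p, fun i => (List.ofFn I.a).getD i 0,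
    fun j => (List.ofFn I.b).getD j 0, fun i u => ?_, fun i => ?_, fun j => ?_,
    ⟨rfl, rfl, rfl, fun _ _ => rfl, fun i hi => ?_, fun _ _ => rfl, fun _ _ => rfl, hp0,
      fun j hj => ?_, fun j hj => ?_, fun j hj => ?_, fun j hj => ?_⟩⟩
  · obtain ⟨x, hx, hxa⟩ := Finset.mem_map.1 (ha i)
    obtain ⟨y, hy⟩ := Finset.card_eq_one.1 (hI i)
    rw [hy, Finset.mem_singleton] at hx
    subst hx
    simp only
    rw [← hxa, hy, Finset.mem_singleton, eq_comm, Fin.ext_iff]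
    rfl
  · simp
  · simp
  · obtain ⟨x, _, hxa⟩ := Finset.mem_map.1 (ha ⟨i, hi⟩)
    simp only at hxa
    rw [← hxa]
    exact x.2
  · have := I.penaltySet_val ⟨j, hj⟩
    simp only at this
    rw [this, Finset.card_map]
    exact (hp ⟨j, hj⟩).2.1
  · have := I.penaltySet_val ⟨j, hj⟩
    simp only at this
    rw [this, Finset.card_map]
    exact (hp ⟨j, hj⟩).2.2
  · have := I.penaltySet_val ⟨j, hj⟩
    simp only at this
    rw [this, Finset.card_map]
    exact (hp ⟨j, hj⟩).1
  · intro x hx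
    have := I.penaltySet_val ⟨j, hj⟩
    simp only at this
    rw [this] at hx
    obtain ⟨u, _, rfl⟩ := Finset.mem_map.1 hx
    exact Finset.mem_range.2 u.2

/-! ### Optimality of the output, and separators for the instance -/

section

variable {a : ℕ → ℕ} {r b : ℕ → ℝ}

theorem profit_eq (ha : ∀ (i : Fin I.h) (u : Fin I.n), u ∈ I.A i ↔ a i = u)
    (hr : ∀ i : Fin I.h, r i = I.a i) (hb : ∀ j : Fin I.l, b j = I.b j) (Y : Finset (Fin I.n)) :
    I.profit Y = ∑ i ∈ Finset.range I.h, (if a i ∈ Y.map Fin.valEmbedding then r i else 0) -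
      ∑ j ∈ Finset.range I.l, if I.penaltySet j ⊆ Y.map Fin.valEmbedding then b j else 0 := by
  rw [profit, ← Fin.sum_univ_eq_sum_range
      (fun i => if a i ∈ Y.map Fin.valEmbedding then r i else 0),
    ← Fin.sum_univ_eq_sum_range
      (fun j => if I.penaltySet j ⊆ Y.map Fin.valEmbedding then b j else 0),
    Finset.sum_filter, Finset.sum_filter]
  congr 1
  · refine Finset.sum_congr rfl fun i _ => ?_
    rw [hr]
    refine if_congr ?_ rfl rfl
    rw [Finset.mem_map]
    constructor
    · rintro ⟨u, hu⟩
      rw [Finset.mem_inter] at hu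
      exact ⟨u, hu.2, ((ha i u).1 hu.1).symm⟩
    · rintro ⟨u, hu, hua⟩
      exact ⟨u, Finset.mem_inter.2 ⟨(ha i u).2 hua.symm, hu⟩⟩
  · refine Finset.sum_congr rfl fun j _ => ?_
    rw [hb, penaltySet_val]
    exact if_congr Finset.map_subset_map.symm rfl rfl

theorem exists_map_eq {n : ℕ} {X : Finset ℕ} (hX : X ⊆ Finset.range n) :
    ∃ Y : Finset (Fin n), Y.map Fin.valEmbedding = X := by
  refine ⟨Finset.univ.filter fun u => (u : ℕ) ∈ X, ?_⟩
  ext x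
  simp only [Finset.mem_map, Finset.mem_filter, Finset.mem_univ, true_and, Fin.valEmbedding_apply]
  exact ⟨by rintro ⟨u, hu, rfl⟩; exact hu, fun hx => ⟨⟨x, Finset.mem_range.1 (hX hx)⟩, hx, rfl⟩⟩

/-- The program optimises over covered players only. Intersecting any selection with these keeps all
rewards and, as penalties are nonnegative, cannot increase the total penalty. -/
theorem isSolution_of_isBest (ha : ∀ (i : Fin I.h) (u : Fin I.n), u ∈ I.A i ↔ a i = u)
    (hlt : ∀ i < I.h, a i < I.n)
    (hr : ∀ i : Fin I.h, r i = I.a i) (hb : ∀ j : Fin I.l, b j = I.b j) {s : State} {X : Finset ℕ}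
    (hX : IsBest I.n (weight I.n (covered I.h a) I.penaltySet (totalReward I.h a r) b)
      (linked I.n (covered I.h a) I.penaltySet) (vertices I.n (I.n + I.l) (covered I.h a)) ∅ ∅ X
      (s.real 2 0)) (hs : ∀ i, s.nat 3 i = if i ∈ X then 1 else 0) : I.IsSolution s := by
  have hS : covered I.h a ⊆ Finset.range I.n := fun x hx => by
    obtain ⟨i, hi, rfl⟩ := mem_cells.1 hx
    exact Finset.mem_range.2 (hlt i hi)
  have hXS := (feasible_iff hS).1 hX.1
  obtain ⟨Y, rfl⟩ := exists_map_eq (hXS.trans hS)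
  have hY : s.real 2 0 = I.profit Y := by
    rw [← hX.2.1, gain_eq hS hXS, profit_eq ha hr hb]
  refine ⟨Y, fun Z => ?_, fun u => ?_, hY⟩
  · have hZS : Z.map Fin.valEmbedding ∩ covered I.h a ⊆ covered I.h a := Finset.inter_subset_right
    have h1 := hX.2.2 _ ((feasible_iff hS).2 hZS)
    rw [gain_eq hS hZS, hY] at h1
    refine le_trans ?_ h1
    rw [profit_eq ha hr hb]
    refine sub_le_sub (le_of_eq ?_) ?_
    · refine Finset.sum_congr rfl fun i hi => if_congr ?_ rfl rfl
      have : a i ∈ covered I.h a := mem_cells.2 ⟨i, Finset.mem_range.1 hi, rfl⟩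
      rw [Finset.mem_inter, and_iff_left this]
    · refine Finset.sum_le_sum fun j hj => ?_
      have hbj : 0 ≤ b j := by
        have := hb ⟨j, Finset.mem_range.1 hj⟩
        simp only at this
        rw [this]
        exact I.b_nonneg _
      split_ifs with h2 h3
      · rfl
      · exact absurd (h2.trans Finset.inter_subset_left) h3
      · exact hbj
      · rfl
  · rw [hs]
    exact if_congr (Finset.mem_map' Fin.valEmbedding) rfl rfl

theorem adj_of_mem {i : Fin I.h} {j : Fin I.l} {u : Fin I.n} (hA : u ∈ I.A i) (hB : u ∈ I.B j) :
    I.reducedConnectionGraph.Adj (.inl i) (.inr j) := by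
  rw [reducedConnectionGraph, SimpleGraph.fromRel_adj]
  exact ⟨by simp, .inl ⟨i, j, u, rfl, rfl, hA, hB⟩⟩

/-- Choosing one reward set for every covered player embeds the graph of the program into the
reduced connection graph, so the tree decomposition applies although players with several reward
sets were merged. -/
theorem separable (ha : ∀ (i : Fin I.h) (u : Fin I.n), u ∈ I.A i ↔ a i = u)
    (hlt : ∀ i < I.h, a i < I.n) {k : ℕ} (R : RootedDecomposition (Fin I.h ⊕ Fin I.l))
    (hk : ∀ t, (R.bag t).card ≤ k + 1)
    (he : ∀ v w, I.reducedConnectionGraph.Adj v w → ∃ t, v ∈ R.bag t ∧ w ∈ R.bag t) :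
    Separable I.n (I.n + I.l) k (compBound (I.n + I.l) k)
      (linked I.n (covered I.h a) I.penaltySet) (vertices I.n (I.n + I.l) (covered I.h a)) := by
  have hS : covered I.h a ⊆ Finset.range I.n := fun x hx => by
    obtain ⟨i, hi, rfl⟩ := mem_cells.1 hx
    exact Finset.mem_range.2 (hlt i hi)
  have hV : vertices I.n (I.n + I.l) (covered I.h a) ⊆ Finset.range (I.n + I.l) := by
    intro x hx
    rw [vertices, Finset.mem_union, Finset.mem_Ico] at hx
    rw [Finset.mem_range]
    rcases hx with hx | hx
    · have := Finset.mem_range.1 (hS hx)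
      omega
    · exact hx.2
  have hnode : ∀ x ∈ vertices I.n (I.n + I.l) (covered I.h a), ∃ y : Fin I.h ⊕ Fin I.l,
      y.elim (fun i : Fin I.h => a i) (fun j : Fin I.l => I.n + j) = x := by
    intro x hx
    rw [vertices, Finset.mem_union, Finset.mem_Ico] at hx
    rcases hx with hx | hx
    · obtain ⟨i, hi, rfl⟩ := mem_cells.1 hx
      exact ⟨.inl ⟨i, hi⟩, rfl⟩
    · exact ⟨.inr ⟨x - I.n, by omega⟩, by simp; omega⟩
  -- `choose!` needs a default value for `φ` outside the vertex set.
  rcases isEmpty_or_nonempty (Fin I.h ⊕ Fin I.l) with hemp | hne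
  · have hVe : ∀ x, x ∉ vertices I.n (I.n + I.l) (covered I.h a) := fun x hx => by
      obtain ⟨y, _⟩ := hnode x hx
      exact hemp.false y
    exact ⟨bip_linked hS, hV, fun A hA v hv => absurd (hA hv) (hVe v),
      fun A hA v hv => absurd (hA hv) (hVe v)⟩
  choose! φ hφ using hnode
  have key : ∀ x ∈ vertices I.n (I.n + I.l) (covered I.h a),
      ∀ y ∈ vertices I.n (I.n + I.l) (covered I.h a), x ∈ covered I.h a → I.n ≤ y →
      x ∈ I.penaltySet (y - I.n) → I.reducedConnectionGraph.Adj (φ x) (φ y) := by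
    intro x hx y hy hxS hny hxy
    have h1 := hφ x hx
    have h2 := hφ y hy
    have hxn := Finset.mem_range.1 (hS hxS)
    rcases hφx : φ x with i | i
    · rcases hφy : φ y with j | j
      · rw [hφy] at h2
        have := hlt j j.2
        simp only [Sum.elim_inl] at h2
        omega
      · rw [hφx] at h1
        rw [hφy] at h2
        simp only [Sum.elim_inl, Sum.elim_inr] at h1 h2
        have hj : y - I.n = j := by omega
        rw [hj, penaltySet_val] at hxy
        obtain ⟨u, hu, rfl⟩ := Finset.mem_map.1 hxy
        exact adj_of_mem ((ha i u).2 h1) hu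
    · rw [hφx] at h1
      simp only [Sum.elim_inr] at h1
      omega
  refine R.separable (bip_linked hS) hV φ (fun x hx y hy hxy => ?_) hk fun x hx y hy hxy => ?_
  · rw [← hφ x hx, ← hφ y hy, hxy]
  · rcases hxy with ⟨h1, h2, h3⟩ | ⟨h1, h2, h3⟩
    · exact he _ _ (key x hx y hy h1 h2 h3)
    · exact he _ _ (key y hy x hx h1 h2 h3).symm

end

/-- Distinct penalty sets over covered players are distinct neighbourhoods, of which there are at
most `n * (k + 1) + n * 2 ^ (k + 1) + 1`; distinct singletons give `h ≤ n`. -/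
theorem size_le {k : ℕ} (hI : I.RewardSingletons) (R : RootedDecomposition (Fin I.h ⊕ Fin I.l))
    (hk : ∀ t, (R.bag t).card ≤ k + 1)
    (he : ∀ v w, I.reducedConnectionGraph.Adj v w → ∃ t, v ∈ R.bag t ∧ w ∈ R.bag t)
    (hn : 1 ≤ I.n) (hA : Function.Injective I.A) (hB : Function.Injective I.B)
    (hcov : ∀ u, ∃ i, u ∈ I.A i) : I.n + I.l ≤ 2 ^ (3 * (k + 1)) * I.n ∧ I.h ≤ I.n := by
  choose φ hφ using hcov
  have hone : ∀ i u u', u ∈ I.A i → u' ∈ I.A i → u = u' := fun i u u' h h' =>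
    Finset.card_le_one.1 (hI i).le _ h _ h'
  have hl := R.card_le_of_injective hk I.B hB (fun u => Sum.inl (φ u)) (fun j => Sum.inr j)
    (fun u u' h => hone (φ u) u u' (hφ u) (by rw [Sum.inl.inj h]; exact hφ u'))
    (fun j j' h => Sum.inr.inj h) fun j u hu => he _ _ (adj_of_mem (hφ u) hu)
  constructor
  · have h1 : k + 1 ≤ 2 ^ (k + 1) := Nat.lt_two_pow_self.le
    have h2 : 2 ≤ 2 ^ (k + 1) := Nat.le_self_pow (by omega) 2
    have h3 : 2 ^ (k + 1) * 4 ≤ 2 ^ (3 * (k + 1)) := by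
      rw [show 4 = 2 ^ 2 from rfl, ← pow_add]
      exact Nat.pow_le_pow_right two_pos (by omega)
    have h4 : I.n + I.l ≤ (2 + (k + 1) + 2 ^ (k + 1)) * I.n := by
      have : (2 + (k + 1) + 2 ^ (k + 1)) * I.n =
          I.n + I.n + I.n * (k + 1) + I.n * 2 ^ (k + 1) := by ring
      omega
    exact h4.trans (Nat.mul_le_mul_right _ (by omega))
  · have hne : ∀ i, ∃ u, u ∈ I.A i := fun i => Finset.card_pos.1 (by rw [hI i]; exact one_pos)
    choose ψ hψ using hne
    have : Function.Injective ψ := fun i i' h => hA <| by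
      ext u
      constructor
      · intro hu
        rw [hone i u _ hu (hψ i), h]
        exact hψ i'
      · intro hu
        rw [hone i' u _ hu (hψ i'), ← h]
        exact hψ i
    simpa using Fintype.card_le_of_injective ψ this

end RPSP

theorem mainTheorem3 :
    ∃ (P : RAM.Program) (C c : ℕ), ∀ I : RPSP, 1 ≤ I.n → I.RewardSingletons →
      ∀ k : ℕ, treewidth I.reducedConnectionGraph ≤ k →
        ∃ (t : ℕ) (s : RAM.State), RAM.Exec P I.input t s ∧ I.IsSolution s ∧
          t ≤ C * RPSP.timeBound c (max I.n I.h + I.l) k ∧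
          (Function.Injective I.A → Function.Injective I.B → (∀ u, ∃ i, u ∈ I.A i) →
            t ≤ C * RPSP.timeBound c I.n k) := by
  refine ⟨RAM.program, 2 ^ 50, 96, fun I hn hI k hk => ?_⟩
  -- The decomposition serves only to bound the running time; the program receives neither it nor
  -- `k`.
  obtain ⟨D, hD⟩ := exists_width_eq_treewidth I.reducedConnectionGraph
  obtain ⟨R, hR, he⟩ := D.exists_rooted
  have hRk : ∀ t, (R.bag t).card ≤ k + 1 := fun t => (hR t).trans (by omega)
  obtain ⟨a, p, r, b, ha, hr, hb, hM⟩ := RPSP.exists_inputMem hI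
  obtain ⟨t, s, hex, ht, X, hX, hs⟩ := RAM.runs_program hM hn
    (fun i hi x => by
      obtain ⟨i, rfl⟩ := Nat.exists_eq_add_of_le' hi
      rfl)
    (fun i hi x => by
      obtain ⟨i, rfl⟩ := Nat.exists_eq_add_of_le' hi
      rfl)
    (RPSP.separable ha hM.lt R hRk he)
  refine ⟨t, s, hex, RPSP.isSolution_of_isBest ha hM.lt hr hb hX hs, ht.trans ?_,
    fun hA hB hcov => ht.trans ?_⟩
  · refine runTime_le_timeBound hn (by omega) ?_ (by omega)
    exact le_trans (by omega) (Nat.le_mul_of_pos_left _ (by positivity))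
  · obtain ⟨h1, h2⟩ := RPSP.size_le hI R hRk he hn hA hB hcov
    exact runTime_le_timeBound hn hn h1 h2
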